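/- Let $\mathcal X,\mathcal Y$ be separable real Hilbert spaces, $\gamma$ a Borel probability measure on $\mathcal X$, $G_0:\mathcal X\to\mathcal Y$ Borel measurable, $\sigma>0$ and $n\ge 1$. One observes $(x_i,y_i)_{i=1}^n$ with $x_i\overset{\rm iid}{\sim}\gamma$ and $y_i=G_0(x_i)+\sigma\varepsilon_i$, where the noise $(\varepsilon_i)_{i=1}^n$ is independent of $(x_i)_{i=1}^n$ and is of one of the following two types. * White noise: the $\varepsilon_i$ are independent copies of the $\mathcal Y$-white noise process, i.e. the centred Gaussian process $(\langle\varepsilon_i,y\rangle)_{y\in\mathcal Y}$ with covariance $\mathrm{Cov}(\langle\varepsilon_i,y\rangle,\langle\varepsilon_i,y'\rangle)=\langle y,y'\rangle_{\mathcal Y}$, realised as usual by its series $\langle\varepsilon_i,y\rangle=\sum_j\langle y,\psi_j\rangle_{\mathcal Y}\langle\varepsilon_i,\psi_j\rangle$ in an orthonormal basis $(\psi_j)$ of $\mathcal Y$ (almost surely, for all $y$ for which the series converges). Here $\langle y_i,f\rangle:=\langle G_0(x_i),f\rangle_{\mathcal Y}+\sigma\langle\varepsilon_i,f\rangle$ for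 $f\in\mathcal Y$. * Sub-Gaussian noise: the $\varepsilon_i$ are independent random vectors in $\mathcal Y$ with $\mathbb E[\varepsilon_i]=0$ and $\mathbb P(\|\varepsilon_i\|_{\mathcal Y}\ge t)\le 2e^{-t^2/2}$ for all $t\ge 0$. For $F:\mathcal X\to\mathcal Y$ write $\|F\|_n^2=\frac1n\sum_{i=1}^n\|F(x_i)\|_{\mathcal Y}^2$, $\|F\|_{L^2(\gamma)}^2=\int\|F\|_{\mathcal Y}^2\,d\gamma$ and $\|F\|_{\infty,\mathrm{supp}(\gamma)}=\sup_{x\in\mathrm{supp}(\gamma)}\|F(x)\|_{\mathcal Y}$. Let $H(T,d,\rho)=\log N(T,d,\rho)$, where $N(T,d,\rho)$ is the minimal number of open $d$-balls of radius $\rho$ needed to cover the pseudometric space $(T,d)$. Let $\boldsymbol G$ be a class of measurable maps $\mathcal X\to\mathcal Y$ that is compact with respect to $\|\cdot\|_{\infty,\mathrm{supp}(\gamma)}$, assume $\|G_0\|_{\infty,\mathrm{supp}(\gamma)}<\infty$, and let $F_\infty<\infty$ satisfy $\sup_{G\in\boldsymbol G}\|G-G_0\|_{\infty,\mathrm{supp}(\gamma)}\le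 F_\infty$. For $G^*\in\boldsymbol G$ and $\delta>0$ put $\boldsymbol G_n^*(\delta)=\{G\in\boldsymbol G:\|G-G^*\|_n\le\delta\}$. Suppose that there is a deterministic function $\Psi_n:(0,\infty)\to[0,\infty)$ such that $\delta\mapsto\Psi_n(\delta)/\delta^2$ is non-increasing and such that, for every $G^*\in\boldsymbol G$ and for $\gamma^n$-almost every $(x_1,\dots,x_n)$, $$\int_0^\delta H^{1/2}\big(\boldsymbol G_n^*(\delta),\|\cdot\|_n,\rho\big)\,d\rho\le\Psi_n(\delta)\qquad\text{for all }\delta>0 .$$ Let $\hat G_n$ be any measurable empirical risk minimizer, i.e. a random element of $\boldsymbol G$, measurable with respect to the Borel $\sigma$-algebra of $\|\cdot\|_{\infty,\mathrm{supp}(\gamma)}$, which almost surely minimizes $$I_n(G)=\frac1n\sum_{i=1}^n\Big(-2\langle G(x_i),y_i\rangle_{\mathcal Y}+\|G(x_i)\|_{\mathcal Y}^2\Big)$$ over $G\in\boldsymbol G$. Then there is a universal constant $C>0$ (not depending on any of the above objects, nor on $n$) such that, whenever $\delta_n,\tilde\delta_n>0$ satisfy $$\sqrt n\,\delta_n^2\ge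 C\sigma\Psi_n(\delta_n)\qquad\text{and}\qquad n\tilde\delta_n^2\ge CF_\infty^2\,H\big(\boldsymbol G,\|\cdot\|_{\infty,\mathrm{supp}(\gamma)},\tilde\delta_n\big),$$ it holds that $$\mathbb E\Big[\|\hat G_n-G_0\|_{L^2(\gamma)}^2\Big]\le C\Big(\delta_n^2+\tilde\delta_n^2+\frac{\sigma^2+F_\infty^2}{n}\Big)+8\inf_{G^*\in\boldsymbol G}\|G^*-G_0\|_{L^2(\gamma)}^2 .$$ -/

import Mathlib

open MeasureTheory ProbabilityTheory Filter Topology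
open scoped ENNReal UniformConvergence

noncomputable section

namespace HilbertRegression

/-! ### Covering numbers and metric entropy -/

/-- The minimal number (possibly infinite) of open `d`-balls of radius `r` with centres in `A`
that are needed to cover `A`. -/
def coveringNumber {T : Type*} (d : T → T → ℝ≥0∞) (A : Set T) (r : ℝ) : ℕ∞ :=
  ⨅ (C : Set T) (_ : C ⊆ A) (_ : ∀ a ∈ A, ∃ c ∈ C, d a c < ENNReal.ofReal r), C.encard

/-- The metric entropy `log N(A, d, r)`, with value `∞` if there is no finite cover. -/
def entropy {T : Type*} (d : T → T → ℝ≥0∞) (A : Set T) (r : ℝ) : ℝ≥0∞ :=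
  (ENNReal.log (coveringNumber d A r : ℝ≥0∞)).toENNReal

section Classes

variable {X Y : Type*} [NormedAddCommGroup Y]

/-- The distance `sup_{x ∈ D} ‖F x - G x‖` of two maps. -/
def supDist (D : Set X) (F G : X → Y) : ℝ≥0∞ := ⨆ x ∈ D, ‖F x - G x‖ₑ

/-- The empirical seminorm `(n⁻¹ ∑ ‖F (x i)‖²)^(1/2)` of a map at the design points `x`. -/
def empNorm {n : ℕ} (x : Fin n → X) (F : X → Y) : ℝ :=
  √((n : ℝ)⁻¹ * ∑ i, ‖F (x i)‖ ^ 2)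

/-- The distance of two maps in the empirical seminorm. -/
def empDist {n : ℕ} (x : Fin n → X) (F G : X → Y) : ℝ≥0∞ :=
  ENNReal.ofReal (empNorm x (F - G))

/-- The localized class `{G ∈ 𝒢 : ‖G - Gs‖_n ≤ δ}`. -/
def localized {n : ℕ} (x : Fin n → X) (𝒢 : Set (X → Y)) (Gs : X → Y) (δ : ℝ) : Set (X → Y) :=
  {G | G ∈ 𝒢 ∧ empNorm x (G - Gs) ≤ δ}

/-- The entropy integral `∫₀^δ H(𝒢_n^*(δ), ‖·‖_n, ρ)^(1/2) dρ` (possibly infinite). -/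
def entropyIntegral {n : ℕ} (x : Fin n → X) (𝒢 : Set (X → Y)) (Gs : X → Y) (δ : ℝ) : ℝ≥0∞ :=
  ∫⁻ ρ in Set.Ioc 0 δ, entropy (empDist x) (localized x 𝒢 Gs δ) ρ ^ (1 / 2 : ℝ)

/-- The standing assumption on the true map `G₀`, the class `𝒢`, the reference map `Gs ∈ 𝒢`, the
design distribution `γ` and the majorant `Ψ` (of which only the values on `(0, ∞)` matter) at
sample size `n`. Compactness is that of `𝒢` in the topology of uniform convergence on the support
of `γ`, i.e. with respect to `‖·‖_{∞, supp γ}`. -/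
structure ClassAssumption [TopologicalSpace X] [MeasurableSpace X] [MeasurableSpace Y]
    (n : ℕ) (γ : Measure X) (G₀ : X → Y) (𝒢 : Set (X → Y)) (Gs : X → Y) (Ψ : ℝ → ℝ) :
    Prop where
  measurable : ∀ G ∈ 𝒢, Measurable G
  mem : Gs ∈ 𝒢
  bounded : ∃ B : ℝ, ∀ x ∈ γ.support, ‖G₀ x‖ ≤ B
  compact : IsCompact (UniformOnFun.ofFun {γ.support} '' 𝒢)
  nonneg : ∀ δ : ℝ, 0 < δ → 0 ≤ Ψ δ
  entropyIntegral_le : ∀ᵐ x ∂(Measure.pi fun _ : Fin n => γ), ∀ δ : ℝ, 0 < δ →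
    entropyIntegral x 𝒢 Gs δ ≤ ENNReal.ofReal (Ψ δ)
  antitone : AntitoneOn (fun δ : ℝ => Ψ δ / δ ^ 2) (Set.Ioi 0)

end Classes

/-! ### Noise and data -/

section Noise

variable {Ω X Y : Type*} [MeasurableSpace Ω] [MeasurableSpace X]
  [NormedAddCommGroup Y] [InnerProductSpace ℝ Y]

/-- `W` is a `Y`-Gaussian white noise process: a centred Gaussian process indexed by `Y` with
covariance `⟪y, y'⟫`. A process is only determined by this up to a null set for each index
separately, whereas below it is evaluated at indices that depend on the data. As usual the process
is therefore realised by its series `W(y) = ∑ j, ⟪y, ψ j⟫ Z j` in some orthonormal basis `ψ`, with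
`Z j = W(ψ j)`: almost surely this holds for all `y` for which the series converges. (The basis is
indexed by a set `J` of natural numbers, so that finite dimensions are included.) -/
structure IsWhiteNoise (W : Y → Ω → ℝ) (μ : Measure Ω) : Prop where
  measurable : ∀ y, Measurable (W y)
  gaussian : IsGaussianProcess W μ
  mean : ∀ y, ∫ ω, W y ω ∂μ = 0
  covariance : ∀ y y', cov[W y, W y'; μ] = inner ℝ y y'
  series : ∃ (J : Set ℕ) (ψ : HilbertBasis J ℝ Y), ∀ᵐ ω ∂μ, ∀ (y : Y) (l : ℝ),
    Tendsto (fun N : ℕ => ∑ j ∈ Finset.range N,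
      open Classical in if h : j ∈ J then inner ℝ y (ψ ⟨j, h⟩) * W (ψ ⟨j, h⟩) ω else 0)
      atTop (𝓝 l) → W y ω = l

/-- A sub-Gaussian random vector with parameter `η`. -/
structure IsSubGaussian [MeasurableSpace Y] (e : Ω → Y) (η : ℝ) (μ : Measure Ω) : Prop where
  measurable : Measurable e
  mean : ∫ ω, e ω ∂μ = 0
  tail : ∀ t : ℝ, 0 ≤ t →
    μ {ω | t ≤ ‖e ω‖} ≤ ENNReal.ofReal (2 * Real.exp (-t ^ 2 / (2 * η ^ 2)))

/-- White noise model. Here `ε i y` is the random variable `⟪ε_i, y⟫`. The noise processes are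
independent copies, and they are independent of the design points `x`. -/
structure WhiteNoiseModel {n : ℕ} (x : Fin n → Ω → X) (ε : Fin n → Y → Ω → ℝ) (μ : Measure Ω) :
    Prop where
  whiteNoise : ∀ i, IsWhiteNoise (ε i) μ
  indep : iIndepFun (fun i ω y => ε i y ω) μ
  indep_design : IndepFun (fun ω i => x i ω) (fun ω i y => ε i y ω) μ

/-- Sub-Gaussian noise model: the noise variables `e i` are independent `Y`-valued sub-Gaussian
vectors with parameter `1`, they are independent of the design points `x`, and
`ε i y = ⟪e i, y⟫`. -/
structure SubGaussianNoiseModel [MeasurableSpace Y] {n : ℕ} (x : Fin n → Ω → X)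
    (ε : Fin n → Y → Ω → ℝ) (μ : Measure Ω) : Prop where
  exists_vector : ∃ e : Fin n → Ω → Y,
    (∀ i, IsSubGaussian (e i) 1 μ) ∧ iIndepFun e μ ∧
    IndepFun (fun ω i => x i ω) (fun ω i => e i ω) μ ∧
    ∀ i y ω, ε i y ω = inner ℝ (e i ω) y

/-- The regression model: the design points `x i` are i.i.d. with law `γ`, and the noise is either
white noise or sub-Gaussian noise. -/
structure RegressionModel [MeasurableSpace Y] {n : ℕ} (γ : Measure X) (x : Fin n → Ω → X)
    (ε : Fin n → Y → Ω → ℝ) (μ : Measure Ω) : Prop where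
  measurable : ∀ i, Measurable (x i)
  law : ∀ i, μ.map (x i) = γ
  indep : iIndepFun x μ
  noise : WhiteNoiseModel x ε μ ∨ SubGaussianNoiseModel x ε μ

/-- The observation `y_i = G₀ (x_i) + σ ε_i`, as the process `f ↦ ⟪y_i, f⟫`. -/
def observation {n : ℕ} (G₀ : X → Y) (σ : ℝ) (x : Fin n → Ω → X) (ε : Fin n → Y → Ω → ℝ)
    (i : Fin n) (f : Y) (ω : Ω) : ℝ :=
  inner ℝ (G₀ (x i ω)) f + σ * ε i f ω

/-- The empirical risk `n⁻¹ ∑ (-2 ⟪G (x_i), y_i⟫ + ‖G (x_i)‖²)` of data `x_i`, `f ↦ ⟪y_i, f⟫`. -/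
def empiricalRisk {n : ℕ} (x : Fin n → X) (y : Fin n → Y → ℝ) (G : X → Y) : ℝ :=
  (n : ℝ)⁻¹ * ∑ i, (-2 * y i (G (x i)) + ‖G (x i)‖ ^ 2)

/-- `Ghat` is a measurable empirical risk minimizer over `𝒢`: it takes values in `𝒢`, is
measurable for the Borel σ-algebra of `‖·‖_{∞, supp γ}`, and almost surely minimizes the
empirical risk over `𝒢`. -/
structure IsERM [TopologicalSpace X] {n : ℕ} (γ : Measure X) (G₀ : X → Y) (𝒢 : Set (X → Y))
    (σ : ℝ) (x : Fin n → Ω → X) (ε : Fin n → Y → Ω → ℝ) (μ : Measure Ω) (Ghat : Ω → X → Y) :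
    Prop where
  mem : ∀ ω, Ghat ω ∈ 𝒢
  measurable : @Measurable Ω (X →ᵤ[{γ.support}] Y) _ (borel _)
    (fun ω => UniformOnFun.ofFun {γ.support} (Ghat ω))
  minimizes : ∀ᵐ ω ∂μ, ∀ G ∈ 𝒢,
    empiricalRisk (fun i => x i ω) (fun i f => observation G₀ σ x ε i f ω) (Ghat ω) ≤
      empiricalRisk (fun i => x i ω) (fun i f => observation G₀ σ x ε i f ω) G

end Noise

end HilbertRegression

end

/-! The minimizer beats every fixed reference map G* in empirical risk. Completing the square turns
this into ‖Ĝ - G₀‖_n² ≤ ‖G* - G₀‖_n² + a (V(Ĝ) - V(G*)) with a = 2σ/√n and V the normalized noise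
process (`basic_inequality`). For a fixed design, V has sub-Gaussian increments with respect to
‖·‖_n. Dudley chaining on the dyadic shells around G*, together with the monotonicity of Ψ(r)/r²,
bounds the noise term uniformly over the class by ‖G - G*‖_n²/8 plus a remainder with expectation of
order δ² + σ²/n (`exists_chaining_bound`, `exists_peeling_bound`). The small multiple is absorbed
into the left side.

The return to L²(γ) uses a finite sup-norm net of radius δ'. For the bounded functions ‖G - G₀‖² on
the net, an exponential lower-tail bound gives population mean ≤ 2 · empirical mean + O(F²(H +
W)/n), with W of bounded expectation (`exists_uniform_norm_comparison`).

All maximal inequalities are kept pathwise: a single variable with bounded exponential moment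
dominates countably many finite maxima at once (`exists_common_bound`). Expectations then follow
without integrating tails.

Both noise types reduce to `lintegral_risk_le_of_noise_representation`, where the noise is a jointly
measurable function w(y, η) of a variable η independent of the design, with sub-Gaussian increments
and continuous along the class. For noise vectors w is the inner product. White noise is not
continuous in its index, so w is taken as the limit of its series. The finite entropy integral makes
the partial sums converge uniformly over the values of the class at the design points
(`ae_uniformCauchy_seriesSum`: Doob's inequality and Borel–Cantelli along the chaining links). This
gives continuity and identifies w with the noise at indices that depend on the data. -/

namespace HilbertRegression

/-! ### Simultaneous bounds for countably many finite families -/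

/-- Countably many nonnegative variables with expectation at most `1` are controlled
simultaneously by one variable `L` with an exponential moment. -/
theorem exists_common_bound {E : Type*} [MeasurableSpace E] {ν : Measure E}
    [IsProbabilityMeasure ν] (B : ℕ → E → ℝ≥0∞) (hB : ∀ j, Measurable (B j))
    (h : ∀ j, ∫⁻ z, B j z ∂ν ≤ 1) :
    ∃ L : E → ℝ, Measurable L ∧ (∀ z, 0 ≤ L z) ∧ ∫⁻ z, ENNReal.ofReal (Real.exp (L z)) ∂ν ≤ 2 ∧
      ∀ᵐ z ∂ν, ∀ j : ℕ, B j z ≤ ENNReal.ofReal (Real.exp (j + 1 + L z)) := by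
  -- A geometrically weighted union bound: S has mean at most 1, L = log(1 + S), and undoing the
  -- weight of B j costs 2^(j+1) ≤ e^(j+1).
  set S : E → ℝ≥0∞ := fun z => ∑' j : ℕ, (2⁻¹ : ℝ≥0∞) ^ (j + 1) * B j z with hS
  have hSm : Measurable S := by fun_prop
  have hSint : ∫⁻ z, S z ∂ν ≤ 1 := by
    rw [hS, lintegral_tsum (fun j => by fun_prop)]
    calc ∑' j : ℕ, ∫⁻ z, (2⁻¹ : ℝ≥0∞) ^ (j + 1) * B j z ∂ν
        ≤ ∑' j : ℕ, (2⁻¹ : ℝ≥0∞) ^ (j + 1) := by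
          refine ENNReal.tsum_le_tsum fun j => ?_
          rw [lintegral_const_mul _ (hB j)]
          exact mul_le_of_le_one_right' (h j)
      _ = 1 := by
          rw [ENNReal.tsum_geometric_add_one, ENNReal.one_sub_inv_two, inv_inv]
          exact ENNReal.inv_mul_cancel (by simp) (by simp)
  have hfin : ∀ᵐ z ∂ν, S z < ⊤ :=
    ae_lt_top hSm (ne_top_of_le_ne_top ENNReal.one_ne_top hSint)
  have hpos : ∀ z, 0 < 1 + (S z).toReal := fun z => by positivity
  refine ⟨fun z => Real.log (1 + (S z).toReal), by fun_prop, fun z => Real.log_nonneg (by simp),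
    ?_, ?_⟩
  · calc ∫⁻ z, ENNReal.ofReal (Real.exp (Real.log (1 + (S z).toReal))) ∂ν
        ≤ ∫⁻ z, (1 + S z) ∂ν := by
          refine lintegral_mono fun z => ?_
          rw [Real.exp_log (hpos z), ENNReal.ofReal_add zero_le_one ENNReal.toReal_nonneg,
            ENNReal.ofReal_one]
          gcongr
          exact ENNReal.ofReal_toReal_le
      _ ≤ 2 := by
          rw [lintegral_add_left measurable_const]
          simp only [lintegral_const, measure_univ, mul_one]
          calc (1 : ℝ≥0∞) + ∫⁻ z, S z ∂ν ≤ 1 + 1 := by gcongr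
            _ = 2 := one_add_one_eq_two
  · filter_upwards [hfin] with z hz j
    have h1 : (2⁻¹ : ℝ≥0∞) ^ (j + 1) * B j z ≤ S z := ENNReal.le_tsum j
    have h2 : B j z ≤ 2 ^ (j + 1) * S z := by
      calc B j z = 2 ^ (j + 1) * ((2⁻¹ : ℝ≥0∞) ^ (j + 1) * B j z) := by
            rw [← mul_assoc, ← mul_pow, ENNReal.mul_inv_cancel (by simp) (by simp), one_pow,
              one_mul]
        _ ≤ _ := by gcongr
    refine h2.trans ?_
    rw [Real.exp_add, Real.exp_log (hpos z), ENNReal.ofReal_mul (by positivity)]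
    gcongr
    · have : (2 : ℝ≥0∞) ^ (j + 1) = ENNReal.ofReal (2 ^ (j + 1)) := by
        rw [ENNReal.ofReal_pow (by norm_num)]; simp
      rw [this]
      apply ENNReal.ofReal_le_ofReal
      calc (2 : ℝ) ^ (j + 1) ≤ (Real.exp 1) ^ (j + 1) := by
            gcongr
            linarith [Real.add_one_le_exp (1 : ℝ)]
        _ = _ := by rw [← Real.exp_nat_mul]; push_cast; ring_nf
    · calc S z = ENNReal.ofReal (S z).toReal := (ENNReal.ofReal_toReal hz.ne).symm
        _ ≤ _ := by gcongr; linarith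

/-- Maximal inequality for countably many finite families of sub-Gaussian variables. -/
theorem exists_level_bound {E α : Type*} [MeasurableSpace E] {ν : Measure E}
    [IsProbabilityMeasure ν] (I : ℕ → Finset α) (U : ℕ → α → E → ℝ) (s h : ℕ → ℝ) {K : ℝ}
    (hK : 0 ≤ K) (hs : ∀ j, 0 < s j) (hh : ∀ j, 0 ≤ h j)
    (hcard : ∀ j, ((I j).card : ℝ) ≤ Real.exp (h j))
    (hU : ∀ j, ∀ l ∈ I j, Measurable (U j l))
    (hmgf : ∀ j, ∀ l ∈ I j, ∀ a : ℝ, ∫⁻ z, ENNReal.ofReal (Real.exp (a * U j l z)) ∂ν ≤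
      ENNReal.ofReal (Real.exp (K * a ^ 2 * s j ^ 2))) :
    ∃ L : E → ℝ, Measurable L ∧ (∀ z, 0 ≤ L z) ∧ ∫⁻ z, ENNReal.ofReal (Real.exp (L z)) ∂ν ≤ 2 ∧
      ∀ᵐ z ∂ν, ∀ j : ℕ, ∀ l ∈ I j, |U j l z| ≤ (1 + K) * s j * (√(h j) + j + 2 + L z) := by
  -- The exponent a j makes the moment bound exp(K(1 + h j)). The prefactor in B j then cancels the
  -- cardinality e^(h j), the two signs (2 ≤ e) and this moment exactly.
  set a : ℕ → ℝ := fun j => √(1 + h j) / s j with ha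
  set B : ℕ → E → ℝ≥0∞ := fun j z => ∑ l ∈ I j,
    (ENNReal.ofReal (Real.exp (-((1 + K) * (1 + h j))))) *
      (ENNReal.ofReal (Real.exp (a j * U j l z)) + ENNReal.ofReal (Real.exp (-a j * U j l z)))
    with hBdef
  have hterm : ∀ j, ∀ l ∈ I j, Measurable fun z => ENNReal.ofReal (Real.exp (a j * U j l z)) :=
    fun j l hl => by have := hU j l hl; fun_prop
  have hterm' : ∀ j, ∀ l ∈ I j, Measurable fun z => ENNReal.ofReal (Real.exp (-a j * U j l z)) :=
    fun j l hl => by have := hU j l hl; fun_prop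
  have hterm2 : ∀ j, ∀ l ∈ I j, Measurable fun z =>
      ENNReal.ofReal (Real.exp (-((1 + K) * (1 + h j)))) *
      (ENNReal.ofReal (Real.exp (a j * U j l z)) + ENNReal.ofReal (Real.exp (-a j * U j l z))) :=
    fun j l hl => ((hterm j l hl).add (hterm' j l hl)).const_mul _
  have hBm : ∀ j, Measurable (B j) := fun j => Finset.measurable_fun_sum _ (hterm2 j)
  have hsq : ∀ j, K * a j ^ 2 * s j ^ 2 = K * (1 + h j) := fun j => by
    have := hs j
    have h1 : √(1 + h j) ^ 2 = 1 + h j := Real.sq_sqrt (by linarith [hh j])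
    rw [ha]
    simp only [div_pow, h1]
    field_simp
  have hBint : ∀ j, ∫⁻ z, B j z ∂ν ≤ 1 := fun j => by
    rw [hBdef]
    simp only
    rw [lintegral_finsetSum' _ fun l hl => (hterm2 j l hl).aemeasurable]
    calc ∑ l ∈ I j, ∫⁻ z, (ENNReal.ofReal (Real.exp (-((1 + K) * (1 + h j))))) *
          (ENNReal.ofReal (Real.exp (a j * U j l z)) +
            ENNReal.ofReal (Real.exp (-a j * U j l z))) ∂ν
        ≤ ∑ l ∈ I j, ENNReal.ofReal (Real.exp (-((1 + K) * (1 + h j))) *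
            (2 * Real.exp (K * (1 + h j)))) := by
          refine Finset.sum_le_sum fun l hl => ?_
          rw [lintegral_const_mul' _ _ ENNReal.ofReal_ne_top,
            lintegral_add_left (hterm j l hl), ENNReal.ofReal_mul (by positivity), two_mul,
            ENNReal.ofReal_add (by positivity) (by positivity)]
          have h1 := hmgf j l hl (a j)
          have h2 := hmgf j l hl (-a j)
          rw [neg_sq, hsq] at h2
          rw [hsq] at h1
          gcongr
      _ = ENNReal.ofReal ((I j).card * (Real.exp (-((1 + K) * (1 + h j))) *
            (2 * Real.exp (K * (1 + h j))))) := by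
          rw [Finset.sum_const, nsmul_eq_mul,
            ENNReal.ofReal_mul (p := ((I j).card : ℝ)) (by positivity), ENNReal.ofReal_natCast]
      _ ≤ ENNReal.ofReal 1 := by
          apply ENNReal.ofReal_le_ofReal
          calc ((I j).card : ℝ) * (Real.exp (-((1 + K) * (1 + h j))) *
                (2 * Real.exp (K * (1 + h j))))
              ≤ Real.exp (h j) * (Real.exp (-((1 + K) * (1 + h j))) *
                (Real.exp 1 * Real.exp (K * (1 + h j)))) := by
                gcongr
                · exact hcard j
                · linarith [Real.add_one_le_exp (1 : ℝ)]
            _ = 1 := by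
                rw [← Real.exp_add, ← Real.exp_add, ← Real.exp_add, Real.exp_eq_one_iff]
                ring
      _ = 1 := ENNReal.ofReal_one
  obtain ⟨L, hLm, hL0, hLint, hL⟩ := exists_common_bound B hBm hBint
  refine ⟨L, hLm, hL0, hLint, ?_⟩
  filter_upwards [hL] with z hz j l hl
  have h1 : ENNReal.ofReal (Real.exp (-((1 + K) * (1 + h j))) * Real.exp (a j * |U j l z|)) ≤
      ENNReal.ofReal (Real.exp (j + 1 + L z)) := by
    refine le_trans ?_ (hz j)
    refine le_trans ?_ (Finset.single_le_sum (f := fun l =>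
      (ENNReal.ofReal (Real.exp (-((1 + K) * (1 + h j))))) *
      (ENNReal.ofReal (Real.exp (a j * U j l z)) + ENNReal.ofReal (Real.exp (-a j * U j l z))))
      (fun _ _ => zero_le) hl)
    rw [ENNReal.ofReal_mul (by positivity)]
    gcongr
    rcases abs_cases (U j l z) with ⟨h, _⟩ | ⟨h, _⟩ <;> rw [h]
    · exact le_self_add
    · rw [mul_neg, neg_mul]; exact le_add_self
  rw [ENNReal.ofReal_le_ofReal_iff (by positivity), ← Real.exp_add, Real.exp_le_exp] at h1
  have hq : 1 ≤ √(1 + h j) := Real.one_le_sqrt.2 (by linarith [hh j])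
  have hq2 : √(1 + h j) ^ 2 = 1 + h j := Real.sq_sqrt (by linarith [hh j])
  -- This extra 1 turns the j + 1 of the common bound into j + 2.
  have hq3 : √(1 + h j) ≤ 1 + √(h j) := by
    rw [Real.sqrt_le_left (by positivity)]
    nlinarith [Real.sq_sqrt (hh j), Real.sqrt_nonneg (h j)]
  have h2 : √(1 + h j) * |U j l z| ≤
      s j * ((1 + K) * √(1 + h j) ^ 2 + j + 1 + L z) := by
    have : a j * |U j l z| ≤ (1 + K) * √(1 + h j) ^ 2 + j + 1 + L z := by rw [hq2]; linarith
    calc √(1 + h j) * |U j l z| = s j * (a j * |U j l z|) := by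
          rw [ha]; have := (hs j).ne'; field_simp
      _ ≤ _ := by gcongr; exact (hs j).le
  have h3 : √(1 + h j) * |U j l z| ≤
      √(1 + h j) * (s j * ((1 + K) * √(1 + h j) + j + 1 + L z)) := by
    refine h2.trans ?_
    have h4 : 0 ≤ (j : ℝ) + 1 + L z := by have := hL0 z; positivity
    have : (j : ℝ) + 1 + L z ≤ √(1 + h j) * (j + 1 + L z) := le_mul_of_one_le_left h4 hq
    have h5 := mul_le_mul_of_nonneg_left this (hs j).le
    nlinarith
  have h4 := le_of_mul_le_mul_left h3 (by linarith)
  refine h4.trans ?_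
  have h5 := hL0 z
  have h7 : 0 ≤ K * (j + 1 + L z) := by positivity
  calc s j * ((1 + K) * √(1 + h j) + j + 1 + L z)
      ≤ s j * ((1 + K) * (√(h j) + j + 2 + L z)) := by
        refine mul_le_mul_of_nonneg_left ?_ (hs j).le
        nlinarith [mul_le_mul_of_nonneg_left hq3 (by linarith : 0 ≤ 1 + K)]
    _ = _ := by ring

/-! ### Nets from metric entropy -/

/-- A nonempty set of finite entropy has a finite net of the corresponding cardinality. -/
theorem exists_finset_cover {T : Type*} {d : T → T → ℝ≥0∞} {A : Set T} (hA : A.Nonempty) {r : ℝ}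
    (h : entropy d A r ≠ ⊤) :
    ∃ C : Finset T, (∀ c ∈ C, c ∈ A) ∧ (∀ a ∈ A, ∃ c ∈ C, d a c < ENNReal.ofReal r) ∧
      (C.card : ℝ) ≤ Real.exp (entropy d A r).toReal := by
  have hN : coveringNumber d A r ≠ ⊤ := by
    rintro h1
    apply h
    simp [entropy, h1]
  obtain ⟨N, hN'⟩ := ENat.ne_top_iff_exists.1 hN
  have hlt : coveringNumber d A r < (N + 1 : ℕ) := by
    rw [← hN']; exact_mod_cast Nat.lt_succ_self N
  unfold coveringNumber at hlt
  simp only [iInf_lt_iff] at hlt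
  obtain ⟨C, hCA, hC, hcard⟩ := hlt
  have hfin : C.Finite := Set.finite_of_encard_le_coe hcard.le
  lift C to Finset T using hfin
  rw [Set.encard_coe_eq_coe_finsetCard] at hcard
  have hcard' : C.card ≤ N := Nat.lt_succ_iff.1 (by exact_mod_cast hcard)
  refine ⟨C, fun c hc => hCA hc, fun a ha => hC a ha, ?_⟩
  -- Nonemptiness excludes log 0 and makes log N ≥ 0, so the truncation in `entropy` changes
  -- nothing.
  have hpos : 0 < C.card := by
    obtain ⟨a, ha⟩ := hA
    obtain ⟨c, hc, -⟩ := hC a ha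
    exact Finset.card_pos.2 ⟨c, hc⟩
  have hN0 : (0 : ℝ) < N := by exact_mod_cast hpos.trans_le hcard'
  have hN1 : (1 : ℝ) ≤ N := by exact_mod_cast hpos.trans_le hcard'
  have hent : entropy d A r = ENNReal.ofReal (Real.log N) := by
    have : ((N : ℕ∞) : ℝ≥0∞) = ENNReal.ofReal N := by simp
    rw [entropy, ← hN', this, ENNReal.log_ofReal_of_pos hN0, EReal.toENNReal_of_ne_top (by simp),
      EReal.toReal_coe]
  rw [hent, ENNReal.toReal_ofReal (Real.log_nonneg hN1), Real.exp_log hN0]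
  exact_mod_cast hcard'

theorem coveringNumber_anti {T : Type*} (d : T → T → ℝ≥0∞) (A : Set T) :
    Antitone (coveringNumber d A) := by
  intro r s hrs
  refine le_iInf₂ fun C hC => le_iInf fun h => iInf₂_le_of_le C hC <| iInf_le _ fun a ha => ?_
  obtain ⟨c, hc, hd⟩ := h a ha
  exact ⟨c, hc, hd.trans_le (ENNReal.ofReal_le_ofReal hrs)⟩

theorem entropy_anti {T : Type*} (d : T → T → ℝ≥0∞) (A : Set T) : Antitone (entropy d A) := by
  intro r s hrs
  refine EReal.toENNReal_le_toENNReal (ENNReal.log_monotone ?_)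
  exact_mod_cast coveringNumber_anti d A hrs

/-- The dyadic Riemann sum of the entropy integral. -/
theorem tsum_entropy_le {T : Type*} (d : T → T → ℝ≥0∞) (A : Set T) {r : ℝ} (hr : 0 < r) :
    ∑' j : ℕ, ENNReal.ofReal (r / 2 ^ (j + 1)) * entropy d A (r / 2 ^ j) ^ (1 / 2 : ℝ) ≤
      ∫⁻ ρ in Set.Ioc 0 r, entropy d A ρ ^ (1 / 2 : ℝ) := by
  -- On each dyadic interval the entropy is at least its value at the right endpoint, and the
  -- interval has length r / 2^(j+1).
  set s : ℕ → Set ℝ := fun j => Set.Ioc (r / 2 ^ (j + 1)) (r / 2 ^ j) with hs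
  have hanti : Antitone fun j : ℕ => r / (2 : ℝ) ^ j := fun i j hij => by
    dsimp only
    gcongr
    norm_num
  have hdis : Pairwise (Function.onFun Disjoint s) := by
    exact hanti.pairwise_disjoint_on_Ioc_succ
  have hsub : (⋃ j, s j) ⊆ Set.Ioc 0 r := by
    refine Set.iUnion_subset fun j => Set.Ioc_subset_Ioc (by positivity) ?_
    simpa using hanti (Nat.zero_le j)
  calc _ ≤ ∑' j : ℕ, ∫⁻ ρ in s j, entropy d A ρ ^ (1 / 2 : ℝ) := by
        refine ENNReal.tsum_le_tsum fun j => ?_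
        have hvol : volume (s j) = ENNReal.ofReal (r / 2 ^ (j + 1)) := by
          rw [hs, Real.volume_Ioc]
          congr 1
          field_simp
          ring
        rw [← hvol, mul_comm, ← setLIntegral_const]
        refine setLIntegral_mono' measurableSet_Ioc fun ρ hρ => ?_
        exact ENNReal.rpow_le_rpow (entropy_anti d A hρ.2) (by norm_num)
    _ = ∫⁻ ρ in ⋃ j, s j, entropy d A ρ ^ (1 / 2 : ℝ) :=
        (lintegral_iUnion (fun _ => measurableSet_Ioc) hdis _).symm
    _ ≤ _ := lintegral_mono_set hsub

/-- A finite entropy integral provides dyadic nets whose chaining sum is controlled. -/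
theorem exists_nets {T : Type*} (d : T → T → ℝ) {A : Set T} (hA : A.Nonempty) {r S : ℝ}
    (hr : 0 < r) (hS : 0 ≤ S)
    (h : ∫⁻ ρ in Set.Ioc 0 r, entropy (fun s t => ENNReal.ofReal (d s t)) A ρ ^ (1 / 2 : ℝ) ≤
      ENNReal.ofReal S) :
    ∃ (C : ℕ → Finset T) (H : ℕ → ℝ), (∀ j, ∀ c ∈ C j, c ∈ A) ∧
      (∀ j, ∀ a ∈ A, ∃ c ∈ C j, d a c ≤ r / 2 ^ j) ∧ (∀ j, 0 ≤ H j) ∧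
      (∀ j, ((C j).card : ℝ) ≤ Real.exp (H j)) ∧
      ∀ m, ∑ j ∈ Finset.range m, r / 2 ^ (j + 1) * √(H j) ≤ S := by
  have hsum := (tsum_entropy_le (fun s t => ENNReal.ofReal (d s t)) A hr).trans h
  have hfin : ∀ j : ℕ, entropy (fun s t => ENNReal.ofReal (d s t)) A (r / 2 ^ j) ≠ ⊤ := by
    intro j hj
    have h1 := (ENNReal.le_tsum j).trans hsum
    rw [hj, ENNReal.top_rpow_of_pos (by norm_num),
      ENNReal.mul_top (by rw [Ne, ENNReal.ofReal_eq_zero, not_le]; positivity)] at h1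
    exact ENNReal.ofReal_ne_top (top_le_iff.1 h1)
  choose C hCA hC hcard using fun j => exists_finset_cover hA (hfin j)
  refine ⟨C, fun j => (entropy (fun s t => ENNReal.ofReal (d s t)) A (r / 2 ^ j)).toReal, hCA,
    fun j a ha => ?_, fun j => ENNReal.toReal_nonneg, hcard, fun m => ?_⟩
  · obtain ⟨c, hc, hd⟩ := hC j a ha
    exact ⟨c, hc, ((ENNReal.ofReal_lt_ofReal_iff (by positivity)).1 hd).le⟩
  · have h1 := (ENNReal.sum_le_tsum (Finset.range m)).trans hsum
    rw [← ENNReal.ofReal_le_ofReal_iff hS]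
    refine le_trans (le_of_eq ?_) h1
    rw [ENNReal.ofReal_sum_of_nonneg fun j _ => by positivity]
    refine Finset.sum_congr rfl fun j _ => ?_
    rw [ENNReal.ofReal_mul (by positivity), Real.sqrt_eq_rpow,
      ← ENNReal.ofReal_rpow_of_nonneg ENNReal.toReal_nonneg (by norm_num),
      ENNReal.ofReal_toReal (hfin j)]

/-! ### Chaining -/

/-- Links between levels j + 1 and j number at most exp(H'(j+1) + H'(j)), and the square root is
subadditive. Writing 2r/2^j as 8r/2^(j+2) and as 4r/2^(j+1) gives 8S + 4S; the series ∑(j+2)/2^j = 6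
and ∑1/2^j = 2 give 12r + 4rL. Allowing H' below H leaves room for a one-point net at level 0. -/
theorem sum_chaining_scales_le {r S L : ℝ} (hr : 0 < r) (hL : 0 ≤ L) {H H' : ℕ → ℝ}
    (hH' : ∀ j, H' j ≤ H j) (hS : ∀ m, ∑ j ∈ Finset.range m, r / 2 ^ (j + 1) * √(H j) ≤ S)
    (m : ℕ) :
    ∑ j ∈ Finset.range m, 2 * (r / 2 ^ j) * (√(H' (j + 1) + H' j) + j + 2 + L) ≤
      12 * (S + r * (1 + L)) := by
  have h1 : ∑ j ∈ Finset.range m, r / 2 ^ (j + 1) * √(H j) ≤ S := hS m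
  have h2 : ∑ j ∈ Finset.range m, r / 2 ^ (j + 2) * √(H (j + 1)) ≤ S := by
    refine le_trans ?_ (hS (m + 1))
    rw [Finset.sum_range_succ']
    have : 0 ≤ r / 2 ^ (0 + 1) * √(H 0) := by positivity
    linarith
  have h3 : ∀ m : ℕ, ∑ j ∈ Finset.range m, ((j : ℝ) + 2) / 2 ^ j = 6 - (2 * m + 6) / 2 ^ m := by
    intro m
    induction m with
    | zero => norm_num
    | succ m ih => rw [Finset.sum_range_succ, ih]; push_cast; field_simp; ring
  have h4 : ∀ m : ℕ, ∑ j ∈ Finset.range m, (1 : ℝ) / 2 ^ j = 2 - 2 / 2 ^ m := by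
    intro m
    induction m with
    | zero => norm_num
    | succ m ih => rw [Finset.sum_range_succ, ih]; field_simp; ring
  have h5 : ∑ j ∈ Finset.range m, 2 * (r / 2 ^ j) * (√(H' (j + 1) + H' j) + j + 2 + L) ≤
      ∑ j ∈ Finset.range m, (8 * (r / 2 ^ (j + 2) * √(H (j + 1))) +
        4 * (r / 2 ^ (j + 1) * √(H j)) + 2 * r * (((j : ℝ) + 2) / 2 ^ j) +
        2 * r * L * (1 / 2 ^ j)) := by
    refine Finset.sum_le_sum fun j _ => ?_
    have h6 : √(H' (j + 1) + H' j) ≤ √(H (j + 1)) + √(H j) :=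
      (Real.sqrt_le_sqrt (add_le_add (hH' _) (hH' _))).trans
        (by
          rcases le_total 0 (H j) with h | h
          · rcases le_total 0 (H (j + 1)) with h' | h'
            · rw [Real.sqrt_le_left (by positivity)]
              nlinarith [Real.sq_sqrt h, Real.sq_sqrt h', Real.sqrt_nonneg (H j),
                Real.sqrt_nonneg (H (j + 1))]
            · exact (Real.sqrt_le_sqrt (by linarith)).trans
                (le_add_of_nonneg_left (Real.sqrt_nonneg _))
          · exact (Real.sqrt_le_sqrt (by linarith)).trans
              (le_add_of_nonneg_right (Real.sqrt_nonneg _)))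
    have h7 : 0 ≤ 2 * (r / 2 ^ j) := by positivity
    refine (mul_le_mul_of_nonneg_left (by linarith : _ ≤ √(H (j + 1)) + √(H j) + j + 2 + L)
      h7).trans (le_of_eq ?_)
    field_simp
    ring
  refine h5.trans ?_
  rw [Finset.sum_add_distrib, Finset.sum_add_distrib, Finset.sum_add_distrib, ← Finset.mul_sum,
    ← Finset.mul_sum, ← Finset.mul_sum, ← Finset.mul_sum, h3, h4]
  have h8 : 2 * r * (6 - (2 * m + 6) / 2 ^ m) ≤ 2 * r * 6 := by
    gcongr
    linarith [show (0 : ℝ) ≤ (2 * m + 6) / 2 ^ m by positivity]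
  have h9 : 2 * r * L * (2 - 2 / 2 ^ m) ≤ 2 * r * L * 2 := by
    gcongr
    linarith [show (0 : ℝ) ≤ 2 / 2 ^ m by positivity]
  have h10 : 0 ≤ r * L := by positivity
  linarith

/-- Dudley's entropy bound for a process with sub-Gaussian increments, with an explicit
fluctuation term that has an exponential moment. -/
theorem exists_chaining_bound {T E : Type*} [MeasurableSpace E] {ν : Measure E}
    [IsProbabilityMeasure ν] {d : T → T → ℝ} (hsymm : ∀ s t, d s t = d t s)
    (htri : ∀ s t u, d s u ≤ d s t + d t u) (hd0 : ∀ s t, 0 ≤ d s t) {A : Set T} {t₀ : T}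
    (ht₀ : t₀ ∈ A) {r S K : ℝ} (hr : 0 < r) (hS : 0 ≤ S) (hK : 0 ≤ K)
    (hA : ∀ t ∈ A, d t t₀ ≤ r)
    (hent : ∫⁻ ρ in Set.Ioc 0 r, entropy (fun s t => ENNReal.ofReal (d s t)) A ρ ^ (1 / 2 : ℝ) ≤
      ENNReal.ofReal S)
    (V : T → E → ℝ) (hV : ∀ t ∈ A, Measurable (V t))
    (hmgf : ∀ s ∈ A, ∀ t ∈ A, ∀ a : ℝ, ∫⁻ z, ENNReal.ofReal (Real.exp (a * (V s z - V t z))) ∂ν ≤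
      ENNReal.ofReal (Real.exp (K * a ^ 2 * d s t ^ 2))) :
    ∃ L : E → ℝ, Measurable L ∧ (∀ z, 0 ≤ L z) ∧ ∫⁻ z, ENNReal.ofReal (Real.exp (L z)) ∂ν ≤ 2 ∧
      ∀ᵐ z ∂ν, ∀ t ∈ A, (∀ u : ℕ → T, (∀ k, u k ∈ A) → Tendsto (fun k => d (u k) t) atTop (𝓝 0) →
        Tendsto (fun k => V (u k) z) atTop (𝓝 (V t z))) →
        |V t z - V t₀ z| ≤ 12 * (1 + K) * (S + r * (1 + L z)) := by
  classical
  obtain ⟨C, H, hCA, hC, hH0, hcard, hsum⟩ := exists_nets d ⟨t₀, ht₀⟩ hr hS hent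
  -- All of A lies within r of t₀, so {t₀} is a valid net at level 0 and every chain starts at t₀.
  set C' : ℕ → Finset T := fun j => Nat.casesOn j {t₀} fun k => C (k + 1) with hC'
  set H' : ℕ → ℝ := fun j => Nat.casesOn j 0 fun k => H (k + 1) with hH'
  have hCA' : ∀ j, ∀ c ∈ C' j, c ∈ A := by
    rintro (_ | j) c hc
    · rw [Finset.mem_singleton.1 hc]; exact ht₀
    · exact hCA (j + 1) c hc
  have hcov : ∀ j, ∀ a ∈ A, ∃ c ∈ C' j, d a c ≤ r / 2 ^ j := by
    rintro (_ | j) a ha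
    · exact ⟨t₀, Finset.mem_singleton_self _, by simpa using hA a ha⟩
    · exact hC (j + 1) a ha
  have hH'0 : ∀ j, 0 ≤ H' j := by
    rintro (_ | j)
    · exact le_rfl
    · exact hH0 (j + 1)
  have hH'le : ∀ j, H' j ≤ H j := by
    rintro (_ | j)
    · exact hH0 0
    · exact le_rfl
  have hcard' : ∀ j, ((C' j).card : ℝ) ≤ Real.exp (H' j) := by
    rintro (_ | j)
    · simp [hC', hH']
    · exact hcard (j + 1)
  have hlink := exists_level_bound (ν := ν)
    (fun j => ((C' (j + 1)) ×ˢ (C' j)).filter fun p => d p.1 p.2 ≤ 2 * (r / 2 ^ j))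
    (fun _ p z => V p.1 z - V p.2 z) (fun j => 2 * (r / 2 ^ j)) (fun j => H' (j + 1) + H' j) hK
    (fun j => by positivity) (fun j => add_nonneg (hH'0 (j + 1)) (hH'0 j))
    (fun j => by
      calc _ ≤ (((C' (j + 1)) ×ˢ (C' j)).card : ℝ) := by
            exact_mod_cast Finset.card_filter_le _ _
        _ = ((C' (j + 1)).card : ℝ) * (C' j).card := by rw [Finset.card_product]; push_cast; rfl
        _ ≤ Real.exp (H' (j + 1)) * Real.exp (H' j) := by
            gcongr
            · exact hcard' (j + 1)
            · exact hcard' j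
        _ = _ := (Real.exp_add _ _).symm)
    (fun j p hp => by
      rw [Finset.mem_filter, Finset.mem_product] at hp
      exact (hV _ (hCA' (j + 1) _ hp.1.1)).sub (hV _ (hCA' j _ hp.1.2)))
    (fun j p hp a => by
      rw [Finset.mem_filter, Finset.mem_product] at hp
      refine (hmgf _ (hCA' (j + 1) _ hp.1.1) _ (hCA' j _ hp.1.2) a).trans ?_
      refine ENNReal.ofReal_le_ofReal (Real.exp_le_exp.2 ?_)
      have := hd0 p.1 p.2
      gcongr
      exact hp.2)
  obtain ⟨L, hLm, hL0, hLint, hL⟩ := hlink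
  refine ⟨L, hLm, hL0, hLint, ?_⟩
  -- The null set comes from the countably many links alone, so t may range over an uncountable set;
  -- continuity at t along its chain carries the bound to the limit.
  filter_upwards [hL] with z hz t ht hcont
  choose π hπC hπ using fun j => hcov j t ht
  have hπ0 : π 0 = t₀ := Finset.mem_singleton.1 (hπC 0)
  have hlim : Tendsto (fun j => d (π j) t) atTop (𝓝 0) := by
    have h2 : Tendsto (fun j : ℕ => r / (2 : ℝ) ^ j) atTop (𝓝 0) :=
      tendsto_const_nhds.div_atTop (tendsto_pow_atTop_atTop_of_one_lt (by norm_num))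
    exact squeeze_zero (fun j => hd0 _ _) (fun j => (hsymm _ _).trans_le (hπ j)) h2
  have hV := hcont π (fun k => hCA' k _ (hπC k)) hlim
  have hb : ∀ m, |V (π m) z - V t₀ z| ≤ 12 * (1 + K) * (S + r * (1 + L z)) := by
    intro m
    have h1 : V (π m) z - V t₀ z = ∑ j ∈ Finset.range m, (V (π (j + 1)) z - V (π j) z) := by
      rw [Finset.sum_range_sub (fun j => V (π j) z), hπ0]
    rw [h1]
    refine (Finset.abs_sum_le_sum_abs _ _).trans ?_
    calc ∑ j ∈ Finset.range m, |V (π (j + 1)) z - V (π j) z|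
        ≤ ∑ j ∈ Finset.range m, (1 + K) *
          (2 * (r / 2 ^ j) * (√(H' (j + 1) + H' j) + j + 2 + L z)) := by
          refine Finset.sum_le_sum fun j _ => ?_
          have h2 := hz j (π (j + 1), π j) (by
            rw [Finset.mem_filter, Finset.mem_product]
            refine ⟨⟨hπC _, hπC _⟩, ?_⟩
            have h3 := hπ (j + 1)
            have h4 : r / 2 ^ (j + 1) ≤ r / 2 ^ j := by gcongr <;> norm_num
            calc d (π (j + 1)) (π j) ≤ d (π (j + 1)) t + d t (π j) := htri _ _ _
              _ ≤ r / 2 ^ j + r / 2 ^ j :=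
                  add_le_add (by rw [hsymm]; linarith) (hπ j)
              _ = _ := by ring)
          refine h2.trans (le_of_eq (by ring))
      _ = (1 + K) * _ := (Finset.mul_sum _ _ _).symm
      _ ≤ (1 + K) * (12 * (S + r * (1 + L z))) := by
          gcongr
          exact sum_chaining_scales_le hr (hL0 z) hH'le hsum m
      _ = _ := by ring
  exact le_of_tendsto ((hV.sub_const _).abs) (Eventually.of_forall hb)

/-! ### Peeling -/

theorem nat_sq_le_two_mul_two_pow (s : ℕ) : (s : ℝ) ^ 2 ≤ 2 * 2 ^ s := by
  have h : s ^ 2 ≤ 2 * 2 ^ s := by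
    induction s using Nat.strong_induction_on with
    | _ s ih =>
      rcases Nat.lt_or_ge s 4 with h | h
      · interval_cases s <;> norm_num
      · obtain ⟨t, rfl⟩ : ∃ t, s = t + 1 := ⟨s - 1, by omega⟩
        have := ih t (by omega)
        rw [pow_succ 2 t]
        nlinarith
  exact_mod_cast h

/-- With R = 2^s δ, the entropy term is at most R²/64 by the critical inequality. Young's inequality
bounds the fluctuation by R²/128 plus a multiple of (qa(3 + s + L))². Its s-part costs another
R²/128 since s² ≤ 2·2^s, and its L-part is absorbed by e^L. The total is R²/32; the spare -δ² pays
for the innermost shell in `exists_peeling_bound`. -/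
theorem peeling_arith {a δ q Ψr L P : ℝ} {s : ℕ} (ha : 0 ≤ a) (hq : 12 ≤ q) (hL : 0 ≤ L)
    (haδ : a ≤ δ) (hΨ : 64 * q * a * Ψr ≤ (2 ^ s * δ) ^ 2)
    (hP : P ≤ q * (Ψr + 2 ^ s * δ * (1 + (s + 2 + L)))) :
    a * P ≤ (2 ^ s * δ) ^ 2 / 32 + 10 ^ 6 * q ^ 4 * (δ ^ 2 + a ^ 2 * Real.exp L) -
      δ ^ 2 := by
  have h1 : a * P ≤ a * (q * (Ψr + 2 ^ s * δ * (1 + (s + 2 + L)))) :=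
    mul_le_mul_of_nonneg_left hP ha
  set R : ℝ := 2 ^ s * δ with hR
  have h2 : a * (q * (R * (1 + (s + 2 + L)))) ≤ R ^ 2 / 128 + 32 * (q * a * (3 + s + L)) ^ 2 := by
    nlinarith [sq_nonneg (R - 64 * (q * a * (3 + s + L)))]
  have h3 : (3 + s + L) ^ 2 ≤ 2 * (3 + L) ^ 2 + 2 * (s : ℝ) ^ 2 := by
    nlinarith [sq_nonneg (3 + L - s)]
  have h4 : (3 + L) ^ 2 ≤ 18 * Real.exp L := by
    have := Real.quadratic_le_exp_of_nonneg hL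
    nlinarith
  have h5 : 64 * q ^ 2 * (s : ℝ) ^ 2 * δ ^ 2 ≤ R ^ 2 / 128 + 128 * (64 * q ^ 2) ^ 2 * δ ^ 2 := by
    have h6 : 64 * q ^ 2 * (s : ℝ) ^ 2 ≤ 64 * q ^ 2 * (2 * 2 ^ s) := by
      gcongr; exact nat_sq_le_two_mul_two_pow s
    have h7 : 64 * q ^ 2 * (2 * 2 ^ s) ≤ (2 ^ s) ^ 2 / 128 + 128 * (64 * q ^ 2) ^ 2 := by
      nlinarith [sq_nonneg ((2 : ℝ) ^ s - 128 * (64 * q ^ 2))]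
    have h8 := mul_le_mul_of_nonneg_right (h6.trans h7) (sq_nonneg δ)
    rw [hR]
    nlinarith
  have h6 : 32 * (q * a * (3 + s + L)) ^ 2 ≤
      64 * q ^ 2 * a ^ 2 * (18 * Real.exp L) + 64 * q ^ 2 * (s : ℝ) ^ 2 * δ ^ 2 := by
    have e1 : a ^ 2 ≤ δ ^ 2 := by gcongr
    have e2 : 32 * (q * a) ^ 2 * (3 + s + L) ^ 2 ≤
        32 * (q * a) ^ 2 * (2 * (18 * Real.exp L) + 2 * (s : ℝ) ^ 2) := by
      gcongr; linarith
    have e3 : 64 * q ^ 2 * (s : ℝ) ^ 2 * a ^ 2 ≤ 64 * q ^ 2 * (s : ℝ) ^ 2 * δ ^ 2 := by gcongr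
    nlinarith
  have h7 : 64 * q ^ 2 * a ^ 2 * (18 * Real.exp L) ≤ 10 ^ 6 * q ^ 4 * (a ^ 2 * Real.exp L) := by
    have e1 : 64 * 18 * q ^ 2 ≤ 10 ^ 6 * q ^ 4 := by
      have e0 : 1 ≤ q ^ 2 := one_le_pow₀ (by linarith)
      have e2 : q ^ 4 = q ^ 2 * q ^ 2 := by ring
      nlinarith [mul_le_mul_of_nonneg_left e0 (sq_nonneg q)]
    have e2 := mul_le_mul_of_nonneg_right e1 (by positivity : 0 ≤ a ^ 2 * Real.exp L)
    nlinarith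
  have h8 : 128 * (64 * q ^ 2) ^ 2 * δ ^ 2 + δ ^ 2 ≤ 10 ^ 6 * q ^ 4 * δ ^ 2 := by
    have e0 : 1 ≤ q ^ 4 := one_le_pow₀ (by linarith)
    have e1 : 128 * (64 * q ^ 2) ^ 2 + 1 ≤ 10 ^ 6 * q ^ 4 := by nlinarith
    nlinarith [mul_le_mul_of_nonneg_right e1 (sq_nonneg δ)]
  have h9 : a * (q * Ψr) ≤ R ^ 2 / 64 := by linarith
  linarith

/-- Peeling: the process is dominated by a small multiple of the squared distance to the centre,
up to a remainder of the order of the critical radius. -/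
theorem exists_peeling_bound {T E : Type*} [MeasurableSpace E] {ν : Measure E}
    [IsProbabilityMeasure ν] {d : T → T → ℝ} (hsymm : ∀ s t, d s t = d t s)
    (htri : ∀ s t u, d s u ≤ d s t + d t u) (hd0 : ∀ s t, 0 ≤ d s t) {A : Set T} {t₀ : T}
    (ht₀ : t₀ ∈ A) (hd00 : d t₀ t₀ = 0) {Ψ : ℝ → ℝ} {K a δ : ℝ} (hK : 0 ≤ K)
    (hΨ : ∀ r, 0 < r → 0 ≤ Ψ r)
    (hanti : AntitoneOn (fun r : ℝ => Ψ r / r ^ 2) (Set.Ioi 0))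
    (hent : ∀ r, 0 < r → ∫⁻ ρ in Set.Ioc 0 r,
      entropy (fun s t => ENNReal.ofReal (d s t)) {t | t ∈ A ∧ d t t₀ ≤ r} ρ ^ (1 / 2 : ℝ) ≤
        ENNReal.ofReal (Ψ r))
    (V : T → E → ℝ) (hV : ∀ t ∈ A, Measurable (V t))
    (hmgf : ∀ s ∈ A, ∀ t ∈ A, ∀ a : ℝ, ∫⁻ z, ENNReal.ofReal (Real.exp (a * (V s z - V t z))) ∂ν ≤
      ENNReal.ofReal (Real.exp (K * a ^ 2 * d s t ^ 2)))
    (hcont : ∀ᵐ z ∂ν, ∀ t ∈ A, ∀ u : ℕ → T, (∀ k, u k ∈ A) →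
      Tendsto (fun k => d (u k) t) atTop (𝓝 0) →
        Tendsto (fun k => V (u k) z) atTop (𝓝 (V t z)))
    (ha : 0 ≤ a) (hδ : 0 < δ) (haδ : a ≤ δ) (hcrit : 768 * (1 + K) * a * Ψ δ ≤ δ ^ 2) :
    ∃ W : E → ℝ, Measurable W ∧ (∀ z, 0 ≤ W z) ∧ ∫⁻ z, ENNReal.ofReal (W z) ∂ν ≤ 2 ∧
      ∀ᵐ z ∂ν, ∀ t ∈ A, a * |V t z - V t₀ z| ≤
        d t t₀ ^ 2 / 8 + 10 ^ 6 * (12 * (1 + K)) ^ 4 * (δ ^ 2 + a ^ 2 * W z) := by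
  have hr : ∀ s : ℕ, 0 < 2 ^ s * δ := fun s => by positivity
  have key := fun s : ℕ => exists_chaining_bound (ν := ν) hsymm htri hd0
    (A := {t | t ∈ A ∧ d t t₀ ≤ 2 ^ s * δ}) (t₀ := t₀) ⟨ht₀, by rw [hd00]; exact (hr s).le⟩
    (hr s) (hΨ _ (hr s)) hK (fun t ht => ht.2) (hent _ (hr s)) V (fun t ht => hV t ht.1)
    (fun s hs t ht => hmgf s hs.1 t ht.1)
  choose Ls hLsm hLs0 hLsint hLs using key
  -- One variable controls the fluctuations of all shells; the factor 1/2 normalizes their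
  -- exponential moments from 2 to 1. Shell s then has fluctuation at most s + 2 + L.
  obtain ⟨L, hLm, hL0, hLint, hL⟩ := exists_common_bound (ν := ν)
    (fun s z => 2⁻¹ * ENNReal.ofReal (Real.exp (Ls s z)))
    (fun s => by have := hLsm s; fun_prop)
    (fun s => by
      rw [lintegral_const_mul' _ _ (by simp)]
      calc (2⁻¹ : ℝ≥0∞) * _ ≤ 2⁻¹ * 2 := by gcongr; exact hLsint s
        _ = 1 := ENNReal.inv_mul_cancel (by simp) (by simp))
  refine ⟨fun z => Real.exp (L z), by fun_prop, fun z => (Real.exp_pos _).le, hLint, ?_⟩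
  filter_upwards [hL, hcont, ae_all_iff.2 hLs] with z hz hc hchain t ht
  have hLs_le : ∀ s : ℕ, Ls s z ≤ s + 2 + L z := by
    intro s
    have h1 := hz s
    have h2 : (2⁻¹ : ℝ≥0∞) = ENNReal.ofReal 2⁻¹ := by
      rw [ENNReal.ofReal_inv_of_pos (by norm_num)]; simp
    rw [h2, ← ENNReal.ofReal_mul (by norm_num),
      ENNReal.ofReal_le_ofReal_iff (by positivity)] at h1
    have h3 : Real.exp (Ls s z) ≤ Real.exp (s + 2 + L z) := by
      calc Real.exp (Ls s z) ≤ 2 * Real.exp (s + 1 + L z) := by linarith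
        _ ≤ Real.exp 1 * Real.exp (s + 1 + L z) := by
            gcongr; linarith [Real.add_one_le_exp (1 : ℝ)]
        _ = _ := by rw [← Real.exp_add]; ring_nf
    exact Real.exp_le_exp.1 h3
  -- Since Ψ(r)/r² is non-increasing, the critical inequality at δ passes to every larger radius;
  -- 768 = 64 · 12.
  have hΨs : ∀ s : ℕ, 64 * (12 * (1 + K)) * a * Ψ (2 ^ s * δ) ≤ (2 ^ s * δ) ^ 2 := by
    intro s
    have h1 := hanti (Set.mem_Ioi.2 hδ) (Set.mem_Ioi.2 (hr s))
      (le_mul_of_one_le_left hδ.le (one_le_pow₀ (by norm_num)))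
    simp only at h1
    rw [div_le_div_iff₀ (by have := hr s; positivity) (by positivity)] at h1
    have h2 : 0 ≤ 64 * (12 * (1 + K)) * a := by positivity
    have h3 := mul_le_mul_of_nonneg_left h1 h2
    have h4 := mul_le_mul_of_nonneg_right hcrit (sq_nonneg (2 ^ s * δ))
    have h5 : 64 * (12 * (1 + K)) * a * Ψ (2 ^ s * δ) * δ ^ 2 ≤ (2 ^ s * δ) ^ 2 * δ ^ 2 := by
      linarith
    exact le_of_mul_le_mul_right h5 (by positivity)
  have hex : ∃ s : ℕ, d t t₀ ≤ 2 ^ s * δ := by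
    obtain ⟨s, hs⟩ := pow_unbounded_of_one_lt (d t t₀ / δ) (by norm_num : (1 : ℝ) < 2)
    exact ⟨s, ((div_lt_iff₀ hδ).1 hs).le⟩
  classical
  set s := Nat.find hex with hs
  have hds : d t t₀ ≤ 2 ^ s * δ := Nat.find_spec hex
  -- Outside the innermost shell, minimality of s gives 2^s δ ≤ 2 d(t, t₀), hence the coefficient
  -- 4/32 = 1/8.
  have hmin : (2 ^ s * δ) ^ 2 / 32 ≤ d t t₀ ^ 2 / 8 + δ ^ 2 := by
    rcases Nat.eq_zero_or_pos s with h0 | h0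
    · rw [h0, pow_zero, one_mul]; nlinarith [sq_nonneg (d t t₀), sq_nonneg δ]
    · have h1 := Nat.find_min hex (m := s - 1) (by omega)
      rw [not_le] at h1
      have h2 : (2 : ℝ) ^ s = 2 * 2 ^ (s - 1) := by
        rw [← pow_succ']; congr 1; omega
      have h3 : (2 ^ (s - 1) * δ) ^ 2 ≤ d t t₀ ^ 2 := by gcongr
      rw [h2]
      nlinarith [sq_nonneg δ]
  have hb := hchain s t ⟨ht, hds⟩ fun u hu hlim => hc t ht u (fun k => (hu k).1) hlim
  have hb' : |V t z - V t₀ z| ≤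
      12 * (1 + K) * (Ψ (2 ^ s * δ) + 2 ^ s * δ * (1 + (s + 2 + L z))) := by
    refine hb.trans ?_
    gcongr
    exact hLs_le s
  have := peeling_arith ha (by linarith : 12 ≤ 12 * (1 + K)) (hL0 z) haδ (hΨs s) hb'
  linarith

/-! ### Comparison of the empirical and the population norm -/

/-- The slope 1/2 in place of 1 is the source of the factor 2 between population and empirical
means. -/
theorem exp_neg_le_one_sub_half {t : ℝ} (h0 : 0 ≤ t) (h1 : t ≤ 1) : Real.exp (-t) ≤ 1 - t / 2 := by
  have h2 : 0 < 1 + t + t ^ 2 / 2 := by positivity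
  have h3 : 1 + t + t ^ 2 / 2 ≤ Real.exp t := Real.quadratic_le_exp_of_nonneg h0
  rw [Real.exp_neg, inv_le_comm₀ (Real.exp_pos t) (by linarith)]
  refine le_trans ?_ h3
  rw [inv_le_iff_one_le_mul₀ (by linarith)]
  nlinarith [mul_nonneg h0 (sub_nonneg.2 h1), mul_nonneg (mul_nonneg h0 h0) (sub_nonneg.2 h1)]

/-- Exponential lower-tail bound for empirical means of variables with values in `[0, b]`. -/
theorem lintegral_exp_mean_sub_le_one {X : Type*} [MeasurableSpace X] {γ : Measure X}
    [IsProbabilityMeasure γ] {f : X → ℝ} (hf : Measurable f) {b : ℝ} (hb : 0 < b)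
    (h0 : ∀ z, 0 ≤ f z) (h1 : ∀ᵐ z ∂γ, f z ≤ b) (n : ℕ) :
    ∫⁻ x, ENNReal.ofReal (Real.exp (n / (2 * b) * ∫ z, f z ∂γ - (∑ i, f (x i)) / b))
      ∂(Measure.pi fun _ : Fin n => γ) ≤ 1 := by
  set m := ∫ z, f z ∂γ with hm
  have hfint : Integrable f γ := by
    refine (integrable_const b).mono' hf.aestronglyMeasurable ?_
    filter_upwards [h1] with z hz
    rwa [Real.norm_of_nonneg (h0 z)]
  have hgint : Integrable (fun z => Real.exp (-(f z / b))) γ := by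
    refine (integrable_const (1 : ℝ)).mono' (by fun_prop) (Eventually.of_forall fun z => ?_)
    rw [Real.norm_of_nonneg (by positivity), Real.exp_le_one_iff]
    have := div_nonneg (h0 z) hb.le
    linarith
  -- For values in [0, b] the Laplace transform is controlled by the mean m alone; independence then
  -- raises this bound to the power n.
  have hg : ∫ z, Real.exp (-(f z / b)) ∂γ ≤ Real.exp (-(m / (2 * b))) := by
    calc ∫ z, Real.exp (-(f z / b)) ∂γ ≤ ∫ z, (1 - f z / b / 2) ∂γ := by
          refine integral_mono_ae hgint
            ((integrable_const _).sub ((hfint.div_const _).div_const _)) ?_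
          filter_upwards [h1] with z hz
          exact exp_neg_le_one_sub_half (div_nonneg (h0 z) hb.le) ((div_le_one hb).2 hz)
      _ = 1 - m / (2 * b) := by
          rw [integral_sub (integrable_const _) ((hfint.div_const _).div_const _),
            integral_div, integral_div]
          simp only [integral_const, probReal_univ, smul_eq_mul, one_mul]
          rw [div_div, mul_comm b 2]
      _ ≤ _ := by linarith [Real.add_one_le_exp (-(m / (2 * b)))]
  have heq : ∀ x : Fin n → X, Real.exp (n / (2 * b) * m - (∑ i, f (x i)) / b) =
      Real.exp (n / (2 * b) * m) * ∏ i, Real.exp (-(f (x i) / b)) := by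
    intro x
    rw [← Real.exp_sum, ← Real.exp_add, Finset.sum_neg_distrib, Finset.sum_div, sub_eq_add_neg]
  have hprod : Integrable (fun x : Fin n → X => ∏ i, Real.exp (-(f (x i) / b)))
      (Measure.pi fun _ : Fin n => γ) := Integrable.fintype_prod fun _ => hgint
  simp_rw [heq]
  rw [← ofReal_integral_eq_lintegral_ofReal (hprod.const_mul _)
    (Eventually.of_forall fun x => by positivity), ← ENNReal.ofReal_one]
  apply ENNReal.ofReal_le_ofReal
  rw [integral_const_mul,
    integral_fintype_prod_eq_prod (fun _ : Fin n => fun z => Real.exp (-(f z / b)))]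
  calc Real.exp (n / (2 * b) * m) * ∏ _i : Fin n, ∫ z, Real.exp (-(f z / b)) ∂γ
      ≤ Real.exp (n / (2 * b) * m) * ∏ _i : Fin n, Real.exp (-(m / (2 * b))) := by
        gcongr
    _ = 1 := by
        rw [Finset.prod_const, Finset.card_univ, Fintype.card_fin, ← Real.exp_nat_mul,
          ← Real.exp_add, Real.exp_eq_one_iff]
        ring

/-- The population means of finitely many functions with values in `[0, b]` are bounded by twice
their empirical means, up to a remainder of the order of the logarithm of their number. -/
theorem exists_integral_le_two_mul_mean {X ι : Type*} [MeasurableSpace X] {γ : Measure X}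
    [IsProbabilityMeasure γ] (C : Finset ι) (f : ι → X → ℝ) (hf : ∀ c ∈ C, Measurable (f c))
    {b H : ℝ} (hb : 0 < b) (h0 : ∀ c z, 0 ≤ f c z) (h1 : ∀ c ∈ C, ∀ᵐ z ∂γ, f c z ≤ b)
    (hcard : (C.card : ℝ) ≤ Real.exp H) {n : ℕ} (hn : 1 ≤ n) :
    ∃ W : (Fin n → X) → ℝ, Measurable W ∧ (∀ x, 0 ≤ W x) ∧
      ∫⁻ x, ENNReal.ofReal (W x) ∂(Measure.pi fun _ : Fin n => γ) ≤ 2 ∧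
      ∀ᵐ x ∂(Measure.pi fun _ : Fin n => γ), ∀ c ∈ C,
        ∫ z, f c z ∂γ ≤ 2 * ((n : ℝ)⁻¹ * ∑ i, f c (x i)) + 2 * b / n * (H + W x) := by
  set g : ι → (Fin n → X) → ℝ≥0∞ := fun c x =>
    ENNReal.ofReal (Real.exp (n / (2 * b) * ∫ z, f c z ∂γ - (∑ i, f c (x i)) / b)) with hg
  have hgm : ∀ c ∈ C, Measurable (g c) := fun c hc => by
    have := hf c hc
    simp only [hg]
    fun_prop
  -- There is only one finite family here, repeated for all indices; the bound is used at index 0.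
  -- Finally W = e^L absorbs 1 + L.
  obtain ⟨L, hLm, hL0, hLint, hL⟩ := exists_common_bound (ν := Measure.pi fun _ : Fin n => γ)
    (fun _ x => ENNReal.ofReal (Real.exp (-H)) * ∑ c ∈ C, g c x)
    (fun _ => (Finset.measurable_fun_sum _ hgm).const_mul _)
    (fun _ => by
      rw [lintegral_const_mul' _ _ ENNReal.ofReal_ne_top,
        lintegral_finsetSum' _ fun c hc => (hgm c hc).aemeasurable]
      calc _ ≤ ENNReal.ofReal (Real.exp (-H)) * ∑ _c ∈ C, 1 := by
            gcongr with c hc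
            exact lintegral_exp_mean_sub_le_one (hf c hc) hb (h0 c) (h1 c hc) n
        _ = ENNReal.ofReal (Real.exp (-H) * C.card) := by
            rw [ENNReal.ofReal_mul (by positivity), ENNReal.ofReal_natCast]; simp
        _ ≤ ENNReal.ofReal (Real.exp (-H) * Real.exp H) := by gcongr
        _ = 1 := by rw [← Real.exp_add]; simp)
  refine ⟨fun x => Real.exp (L x), by fun_prop, fun x => (Real.exp_pos _).le, hLint, ?_⟩
  filter_upwards [hL] with x hx c hc
  have h2 : ENNReal.ofReal (Real.exp (-H)) * g c x ≤ ENNReal.ofReal (Real.exp (1 + L x)) := by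
    have h3 := hx 0
    simp only [CharP.cast_eq_zero, zero_add] at h3
    refine le_trans ?_ h3
    gcongr
    exact Finset.single_le_sum (f := fun c => g c x) (fun _ _ => zero_le) hc
  rw [hg, ← ENNReal.ofReal_mul (by positivity), ENNReal.ofReal_le_ofReal_iff (by positivity),
    ← Real.exp_add, Real.exp_le_exp] at h2
  have h4 : 1 + L x ≤ Real.exp (L x) := by linarith [Real.add_one_le_exp (L x)]
  have hn' : (0 : ℝ) < n := by exact_mod_cast hn
  have h5 : n / (2 * b) * ∫ z, f c z ∂γ ≤ (∑ i, f c (x i)) / b + (H + Real.exp (L x)) := by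
    linarith
  calc ∫ z, f c z ∂γ = 2 * b / n * (n / (2 * b) * ∫ z, f c z ∂γ) := by field_simp
    _ ≤ 2 * b / n * ((∑ i, f c (x i)) / b + (H + Real.exp (L x))) := by gcongr
    _ = _ := by field_simp

/-! ### The empirical seminorm -/

section EmpNorm

variable {X Y : Type*} [NormedAddCommGroup Y] {n : ℕ} (x : Fin n → X)

theorem empNorm_nonneg (F : X → Y) : 0 ≤ empNorm x F := Real.sqrt_nonneg _

theorem sq_empNorm (F : X → Y) : empNorm x F ^ 2 = (n : ℝ)⁻¹ * ∑ i, ‖F (x i)‖ ^ 2 :=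
  Real.sq_sqrt (by positivity)

theorem empNorm_eq_norm_toLp (F : X → Y) :
    empNorm x F = √((n : ℝ)⁻¹) * ‖WithLp.toLp 2 (fun i => F (x i))‖ := by
  rw [empNorm, Real.sqrt_mul (by positivity), PiLp.norm_eq_of_L2]

theorem empNorm_add_le (F G : X → Y) : empNorm x (F + G) ≤ empNorm x F + empNorm x G := by
  rw [empNorm_eq_norm_toLp, empNorm_eq_norm_toLp, empNorm_eq_norm_toLp, ← mul_add]
  exact mul_le_mul_of_nonneg_left
    (norm_add_le (WithLp.toLp 2 fun i => F (x i)) (WithLp.toLp 2 fun i => G (x i)))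
    (Real.sqrt_nonneg _)

theorem empNorm_sub_comm (F G : X → Y) : empNorm x (F - G) = empNorm x (G - F) := by
  simp only [empNorm, Pi.sub_apply, norm_sub_rev]

theorem empNorm_sub_le (F G H : X → Y) :
    empNorm x (F - H) ≤ empNorm x (F - G) + empNorm x (G - H) := by
  simpa using empNorm_add_le x (F - G) (G - H)

theorem empNorm_sub_self (F : X → Y) : empNorm x (F - F) = 0 := by simp [empNorm]

theorem empNorm_le_of_forall {F : X → Y} {b : ℝ} (hb : 0 ≤ b) (h : ∀ i, ‖F (x i)‖ ≤ b) :
    empNorm x F ≤ b := by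
  rw [empNorm, Real.sqrt_le_left hb]
  calc (n : ℝ)⁻¹ * ∑ i, ‖F (x i)‖ ^ 2 ≤ (n : ℝ)⁻¹ * ∑ _i : Fin n, b ^ 2 := by
        gcongr with i; exact h i
    _ = ((n : ℝ)⁻¹ * n) * b ^ 2 := by simp [mul_assoc]
    _ ≤ b ^ 2 := by
        refine mul_le_of_le_one_left (sq_nonneg b) ?_
        rcases Nat.eq_zero_or_pos n with rfl | h
        · simp
        · rw [inv_mul_cancel₀ (by positivity)]

theorem norm_le_sqrt_mul_empNorm (F : X → Y) (i : Fin n) : ‖F (x i)‖ ≤ √n * empNorm x F := by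
  have hn : (0 : ℝ) < n := by exact_mod_cast i.pos
  have h1 : ‖F (x i)‖ ^ 2 ≤ (√n * empNorm x F) ^ 2 := by
    rw [mul_pow, sq_empNorm, Real.sq_sqrt hn.le, ← mul_assoc, mul_inv_cancel₀ hn.ne', one_mul]
    exact Finset.single_le_sum (f := fun i => ‖F (x i)‖ ^ 2) (fun _ _ => sq_nonneg _)
      (Finset.mem_univ i)
  exact le_of_sq_le_sq h1 (mul_nonneg (Real.sqrt_nonneg _) (empNorm_nonneg x F))

theorem measurable_empNorm [MeasurableSpace X] [MeasurableSpace Y] [OpensMeasurableSpace Y]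
    {F : X → Y} (hF : Measurable F) : Measurable fun x : Fin n → X => empNorm x F := by
  unfold empNorm
  fun_prop

end EmpNorm

/-! ### Separability of the class -/

/-- Compactness gives total boundedness, hence finite 1/(m+1)-nets for all m, and their union is
countable. Suprema and uniform statements over the class can thus be made measurable. -/
theorem exists_dense_seq_of_isCompact {X Y : Type*} [NormedAddCommGroup Y] {D : Set X}
    {𝒢 : Set (X → Y)} (hne : 𝒢.Nonempty) (h : IsCompact (UniformOnFun.ofFun {D} '' 𝒢)) :
    ∃ g : ℕ → X → Y, (∀ k, g k ∈ 𝒢) ∧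
      ∀ G ∈ 𝒢, ∀ b : ℝ, 0 < b → ∃ k, ∀ z ∈ D, ‖G z - g k z‖ < b := by
  have htb := h.totallyBounded
  rw [totallyBounded_iff_subset] at htb
  have hU : ∀ m : ℕ, UniformOnFun.gen {D} D {p : Y × Y | dist p.1 p.2 < 1 / ((m : ℝ) + 1)} ∈
      uniformity (X →ᵤ[{D}] Y) := fun m =>
    UniformOnFun.gen_mem_uniformity (𝔖 := {D}) (β := Y) (s := D)
      (V := {p : Y × Y | dist p.1 p.2 < 1 / ((m : ℝ) + 1)}) (Set.mem_singleton D)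
      (Metric.dist_mem_uniformity (by positivity))
  choose t ht htfin hcov using fun m => htb _ (hU m)
  set 𝒢₀ : Set (X → Y) := ⋃ m, UniformOnFun.toFun {D} '' t m with h𝒢₀
  have hsub : 𝒢₀ ⊆ 𝒢 := by
    rintro _ hG
    obtain ⟨m, f, hf, rfl⟩ := Set.mem_iUnion.1 hG
    obtain ⟨G, hG', rfl⟩ := ht m hf
    exact hG'
  have hcount : 𝒢₀.Countable :=
    Set.countable_iUnion fun m => ((htfin m).countable).image _
  have hdense : ∀ G ∈ 𝒢, ∀ b : ℝ, 0 < b → ∃ g ∈ 𝒢₀, ∀ z ∈ D, ‖G z - g z‖ < b := by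
    intro G hG b hb
    obtain ⟨m, hm⟩ := exists_nat_one_div_lt hb
    have h1 := hcov m (Set.mem_image_of_mem _ hG)
    simp only [Set.mem_iUnion] at h1
    obtain ⟨f, hf, h2⟩ := h1
    refine ⟨UniformOnFun.toFun {D} f, Set.mem_iUnion.2 ⟨m, f, hf, rfl⟩, fun z hz => ?_⟩
    have h3 : dist (G z) (UniformOnFun.toFun {D} f z) < 1 / ((m : ℝ) + 1) := h2 z hz
    rw [← dist_eq_norm]
    exact h3.trans hm
  have hne₀ : 𝒢₀.Nonempty := by
    obtain ⟨G, hG⟩ := hne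
    obtain ⟨g, hg, -⟩ := hdense G hG 1 one_pos
    exact ⟨g, hg⟩
  obtain ⟨g, hg⟩ := hcount.exists_eq_range hne₀
  refine ⟨g, fun k => hsub (hg ▸ Set.mem_range_self k), fun G hG b hb => ?_⟩
  obtain ⟨f, hf, h1⟩ := hdense G hG b hb
  rw [hg] at hf
  obtain ⟨k, rfl⟩ := hf
  exact ⟨k, h1⟩

/-! ### Deterministic comparison along the class -/

section Comparison

variable {X Y : Type*} [NormedAddCommGroup Y]

/-- Young's inequality weighted so that the leading factor stays near 1. It is applied twice when
passing to the net and back, and (5/4)² · 2 · 5/3 must remain below the final constant 8. -/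
theorem sq_norm_sub_le {u v w : Y} {b : ℝ} (h : ‖u - v‖ ≤ b) :
    ‖u - w‖ ^ 2 ≤ 5 / 4 * ‖v - w‖ ^ 2 + 5 * b ^ 2 := by
  have h1 : ‖u - w‖ ≤ ‖u - v‖ + ‖v - w‖ := norm_sub_le_norm_sub_add_norm_sub u v w
  have h2 : ‖u - w‖ ≤ b + ‖v - w‖ := by linarith
  have h3 : ‖u - w‖ ^ 2 ≤ (b + ‖v - w‖) ^ 2 := by gcongr
  nlinarith [sq_nonneg (‖v - w‖ - 4 * b)]

theorem sq_empNorm_sub_le {n : ℕ} (x : Fin n → X) {F G H : X → Y} {b : ℝ} (hb : 0 ≤ b)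
    (h : ∀ i, ‖F (x i) - G (x i)‖ ≤ b) :
    empNorm x (F - H) ^ 2 ≤ 5 / 4 * empNorm x (G - H) ^ 2 + 5 * b ^ 2 := by
  have h1 := empNorm_sub_le x F G H
  have h2 := empNorm_le_of_forall x (F := F - G) hb h
  have h3 : empNorm x (F - H) ≤ b + empNorm x (G - H) := by linarith
  have h4 : empNorm x (F - H) ^ 2 ≤ (b + empNorm x (G - H)) ^ 2 := by
    have := empNorm_nonneg x (F - H)
    gcongr
  nlinarith [sq_nonneg (empNorm x (G - H) - 4 * b)]

theorem integral_sq_norm_sub_le [MeasurableSpace X] {γ : Measure X}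
    [IsProbabilityMeasure γ] {D : Set X} (hD : ∀ᵐ z ∂γ, z ∈ D) {F G H : X → Y} {b : ℝ}
    (h : ∀ z ∈ D, ‖F z - G z‖ ≤ b) (hF : Integrable (fun z => ‖F z - H z‖ ^ 2) γ)
    (hG : Integrable (fun z => ‖G z - H z‖ ^ 2) γ) :
    ∫ z, ‖F z - H z‖ ^ 2 ∂γ ≤ 5 / 4 * ∫ z, ‖G z - H z‖ ^ 2 ∂γ + 5 * b ^ 2 := by
  calc ∫ z, ‖F z - H z‖ ^ 2 ∂γ ≤ ∫ z, (5 / 4 * ‖G z - H z‖ ^ 2 + 5 * b ^ 2) ∂γ := by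
        refine integral_mono_ae hF ((hG.const_mul _).add (integrable_const _)) ?_
        filter_upwards [hD] with z hz
        exact sq_norm_sub_le (h z hz)
    _ = _ := by
        rw [integral_add (hG.const_mul _) (integrable_const _), integral_const_mul]
        simp

theorem integrable_sq_norm_sub [MeasurableSpace X] [MeasurableSpace Y] [BorelSpace Y]
    [SecondCountableTopology Y] {γ : Measure X} [IsProbabilityMeasure γ] {D : Set X}
    (hD : ∀ᵐ z ∂γ, z ∈ D) {F G : X → Y} (hF : Measurable F) (hG : Measurable G) {b : ℝ}
    (h : ∀ z ∈ D, ‖F z - G z‖ ≤ b) : Integrable (fun z => ‖F z - G z‖ ^ 2) γ := by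
  refine (integrable_const (b ^ 2)).mono' (by fun_prop) ?_
  filter_upwards [hD] with z hz
  rw [Real.norm_of_nonneg (by positivity)]
  have := h z hz
  gcongr

theorem sq_eLpNorm_two_eq_ofReal [MeasurableSpace X] {γ : Measure X} {F : X → Y}
    (hF : Integrable (fun z => ‖F z‖ ^ 2) γ) :
    eLpNorm F 2 γ ^ 2 = ENNReal.ofReal (∫ z, ‖F z‖ ^ 2 ∂γ) := by
  have h := eLpNorm_nnreal_pow_eq_lintegral (μ := γ) (f := F) (p := 2) (by norm_num)
  simp only [NNReal.coe_ofNat, ENNReal.rpow_ofNat, ENNReal.coe_ofNat] at h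
  rw [h, ofReal_integral_eq_lintegral_ofReal hF (Eventually.of_forall fun z => by positivity)]
  refine lintegral_congr fun z => ?_
  rw [ENNReal.ofReal_pow (norm_nonneg _), ofReal_norm]

end Comparison

/-! ### Uniform comparison of the norms over the class -/

/-- Uniformly over the class, the squared population distance to `G₀` is bounded by a multiple of
the squared empirical distance, up to a remainder with bounded expectation. -/
theorem exists_uniform_norm_comparison {X Y : Type*} [MeasurableSpace X] [NormedAddCommGroup Y]
    [MeasurableSpace Y] [BorelSpace Y] [SecondCountableTopology Y] {γ : Measure X}
    [IsProbabilityMeasure γ] {D : Set X} (hD : ∀ᵐ z ∂γ, z ∈ D) {n : ℕ} (hn : 1 ≤ n)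
    {G₀ : X → Y} (hG₀ : Measurable G₀) {𝒢 : Set (X → Y)} (hne : 𝒢.Nonempty)
    (hmeas : ∀ G ∈ 𝒢, Measurable G) {F : ℝ} (hF : 0 < F)
    (hbd : ∀ G ∈ 𝒢, ∀ z ∈ D, ‖G z - G₀ z‖ ≤ F) {δ : ℝ} (hδ : 0 < δ) {C : ℝ} (hC : 1 ≤ C)
    (hent : ENNReal.ofReal (C * F ^ 2) * entropy (supDist D) 𝒢 δ ≤ ENNReal.ofReal (n * δ ^ 2)) :
    ∃ W : (Fin n → X) → ℝ, Measurable W ∧ (∀ x, 0 ≤ W x) ∧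
      ∫⁻ x, ENNReal.ofReal (W x) ∂(Measure.pi fun _ : Fin n => γ) ≤ 2 ∧
      ∀ᵐ x ∂(Measure.pi fun _ : Fin n => γ), ∀ G ∈ 𝒢,
        ∫ z, ‖G z - G₀ z‖ ^ 2 ∂γ ≤ 25 / 8 * empNorm x (G - G₀) ^ 2 + 20 * δ ^ 2 +
          5 / 2 * (F ^ 2 / n) * W x := by
  have hCF : 0 < C * F ^ 2 := by positivity
  have hn' : (0 : ℝ) < n := by exact_mod_cast hn
  have hfin : entropy (supDist D) 𝒢 δ ≠ ⊤ := by
    intro h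
    rw [h, ENNReal.mul_top (by simpa using hCF)] at hent
    exact ENNReal.ofReal_ne_top (top_le_iff.1 hent)
  obtain ⟨N, hNA, hN, hcard⟩ := exists_finset_cover hne hfin
  set H := (entropy (supDist D) 𝒢 δ).toReal with hH
  have hHle : F ^ 2 * H ≤ n * δ ^ 2 := by
    rw [← ENNReal.ofReal_toReal hfin, ← ENNReal.ofReal_mul hCF.le,
      ENNReal.ofReal_le_ofReal_iff (by positivity)] at hent
    have h1 : 0 ≤ F ^ 2 * H := by positivity
    nlinarith
  have hint : ∀ G ∈ 𝒢, Integrable (fun z => ‖G z - G₀ z‖ ^ 2) γ := fun G hG =>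
    integrable_sq_norm_sub hD (hmeas G hG) hG₀ (hbd G hG)
  obtain ⟨W, hWm, hW0, hWint, hW⟩ := exists_integral_le_two_mul_mean (γ := γ) N
    (fun G z => ‖G z - G₀ z‖ ^ 2)
    (fun G hG => by have := hmeas G (hNA G hG); fun_prop)
    (b := F ^ 2) (H := H) (by positivity) (fun _ _ => by positivity)
    (fun G hG => by
      filter_upwards [hD] with z hz
      have := hbd G (hNA G hG) z hz
      gcongr) hcard hn
  refine ⟨W, hWm, hW0, hWint, ?_⟩
  have hDx : ∀ᵐ x ∂(Measure.pi fun _ : Fin n => γ), ∀ i, x i ∈ D :=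
    ae_all_iff.2 fun i => Measure.tendsto_eval_ae_ae.eventually hD
  filter_upwards [hW, hDx] with x hx hxD G hG
  obtain ⟨c, hc, hd⟩ := hN G hG
  have hdist : ∀ z ∈ D, ‖G z - c z‖ ≤ δ := by
    intro z hz
    have h1 : ‖G z - c z‖ₑ ≤ supDist D G c := le_iSup₂ (f := fun x _ => ‖G x - c x‖ₑ) z hz
    have h2 := h1.trans hd.le
    rwa [← ofReal_norm, ENNReal.ofReal_le_ofReal_iff hδ.le] at h2
  have h1 := integral_sq_norm_sub_le hD hdist (hint G hG) (hint c (hNA c hc))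
  have h2 := hx c hc
  have h3 := sq_empNorm_sub_le x (F := c) (G := G) (H := G₀) hδ.le
    (fun i => by rw [norm_sub_rev]; exact hdist _ (hxD i))
  rw [sq_empNorm x (c - G₀)] at h3
  simp only [Pi.sub_apply] at h3
  have h4 : 2 * F ^ 2 / n * (H + W x) ≤ 2 * δ ^ 2 + 2 * (F ^ 2 / n) * W x := by
    have : 2 * F ^ 2 / n * H ≤ 2 * δ ^ 2 := by
      rw [div_mul_eq_mul_div, div_le_iff₀ hn']
      linarith
    calc 2 * F ^ 2 / n * (H + W x) = 2 * F ^ 2 / n * H + 2 * (F ^ 2 / n) * W x := by ring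
      _ ≤ _ := by linarith
  -- The constants are 25/8 = 5/4 · 2 · 5/4, 20 = 5 + 5/4 · (2 · 5 + 2) and 5/2 = 5/4 · 2.
  linarith

/-! ### The basic inequality -/

/-- Up to ‖G₀‖_n², which is common to all maps, ‖F - G₀‖_n² is the empirical risk plus 2σ times the
averaged noise at F. The noise w need not be linear, so the difference of its two values appears and
not its value at a difference. -/
theorem basic_inequality {X Y : Type*} [NormedAddCommGroup Y] [InnerProductSpace ℝ Y] {n : ℕ}
    (x : Fin n → X) (G₀ G Gs : X → Y) (w : Fin n → Y → ℝ) (σ : ℝ)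
    (h : empiricalRisk x (fun i f => inner ℝ (G₀ (x i)) f + σ * w i f) G ≤
      empiricalRisk x (fun i f => inner ℝ (G₀ (x i)) f + σ * w i f) Gs) :
    empNorm x (G - G₀) ^ 2 ≤ empNorm x (Gs - G₀) ^ 2 +
      2 * σ / √n * ((√n)⁻¹ * ∑ i, w i (G (x i)) - (√n)⁻¹ * ∑ i, w i (Gs (x i))) := by
  have h1 : ∀ F : X → Y, empNorm x (F - G₀) ^ 2 =
      empiricalRisk x (fun i f => inner ℝ (G₀ (x i)) f + σ * w i f) F +
        2 * σ * ((n : ℝ)⁻¹ * ∑ i, w i (F (x i))) + (n : ℝ)⁻¹ * ∑ i, ‖G₀ (x i)‖ ^ 2 := by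
    intro F
    rw [sq_empNorm, empiricalRisk]
    calc (n : ℝ)⁻¹ * ∑ i, ‖(F - G₀) (x i)‖ ^ 2 = (n : ℝ)⁻¹ * ∑ i,
        ((-2 * (inner ℝ (G₀ (x i)) (F (x i)) + σ * w i (F (x i))) + ‖F (x i)‖ ^ 2) +
          2 * σ * w i (F (x i)) + ‖G₀ (x i)‖ ^ 2) := by
          congr 1
          refine Finset.sum_congr rfl fun i _ => ?_
          rw [Pi.sub_apply, norm_sub_sq_real, real_inner_comm]
          ring
      _ = _ := by
          rw [Finset.sum_add_distrib, Finset.sum_add_distrib, ← Finset.mul_sum]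
          ring
  have h2 : 2 * σ / √n * ((√n)⁻¹ * ∑ i, w i (G (x i)) - (√n)⁻¹ * ∑ i, w i (Gs (x i))) =
      2 * σ * ((n : ℝ)⁻¹ * ∑ i, w i (G (x i))) - 2 * σ * ((n : ℝ)⁻¹ * ∑ i, w i (Gs (x i))) := by
    have : (√(n : ℝ))⁻¹ * (√n)⁻¹ = (n : ℝ)⁻¹ := by
      rw [← mul_inv, Real.mul_self_sqrt (by positivity)]
    rw [← this]
    ring
  rw [h1 G, h1 Gs, h2]
  linarith

/-- A minimizer of the empirical risk is almost as close to `G₀` as any competitor, if the noise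
process is dominated by the squared distance. -/
theorem sq_empNorm_le_of_basic_inequality {X Y : Type*} [NormedAddCommGroup Y] {n : ℕ}
    (x : Fin n → X) {G₀ G Gs : X → Y} {v R : ℝ}
    (h : empNorm x (G - G₀) ^ 2 ≤ empNorm x (Gs - G₀) ^ 2 + v)
    (hv : v ≤ empNorm x (G - Gs) ^ 2 / 8 + R) :
    empNorm x (G - G₀) ^ 2 ≤ 5 / 3 * empNorm x (Gs - G₀) ^ 2 + 4 / 3 * R := by
  have h1 := empNorm_sub_le x G G₀ Gs
  rw [empNorm_sub_comm x G₀ Gs] at h1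
  have h2 : empNorm x (G - Gs) ^ 2 ≤ (empNorm x (G - G₀) + empNorm x (Gs - G₀)) ^ 2 := by
    have := empNorm_nonneg x (G - Gs)
    gcongr
  -- With A, B the distances of G, Gs to G₀: A² ≤ B² + (A² + B²)/4 + R, so 3/4 A² ≤ 5/4 B² + R.
  nlinarith [sq_nonneg (empNorm x (G - G₀) - empNorm x (Gs - G₀))]

/-! ### The noise term -/

/-- The normalized noise process `n^(-1/2) ∑ w i (G (x i))`. -/
noncomputable def noiseProcess {X Y E : Type*} {n : ℕ} (w : Fin n → Y → E → ℝ) (x : Fin n → X)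
    (G : X → Y) (z : E) : ℝ :=
  (√(n : ℝ))⁻¹ * ∑ i, w i (G (x i)) z

section NoiseTerm

variable {X Y E : Type*} [MeasurableSpace E]

theorem measurable_noiseProcess [MeasurableSpace X] [MeasurableSpace Y] {n : ℕ}
    {w : Fin n → Y → E → ℝ}
    (hw : ∀ i, Measurable fun p : Y × E => w i p.1 p.2) {G : X → Y} (hG : Measurable G) :
    Measurable fun p : (Fin n → X) × E => noiseProcess w p.1 G p.2 := by
  unfold noiseProcess
  refine measurable_const.mul (Finset.measurable_fun_sum _ fun i _ => ?_)
  exact (hw i).comp (f := fun p : (Fin n → X) × E => (G (p.1 i), p.2)) (by fun_prop)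

theorem lintegral_exp_noiseProcess_le [NormedAddCommGroup Y] {n : ℕ} (hn : 1 ≤ n) {ν : Measure E}
    {w : Fin n → Y → E → ℝ} {K : ℝ}
    (hmgf : ∀ u v : Fin n → Y, ∀ a : ℝ,
      ∫⁻ z, ENNReal.ofReal (Real.exp (a * ∑ i, (w i (u i) z - w i (v i) z))) ∂ν ≤
        ENNReal.ofReal (Real.exp (K * a ^ 2 * ∑ i, ‖u i - v i‖ ^ 2)))
    (x : Fin n → X) (F G : X → Y) (a : ℝ) :
    ∫⁻ z, ENNReal.ofReal (Real.exp (a * (noiseProcess w x F z - noiseProcess w x G z))) ∂ν ≤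
      ENNReal.ofReal (Real.exp (K * a ^ 2 * empNorm x (F - G) ^ 2)) := by
  have h := hmgf (fun i => F (x i)) (fun i => G (x i)) (a * (√(n : ℝ))⁻¹)
  have hn' : (0 : ℝ) < n := by exact_mod_cast hn
  have h1 : K * (a * (√(n : ℝ))⁻¹) ^ 2 * ∑ i, ‖F (x i) - G (x i)‖ ^ 2 =
      K * a ^ 2 * empNorm x (F - G) ^ 2 := by
    rw [sq_empNorm, mul_pow, inv_pow, Real.sq_sqrt hn'.le]
    simp only [Pi.sub_apply]
    ring
  rw [h1] at h
  refine le_trans (le_of_eq (lintegral_congr fun z => ?_)) h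
  rw [noiseProcess, noiseProcess, Finset.sum_sub_distrib]
  ring_nf

/-- The noise term is dominated by a small multiple of the squared empirical distance, uniformly
over the class, up to a remainder with expectation of the order of the squared critical radius. -/
theorem exists_noise_remainder [MeasurableSpace X] [TopologicalSpace X]
    [HereditarilyLindelofSpace X] [NormedAddCommGroup Y] [MeasurableSpace Y] [BorelSpace Y]
    [SecondCountableTopology Y] {γ : Measure X}
    [IsProbabilityMeasure γ] {n : ℕ} (hn : 1 ≤ n) {G₀ Gs : X → Y} {𝒢 : Set (X → Y)} {Ψ : ℝ → ℝ}
    (hclass : ClassAssumption n γ G₀ 𝒢 Gs Ψ) {ν : Measure E} [IsProbabilityMeasure ν]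
    {w : Fin n → Y → E → ℝ} (hw : ∀ i, Measurable fun p : Y × E => w i p.1 p.2) {K : ℝ}
    (hK : 0 ≤ K)
    (hmgf : ∀ u v : Fin n → Y, ∀ a : ℝ,
      ∫⁻ z, ENNReal.ofReal (Real.exp (a * ∑ i, (w i (u i) z - w i (v i) z))) ∂ν ≤
        ENNReal.ofReal (Real.exp (K * a ^ 2 * ∑ i, ‖u i - v i‖ ^ 2)))
    (hcont : ∀ᵐ p ∂((Measure.pi fun _ : Fin n => γ).prod ν), ∀ G ∈ 𝒢, ∀ u : ℕ → X → Y,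
      (∀ k, u k ∈ 𝒢) → Tendsto (fun k => empNorm p.1 (u k - G)) atTop (𝓝 0) →
        ∀ i, Tendsto (fun k => w i (u k (p.1 i)) p.2) atTop (𝓝 (w i (G (p.1 i)) p.2)))
    {a δ : ℝ} (ha : 0 ≤ a) (hδ : 0 < δ) (haδ : a ≤ δ)
    (hcrit : 768 * (1 + K) * a * Ψ δ ≤ δ ^ 2) :
    ∃ R : (Fin n → X) × E → ℝ≥0∞, Measurable R ∧
      ∫⁻ p, R p ∂((Measure.pi fun _ : Fin n => γ).prod ν) ≤
        ENNReal.ofReal (10 ^ 6 * (12 * (1 + K)) ^ 4 * (δ ^ 2 + 2 * a ^ 2)) ∧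
      ∀ᵐ p ∂((Measure.pi fun _ : Fin n => γ).prod ν), ∀ G ∈ 𝒢,
        ENNReal.ofReal (a * (noiseProcess w p.1 G p.2 - noiseProcess w p.1 Gs p.2) -
          empNorm p.1 (G - Gs) ^ 2 / 8) ≤ R p := by
  set P := Measure.pi fun _ : Fin n => γ with hP
  have hcont' : ∀ᵐ p ∂(P.prod ν), ∀ G ∈ 𝒢, ∀ u : ℕ → X → Y,
      (∀ k, u k ∈ 𝒢) → Tendsto (fun k => empNorm p.1 (u k - G)) atTop (𝓝 0) →
        Tendsto (fun k => noiseProcess w p.1 (u k) p.2) atTop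
          (𝓝 (noiseProcess w p.1 G p.2)) := by
    filter_upwards [hcont] with p hp G hG u hu hlim
    exact (tendsto_finsetSum _ fun i _ => hp G hG u hu hlim i).const_mul _
  obtain ⟨g, hg𝒢, hg⟩ := exists_dense_seq_of_isCompact ⟨Gs, hclass.mem⟩ hclass.compact
  have hGsm := hclass.measurable Gs hclass.mem
  -- The remainder is a supremum over a countable dense subfamily, which keeps it measurable;
  -- continuity of the noise extends the bound to the whole class.
  have hRm : Measurable fun p : (Fin n → X) × E => ⨆ k, ENNReal.ofReal
      (a * (noiseProcess w p.1 (g k) p.2 - noiseProcess w p.1 Gs p.2) -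
        empNorm p.1 (g k - Gs) ^ 2 / 8) := by
    refine Measurable.iSup fun k => Measurable.ennreal_ofReal ?_
    have hgm := hclass.measurable _ (hg𝒢 k)
    have h1 := measurable_noiseProcess hw hgm
    have h2 := measurable_noiseProcess hw hGsm
    have h3 : Measurable fun p : (Fin n → X) × E => empNorm p.1 (g k - Gs) :=
      (measurable_empNorm (hgm.sub hGsm)).comp measurable_fst
    fun_prop
  refine ⟨_, hRm, ?_, ?_⟩
  · rw [lintegral_prod _ hRm.aemeasurable]
    set M : ℝ := 10 ^ 6 * (12 * (1 + K)) ^ 4 with hM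
    have hM0 : 0 ≤ M := by positivity
    have hx : ∀ᵐ x ∂P, ∫⁻ z, ⨆ k, ENNReal.ofReal
        (a * (noiseProcess w x (g k) z - noiseProcess w x Gs z) -
          empNorm x (g k - Gs) ^ 2 / 8) ∂ν ≤ ENNReal.ofReal (M * (δ ^ 2 + 2 * a ^ 2)) := by
      -- With the design x frozen, peeling applies to the noise alone in the metric ‖·‖_n. The
      -- resulting bound does not depend on x, so integrating over the design costs nothing.
      filter_upwards [hclass.entropyIntegral_le, Measure.ae_ae_of_ae_prod hcont'] with x hxent hxc
      obtain ⟨W, hWm, hW0, hWint, hW⟩ := exists_peeling_bound (ν := ν)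
        (d := fun F G : X → Y => empNorm x (F - G)) (empNorm_sub_comm x) (empNorm_sub_le x)
        (fun _ _ => empNorm_nonneg x _) hclass.mem (empNorm_sub_self x Gs) hK hclass.nonneg
        hclass.antitone hxent (fun G z => noiseProcess w x G z)
        (fun G hG => (measurable_noiseProcess hw (hclass.measurable G hG)).comp
          measurable_prodMk_left)
        (fun F _ G _ b => lintegral_exp_noiseProcess_le hn hmgf x F G b) hxc ha hδ haδ hcrit
      calc _ ≤ ∫⁻ z, (ENNReal.ofReal (M * δ ^ 2) +
            ENNReal.ofReal (M * a ^ 2) * ENNReal.ofReal (W z)) ∂ν := by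
            refine lintegral_mono_ae ?_
            filter_upwards [hW] with z hz
            refine iSup_le fun k => ?_
            rw [← ENNReal.ofReal_mul (by positivity), ← ENNReal.ofReal_add (by positivity)
              (by have := hW0 z; positivity)]
            apply ENNReal.ofReal_le_ofReal
            have h1 := hz (g k) (hg𝒢 k)
            have h2 := mul_le_mul_of_nonneg_left
              (le_abs_self (noiseProcess w x (g k) z - noiseProcess w x Gs z)) ha
            linarith
        _ ≤ ENNReal.ofReal (M * δ ^ 2) + ENNReal.ofReal (M * a ^ 2) * 2 := by
            rw [lintegral_add_left measurable_const,
              lintegral_const_mul' _ _ ENNReal.ofReal_ne_top]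
            simp only [lintegral_const, measure_univ, mul_one]
            gcongr
        _ = _ := by
            rw [show (2 : ℝ≥0∞) = ENNReal.ofReal 2 by simp, ← ENNReal.ofReal_mul (by positivity),
              ← ENNReal.ofReal_add (by positivity) (by positivity)]
            ring_nf
    calc _ ≤ ∫⁻ _x, ENNReal.ofReal (M * (δ ^ 2 + 2 * a ^ 2)) ∂P := lintegral_mono_ae hx
      _ = _ := by simp
  · have hD : ∀ᵐ x ∂P, ∀ i, x i ∈ γ.support :=
      ae_all_iff.2 fun i => Measure.tendsto_eval_ae_ae.eventually Measure.support_mem_ae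
    have hD' : ∀ᵐ p ∂(P.prod ν), ∀ i, p.1 i ∈ γ.support :=
      Measure.quasiMeasurePreserving_fst.ae hD
    filter_upwards [hcont', hD'] with p hp hpD G hG
    -- Approximation in sup norm on the support implies approximation in ‖·‖_n, because almost
    -- surely all design points lie in the support.
    choose k hk using fun m : ℕ => hg G hG (1 / ((m : ℝ) + 1)) (by positivity)
    have hlim : Tendsto (fun m => empNorm p.1 (g (k m) - G)) atTop (𝓝 0) := by
      refine squeeze_zero (fun m => empNorm_nonneg _ _) (fun m => ?_)
        tendsto_one_div_add_atTop_nhds_zero_nat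
      refine empNorm_le_of_forall _ (by positivity) fun i => ?_
      rw [Pi.sub_apply, norm_sub_rev]
      exact (hk m _ (hpD i)).le
    have hV := hp G hG _ (fun m => hg𝒢 (k m)) hlim
    have hd : Tendsto (fun m => empNorm p.1 (g (k m) - Gs)) atTop (𝓝 (empNorm p.1 (G - Gs))) := by
      rw [tendsto_iff_dist_tendsto_zero]
      refine squeeze_zero (fun m => dist_nonneg) (fun m => ?_) hlim
      rw [Real.dist_eq, abs_le]
      have h1 := empNorm_sub_le p.1 (g (k m)) G Gs
      have h2 := empNorm_sub_le p.1 G (g (k m)) Gs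
      rw [empNorm_sub_comm p.1 G (g (k m))] at h2
      constructor <;> linarith
    have h1 := ENNReal.tendsto_ofReal
      (((hV.sub_const (noiseProcess w p.1 Gs p.2)).const_mul a).sub ((hd.pow 2).div_const 8))
    exact le_of_tendsto h1 (Eventually.of_forall fun m => le_iSup (fun k => ENNReal.ofReal
      (a * (noiseProcess w p.1 (g k) p.2 - noiseProcess w p.1 Gs p.2) -
        empNorm p.1 (g k - Gs) ^ 2 / 8)) (k m))

end NoiseTerm

/-! ### The risk bound -/

/-- The constant of the risk bound for noise with sub-Gaussian parameter `K`. -/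
noncomputable def riskConst (K : ℝ) : ℝ := 10 ^ 8 * (12 * (1 + K)) ^ 4

theorem le_riskConst {K : ℝ} (hK : 0 ≤ K) : 1536 * (1 + K) ≤ riskConst K := by
  have h1 : 1 + K ≤ (12 * (1 + K)) ^ 4 := by
    calc 1 + K ≤ 12 * (1 + K) := by linarith
      _ ≤ (12 * (1 + K)) ^ 4 := le_self_pow₀ (by linarith) (by norm_num)
  rw [riskConst]
  nlinarith

/-- Peeling needs a radius not below a = 2σ/√n, so δ is replaced by max δ a. Monotonicity of Ψ(r)/r²
keeps the radius critical, and the 2 in a doubles 768 to 1536. -/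
theorem critical_radius_arith {n : ℕ} (hn : 1 ≤ n) {Ψ : ℝ → ℝ} {K C σ δ δ₁ : ℝ} (hK : 0 ≤ K)
    (hC : 1536 * (1 + K) ≤ C) (hσ : 0 < σ) (hδ : 0 < δ) (hδ₁ : δ ≤ δ₁) (hΨ : 0 ≤ Ψ δ)
    (hanti : AntitoneOn (fun r : ℝ => Ψ r / r ^ 2) (Set.Ioi 0))
    (h : C * σ * Ψ δ ≤ √(n : ℝ) * δ ^ 2) :
    768 * (1 + K) * (2 * σ / √n) * Ψ δ₁ ≤ δ₁ ^ 2 := by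
  have hn' : (0 : ℝ) < √n := Real.sqrt_pos.2 (by exact_mod_cast hn)
  have hδ₁' : 0 < δ₁ := hδ.trans_le hδ₁
  have h1 := hanti (Set.mem_Ioi.2 hδ) (Set.mem_Ioi.2 hδ₁') hδ₁
  simp only at h1
  rw [div_le_iff₀ (by positivity)] at h1
  have h2 : 768 * (1 + K) * (2 * σ / √n) * (Ψ δ / δ ^ 2) ≤ 1 := by
    rw [show 768 * (1 + K) * (2 * σ / √n) * (Ψ δ / δ ^ 2) =
      (1536 * (1 + K) * (σ * Ψ δ)) / (√n * δ ^ 2) by field_simp; ring, div_le_one (by positivity)]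
    calc 1536 * (1 + K) * (σ * Ψ δ) ≤ C * (σ * Ψ δ) := by gcongr
      _ ≤ _ := by linarith
  calc 768 * (1 + K) * (2 * σ / √n) * Ψ δ₁
      ≤ 768 * (1 + K) * (2 * σ / √n) * (Ψ δ / δ ^ 2 * δ₁ ^ 2) := by gcongr
    _ = (768 * (1 + K) * (2 * σ / √n) * (Ψ δ / δ ^ 2)) * δ₁ ^ 2 := by ring
    _ ≤ 1 * δ₁ ^ 2 := by gcongr
    _ = _ := one_mul _

theorem lintegral_sq_empNorm {X Y : Type*} [MeasurableSpace X] [NormedAddCommGroup Y]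
    {γ : Measure X} [IsProbabilityMeasure γ] {n : ℕ} (hn : 1 ≤ n) {F : X → Y}
    (hF : Integrable (fun z => ‖F z‖ ^ 2) γ) :
    ∫⁻ x, ENNReal.ofReal (empNorm x F ^ 2) ∂(Measure.pi fun _ : Fin n => γ) =
      ENNReal.ofReal (∫ z, ‖F z‖ ^ 2 ∂γ) := by
  simp_rw [sq_empNorm]
  have h : ∀ i : Fin n, Integrable (fun x : Fin n → X => ‖F (x i)‖ ^ 2)
      (Measure.pi fun _ : Fin n => γ) := fun i =>
    integrable_comp_eval (μ := fun _ : Fin n => γ) (i := i) hF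
  rw [← ofReal_integral_eq_lintegral_ofReal
    ((integrable_finsetSum _ fun i _ => h i).const_mul _)
    (Eventually.of_forall fun x => by positivity), integral_const_mul,
    integral_finsetSum _ fun i _ => h i]
  congr 1
  rw [Finset.sum_congr rfl fun i _ => integral_comp_eval (μ := fun _ : Fin n => γ) (i := i)
    hF.aestronglyMeasurable]
  have : (n : ℝ) ≠ 0 := by positivity
  simp [this]

/-- The risk bound relative to one reference map, for noise which is represented on an auxiliary
probability space independent of the design. -/
theorem lintegral_risk_le_of_noise_representation {X Y Ω E : Type*}
    [TopologicalSpace X] [HereditarilyLindelofSpace X] [MeasurableSpace X]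
    [NormedAddCommGroup Y] [InnerProductSpace ℝ Y] [SecondCountableTopology Y]
    [MeasurableSpace Y] [BorelSpace Y] [MeasurableSpace Ω] {μ : Measure Ω}
    {γ : Measure X} [IsProbabilityMeasure γ] {n : ℕ} (hn : 1 ≤ n) {σ : ℝ} (hσ : 0 < σ)
    {G₀ Gs : X → Y} (hG₀ : Measurable G₀) {𝒢 : Set (X → Y)} {Ψ : ℝ → ℝ}
    (hclass : ClassAssumption n γ G₀ 𝒢 Gs Ψ) {F : ℝ} (hF : 0 < F)
    (hbd : ∀ G ∈ 𝒢, ∀ z ∈ γ.support, ‖G z - G₀ z‖ ≤ F)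
    {x : Fin n → Ω → X} {ε : Fin n → Y → Ω → ℝ} {Ghat : Ω → X → Y}
    (hERM : IsERM γ G₀ 𝒢 σ x ε μ Ghat)
    [MeasurableSpace E] {ν : Measure E} [IsProbabilityMeasure ν] {η : Ω → E}
    (hlaw_meas : Measurable fun ω => (fun i => x i ω, η ω))
    (hlaw : μ.map (fun ω => (fun i => x i ω, η ω)) = (Measure.pi fun _ : Fin n => γ).prod ν)
    {w : Fin n → Y → E → ℝ} (hw : ∀ i, Measurable fun p : Y × E => w i p.1 p.2) {K : ℝ}
    (hK : 0 ≤ K)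
    (hmgf : ∀ u v : Fin n → Y, ∀ a : ℝ,
      ∫⁻ z, ENNReal.ofReal (Real.exp (a * ∑ i, (w i (u i) z - w i (v i) z))) ∂ν ≤
        ENNReal.ofReal (Real.exp (K * a ^ 2 * ∑ i, ‖u i - v i‖ ^ 2)))
    (hcont : ∀ᵐ p ∂((Measure.pi fun _ : Fin n => γ).prod ν), ∀ G ∈ 𝒢, ∀ u : ℕ → X → Y,
      (∀ k, u k ∈ 𝒢) → Tendsto (fun k => empNorm p.1 (u k - G)) atTop (𝓝 0) →
        ∀ i, Tendsto (fun k => w i (u k (p.1 i)) p.2) atTop (𝓝 (w i (G (p.1 i)) p.2)))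
    (heq : ∀ᵐ ω ∂μ, ∀ G ∈ 𝒢, ∀ i, ε i (G (x i ω)) ω = w i (G (x i ω)) (η ω))
    {δ δ' : ℝ} (hδ : 0 < δ) (hδ' : 0 < δ')
    (hcrit : riskConst K * σ * Ψ δ ≤ √(n : ℝ) * δ ^ 2)
    (hent : ENNReal.ofReal (riskConst K * F ^ 2) * entropy (supDist γ.support) 𝒢 δ' ≤
      ENNReal.ofReal (n * δ' ^ 2)) :
    ∫⁻ ω, eLpNorm (Ghat ω - G₀) 2 γ ^ 2 ∂μ ≤
      ENNReal.ofReal (riskConst K * (δ ^ 2 + δ' ^ 2 + (σ ^ 2 + F ^ 2) / n)) +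
        8 * eLpNorm (Gs - G₀) 2 γ ^ 2 := by
  set P := Measure.pi fun _ : Fin n => γ with hP
  have hn' : (0 : ℝ) < n := by exact_mod_cast hn
  have hsq : (0 : ℝ) < √n := Real.sqrt_pos.2 hn'
  have hD : ∀ᵐ z ∂γ, z ∈ γ.support := Measure.support_mem_ae
  have hC1 : 1 ≤ riskConst K := by linarith [le_riskConst hK]
  set a : ℝ := 2 * σ / √n with ha
  have ha0 : 0 < a := by positivity
  have ha2 : a ^ 2 = 4 * (σ ^ 2 / n) := by
    rw [ha, div_pow, Real.sq_sqrt hn'.le]; ring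
  set δ₁ := max δ a with hδ₁
  have hδ₁sq : δ₁ ^ 2 ≤ δ ^ 2 + a ^ 2 := by
    rcases max_choice δ a with h | h <;> rw [hδ₁, h] <;> nlinarith [sq_nonneg δ, sq_nonneg a]
  obtain ⟨R, hRm, hRint, hR⟩ := exists_noise_remainder hn hclass hw hK hmgf hcont ha0.le
    (lt_max_of_lt_left hδ) (le_max_right δ a)
    (critical_radius_arith hn hK (le_riskConst hK) hσ hδ (le_max_left δ a)
      (hclass.nonneg δ hδ) hclass.antitone hcrit)
  obtain ⟨W, hWm, hW0, hWint, hW⟩ := exists_uniform_norm_comparison hD hn hG₀ ⟨Gs, hclass.mem⟩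
    hclass.measurable hF hbd hδ' hC1 hent
  have hint : ∀ G ∈ 𝒢, Integrable (fun z => ‖(G - G₀) z‖ ^ 2) γ := fun G hG =>
    integrable_sq_norm_sub hD (hclass.measurable G hG) hG₀ (hbd G hG)
  set Q : (Fin n → X) × E → ℝ≥0∞ := fun p =>
    8 * ENNReal.ofReal (empNorm p.1 (Gs - G₀) ^ 2) + 5 * R p + ENNReal.ofReal (20 * δ' ^ 2) +
      ENNReal.ofReal (5 / 2 * (F ^ 2 / n)) * ENNReal.ofReal (W p.1) with hQ
  have hem : Measurable fun x : Fin n → X => ENNReal.ofReal (empNorm x (Gs - G₀) ^ 2) :=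
    (((measurable_empNorm ((hclass.measurable Gs hclass.mem).sub hG₀))).pow_const 2).ennreal_ofReal
  have hQm : Measurable Q := by
    have h1 : Measurable fun p : (Fin n → X) × E =>
            ENNReal.ofReal (empNorm p.1 (Gs - G₀) ^ 2) := hem.comp measurable_fst
    have h2 : Measurable fun p : (Fin n → X) × E => ENNReal.ofReal (W p.1) :=
      (hWm.comp measurable_fst).ennreal_ofReal
    exact (((h1.const_mul _).add (hRm.const_mul _)).add_const _).add (h2.const_mul _)
  -- The two bounds hold almost surely for all maps of the class at once, so they pull back along
  -- the joint law and may be evaluated at the data-dependent minimizer.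
  have hbound : ∀ᵐ ω ∂μ, eLpNorm (Ghat ω - G₀) 2 γ ^ 2 ≤ Q (fun i => x i ω, η ω) := by
    have hR' := hR
    rw [← hlaw] at hR'
    have hW' : ∀ᵐ p ∂(P.prod ν), _ := Measure.quasiMeasurePreserving_fst.ae hW
    rw [← hlaw] at hW'
    filter_upwards [ae_of_ae_map hlaw_meas.aemeasurable hR',
      ae_of_ae_map hlaw_meas.aemeasurable hW', hERM.minimizes, heq] with ω hRω hWω hmin hε
    set xω : Fin n → X := fun i => x i ω with hxω
    have hGh := hERM.mem ω
    rw [sq_eLpNorm_two_eq_ofReal (hint _ hGh)]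
    have hrisk : ∀ G ∈ 𝒢, empiricalRisk xω (fun i f => observation G₀ σ x ε i f ω) G =
        empiricalRisk xω (fun i f => inner ℝ (G₀ (xω i)) f + σ * w i f (η ω)) G := by
      intro G hG
      unfold empiricalRisk observation
      congr 1
      refine Finset.sum_congr rfl fun i _ => ?_
      change -2 * (inner ℝ (G₀ (x i ω)) (G (x i ω)) + σ * ε i (G (x i ω)) ω) + _ = _
      rw [hε G hG i]
    have hmin' := hmin Gs hclass.mem
    rw [hrisk _ hGh, hrisk _ hclass.mem] at hmin'
    have hbasic := basic_inequality xω G₀ (Ghat ω) Gs (fun i f => w i f (η ω)) σ hmin'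
    rcases eq_or_ne (R (xω, η ω)) ⊤ with htop | htop
    · have : Q (xω, η ω) = ⊤ := by simp [hQ, htop]
      rw [this]
      exact le_top
    have hv := hRω (Ghat ω) hGh
    rw [ENNReal.ofReal_le_iff_le_toReal htop] at hv
    have hemp := sq_empNorm_le_of_basic_inequality xω hbasic
      (R := (R (xω, η ω)).toReal) (by unfold noiseProcess at hv; linarith)
    have hpop := hWω (Ghat ω) hGh
    have hR0 : 0 ≤ (R (xω, η ω)).toReal := ENNReal.toReal_nonneg
    -- Here 25/8 · 5/3 = 125/24 ≤ 8 and 25/8 · 4/3 = 25/6 ≤ 5.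
    have hfinal : ∫ z, ‖(Ghat ω - G₀) z‖ ^ 2 ∂γ ≤ 8 * empNorm xω (Gs - G₀) ^ 2 +
        5 * (R (xω, η ω)).toReal + 20 * δ' ^ 2 + 5 / 2 * (F ^ 2 / n) * W xω := by
      simp only [Pi.sub_apply]
      linarith [sq_nonneg (empNorm xω (Gs - G₀))]
    refine (ENNReal.ofReal_le_ofReal hfinal).trans (le_of_eq ?_)
    have hWx := hW0 xω
    rw [ENNReal.ofReal_add (by positivity) (by positivity),
      ENNReal.ofReal_add (by positivity) (by positivity),
      ENNReal.ofReal_add (by positivity) (by positivity),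
      ENNReal.ofReal_mul (by norm_num), ENNReal.ofReal_mul (p := 5) (by norm_num),
      ENNReal.ofReal_mul (p := 5 / 2 * (F ^ 2 / n)) (by positivity), ENNReal.ofReal_toReal htop]
    simp [hQ]
  calc ∫⁻ ω, eLpNorm (Ghat ω - G₀) 2 γ ^ 2 ∂μ ≤ ∫⁻ ω, Q (fun i => x i ω, η ω) ∂μ :=
        lintegral_mono_ae hbound
    _ = ∫⁻ p, Q p ∂(P.prod ν) := by rw [← hlaw, lintegral_map hQm hlaw_meas]
    _ = 8 * ENNReal.ofReal (∫ z, ‖(Gs - G₀) z‖ ^ 2 ∂γ) + 5 * ∫⁻ p, R p ∂(P.prod ν) +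
          ENNReal.ofReal (20 * δ' ^ 2) +
            ENNReal.ofReal (5 / 2 * (F ^ 2 / n)) * ∫⁻ x, ENNReal.ofReal (W x) ∂P := by
        have h1 : Measurable fun p : (Fin n → X) × E =>
            ENNReal.ofReal (empNorm p.1 (Gs - G₀) ^ 2) := hem.comp measurable_fst
        have h2 : Measurable fun p : (Fin n → X) × E => ENNReal.ofReal (W p.1) :=
          (hWm.comp measurable_fst).ennreal_ofReal
        have h3 : ∫⁻ p, ENNReal.ofReal (empNorm p.1 (Gs - G₀) ^ 2) ∂(P.prod ν) =
            ENNReal.ofReal (∫ z, ‖(Gs - G₀) z‖ ^ 2 ∂γ) := by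
          rw [← lintegral_sq_empNorm hn (hint Gs hclass.mem),
            lintegral_prod _ h1.aemeasurable]
          simp [hP]
        have h4 : ∫⁻ p, ENNReal.ofReal (W p.1) ∂(P.prod ν) = ∫⁻ x, ENNReal.ofReal (W x) ∂P := by
          rw [lintegral_prod _ h2.aemeasurable]
          simp
        rw [lintegral_add_right _ (h2.const_mul _), lintegral_add_right _ measurable_const,
          lintegral_add_right _ (hRm.const_mul _), lintegral_const_mul _ h1,
          lintegral_const_mul _ hRm, lintegral_const_mul _ h2, h4]
        simp only [h3, lintegral_const, measure_univ, mul_one]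
    _ ≤ 8 * eLpNorm (Gs - G₀) 2 γ ^ 2 +
          5 * ENNReal.ofReal (10 ^ 6 * (12 * (1 + K)) ^ 4 * (δ₁ ^ 2 + 2 * a ^ 2)) +
          ENNReal.ofReal (20 * δ' ^ 2) + ENNReal.ofReal (5 / 2 * (F ^ 2 / n)) * 2 := by
        rw [sq_eLpNorm_two_eq_ofReal (hint Gs hclass.mem)]
        gcongr
    _ = ENNReal.ofReal (5 * (10 ^ 6 * (12 * (1 + K)) ^ 4 * (δ₁ ^ 2 + 2 * a ^ 2)) +
          20 * δ' ^ 2 + 5 / 2 * (F ^ 2 / n) * 2) + 8 * eLpNorm (Gs - G₀) 2 γ ^ 2 := by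
        rw [ENNReal.ofReal_add (by positivity) (by positivity),
          ENNReal.ofReal_add (by positivity) (by positivity),
          ENNReal.ofReal_mul (p := 5) (by norm_num),
          ENNReal.ofReal_mul (p := 5 / 2 * (F ^ 2 / n)) (by positivity)]
        simp only [ENNReal.ofReal_ofNat]
        ring
    _ ≤ _ := by
        gcongr ENNReal.ofReal ?_ + _
        have hM : 1 ≤ (12 * (1 + K)) ^ 4 := one_le_pow₀ (by linarith)
        rw [riskConst]
        set M := (12 * (1 + K)) ^ 4
        -- From δ₁² ≤ δ² + a² and a² = 4σ²/n. The largest resulting coefficient, 5 · 10^6 · 12,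
        -- stays below the 10^8 of `riskConst`.
        have e1 : δ₁ ^ 2 + 2 * a ^ 2 ≤ δ ^ 2 + 12 * (σ ^ 2 / n) := by linarith
        have e2 : 0 ≤ σ ^ 2 / n := by positivity
        have e3 : 0 ≤ F ^ 2 / n := by positivity
        have e4 : 0 ≤ δ' ^ 2 := by positivity
        have e5 : M * (δ₁ ^ 2 + 2 * a ^ 2) ≤ M * (δ ^ 2 + 12 * (σ ^ 2 / n)) := by gcongr
        have e6 : δ' ^ 2 ≤ M * δ' ^ 2 := le_mul_of_one_le_left e4 hM
        have e7 : F ^ 2 / n ≤ M * (F ^ 2 / n) := le_mul_of_one_le_left e3 hM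
        have e8 : 0 ≤ M * δ ^ 2 := by positivity
        have e9 : 0 ≤ M * (σ ^ 2 / n) := by positivity
        have e10 : (σ ^ 2 + F ^ 2) / n = σ ^ 2 / n + F ^ 2 / n := add_div _ _ _
        rw [e10]
        linarith

/-! ### Sub-Gaussian noise vectors -/

/-- For centred variables the linear term integrates to zero, leaving a moment generating function
that is quadratic near 0. -/
theorem exp_le_one_add_add_sq_mul_exp_sq (x : ℝ) :
    Real.exp x ≤ 1 + x + x ^ 2 * Real.exp (x ^ 2) := by
  have h1 : 1 ≤ Real.exp (x ^ 2) := Real.one_le_exp (sq_nonneg x)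
  rcases le_total |x| 1 with h | h
  · have h2 := (abs_le.1 (Real.abs_exp_sub_one_sub_id_le h)).2
    nlinarith [sq_nonneg x]
  · have hx2 : |x| ≤ x ^ 2 := by rw [← sq_abs]; nlinarith
    have hx1 : 1 ≤ x ^ 2 := h.trans hx2
    rcases le_total 0 x with h0 | h0
    · rw [abs_of_nonneg h0] at h hx2
      have h3 : Real.exp x ≤ Real.exp (x ^ 2) := Real.exp_le_exp.2 hx2
      nlinarith
    · rw [abs_of_nonpos h0] at hx2
      have h3 : Real.exp x ≤ 1 := Real.exp_le_one_iff.2 h0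
      nlinarith

/-- Layer cake: the tail 2e^(-t/2) of ‖e‖² against the density e^(t/4)/4 integrates to 2, and the
value at 0 contributes 1. -/
theorem lintegral_exp_sq_norm_le {Ω Y : Type*} [MeasurableSpace Ω] {μ : Measure Ω}
    [IsProbabilityMeasure μ] [NormedAddCommGroup Y] [InnerProductSpace ℝ Y] [MeasurableSpace Y]
    [BorelSpace Y] {e : Ω → Y} (he : IsSubGaussian e 1 μ) :
    ∫⁻ ω, ENNReal.ofReal (Real.exp (‖e ω‖ ^ 2 / 4)) ∂μ ≤ 3 := by
  have hm : Measurable fun ω => ‖e ω‖ ^ 2 := by have := he.measurable; fun_prop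
  have hprim : ∀ f : ℝ, ∫ t in (0 : ℝ)..f, Real.exp (t / 4) / 4 = Real.exp (f / 4) - 1 := by
    intro f
    rw [intervalIntegral.integral_eq_sub_of_hasDerivAt (f := fun t => Real.exp (t / 4))]
    · simp
    · intro t _
      simpa [div_eq_mul_inv] using ((hasDerivAt_id t).div_const 4).exp
    · exact Continuous.intervalIntegrable (by fun_prop) _ _
  have hlc := lintegral_comp_eq_lintegral_meas_le_mul μ (f := fun ω => ‖e ω‖ ^ 2)
    (g := fun t => Real.exp (t / 4) / 4) (Eventually.of_forall fun ω => by positivity)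
    hm.aemeasurable (fun t _ => Continuous.intervalIntegrable (by fun_prop) _ _)
    (Eventually.of_forall fun t => by positivity)
  simp only [hprim] at hlc
  have htail : ∫⁻ t in Set.Ioi (0 : ℝ), μ {a | t ≤ ‖e a‖ ^ 2} *
      ENNReal.ofReal (Real.exp (t / 4) / 4) ≤ 2 := by
    calc _ ≤ ∫⁻ t in Set.Ioi (0 : ℝ), ENNReal.ofReal (2⁻¹ * Real.exp (-(1 / 4) * t)) := by
          refine setLIntegral_mono' measurableSet_Ioi fun t ht => ?_
          have ht0 : (0 : ℝ) ≤ t := (Set.mem_Ioi.1 ht).le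
          have hset : {a | t ≤ ‖e a‖ ^ 2} = {a | √t ≤ ‖e a‖} := by
            ext a
            exact (Real.sqrt_le_left (norm_nonneg _)).symm
          rw [hset]
          refine (mul_le_mul_left (he.tail √t (Real.sqrt_nonneg t)) _).trans (le_of_eq ?_)
          rw [← ENNReal.ofReal_mul (by positivity), Real.sq_sqrt ht0]
          congr 1
          rw [mul_div_assoc', mul_assoc, ← Real.exp_add]
          ring_nf
      _ = ENNReal.ofReal (∫ t in Set.Ioi (0 : ℝ), 2⁻¹ * Real.exp (-(1 / 4) * t)) := by
          rw [ofReal_integral_eq_lintegral_ofReal]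
          · exact ((exp_neg_integrableOn_Ioi 0 (by norm_num)).const_mul _)
          · exact Eventually.of_forall fun t => by positivity
      _ = 2 := by
          rw [integral_const_mul, integral_exp_mul_Ioi (by norm_num)]
          norm_num
  calc ∫⁻ ω, ENNReal.ofReal (Real.exp (‖e ω‖ ^ 2 / 4)) ∂μ
      = ∫⁻ ω, (1 + ENNReal.ofReal (Real.exp (‖e ω‖ ^ 2 / 4) - 1)) ∂μ := by
        refine lintegral_congr fun ω => ?_
        rw [← ENNReal.ofReal_one, ← ENNReal.ofReal_add zero_le_one
          (sub_nonneg.2 (Real.one_le_exp (by positivity)))]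
        ring_nf
    _ ≤ 1 + 2 := by
        rw [lintegral_add_left measurable_const, hlc]
        simp only [lintegral_const, measure_univ, mul_one]
        gcongr
    _ = 3 := by norm_num

/-- Put s = a²‖u‖²; the claim is the bound e^(24s). For s ≤ 1/8, centring and the square-exponential
moment 3 give 1 + 8s · 3. For s ≥ 1/8, Young's inequality gives 3e^s, and 3 ≤ 1 + 16s ≤ e^(16s). -/
theorem hasSubgaussianMGF_inner {Ω Y : Type*} [MeasurableSpace Ω] {μ : Measure Ω}
    [IsProbabilityMeasure μ] [NormedAddCommGroup Y] [InnerProductSpace ℝ Y] [CompleteSpace Y]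
    [SecondCountableTopology Y] [MeasurableSpace Y] [BorelSpace Y] {e : Ω → Y}
    (he : IsSubGaussian e 1 μ) (u : Y) :
    HasSubgaussianMGF (fun ω => inner ℝ (e ω) u) (48 * ‖u‖₊ ^ 2) μ := by
  have hem := he.measurable
  have hlint := lintegral_exp_sq_norm_le he
  have hint : Integrable (fun ω => Real.exp (‖e ω‖ ^ 2 / 4)) μ := by
    refine ⟨by fun_prop, ?_⟩
    rw [hasFiniteIntegral_iff_ofReal (Eventually.of_forall fun ω => (Real.exp_pos _).le)]
    exact hlint.trans_lt (by simp)
  have hI : ∫ ω, Real.exp (‖e ω‖ ^ 2 / 4) ∂μ ≤ 3 := by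
    rw [integral_eq_lintegral_of_nonneg_ae (Eventually.of_forall fun ω => (Real.exp_pos _).le)
      hint.1]
    exact ENNReal.toReal_le_of_le_ofReal (by norm_num) (by simpa using hlint)
  have heint : Integrable e μ := by
    refine hint.mono' hem.aestronglyMeasurable (Eventually.of_forall fun ω => ?_)
    nlinarith [Real.add_one_le_exp (‖e ω‖ ^ 2 / 4), sq_nonneg (‖e ω‖ / 2 - 1)]
  have hmean : ∫ ω, inner ℝ (e ω) u ∂μ = 0 := by
    simp_rw [real_inner_comm u]
    rw [integral_inner heint, he.mean, inner_zero_right]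
  have hTint : Integrable (fun ω => inner ℝ (e ω) u) μ := heint.inner_const u
  have hCS : ∀ ω (a : ℝ), (a * inner ℝ (e ω) u) ^ 2 ≤ (a ^ 2 * ‖u‖ ^ 2) * ‖e ω‖ ^ 2 := by
    intro ω a
    have h1 : (inner ℝ (e ω) u : ℝ) ^ 2 ≤ (‖e ω‖ * ‖u‖) ^ 2 :=
      sq_le_sq' (neg_le_of_abs_le (abs_real_inner_le_norm _ _)) (real_inner_le_norm _ _)
    nlinarith [mul_le_mul_of_nonneg_left h1 (sq_nonneg a)]
  have hdom : ∀ ω (a : ℝ), Real.exp (a * inner ℝ (e ω) u) ≤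
      Real.exp (a ^ 2 * ‖u‖ ^ 2) * Real.exp (‖e ω‖ ^ 2 / 4) := by
    intro ω a
    rw [← Real.exp_add, Real.exp_le_exp]
    have h1 : |a * inner ℝ (e ω) u| ≤ |a| * ‖u‖ * ‖e ω‖ := by
      rw [abs_mul, mul_assoc, mul_comm ‖u‖]
      gcongr
      exact abs_real_inner_le_norm _ _
    have h2 := le_abs_self (a * inner ℝ (e ω) u)
    have h3 : (|a| * ‖u‖) ^ 2 = a ^ 2 * ‖u‖ ^ 2 := by rw [mul_pow, sq_abs]
    nlinarith [sq_nonneg (‖e ω‖ / 2 - |a| * ‖u‖)]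
  have hexpint : ∀ a : ℝ, Integrable (fun ω => Real.exp (a * inner ℝ (e ω) u)) μ := by
    intro a
    refine (hint.const_mul (Real.exp (a ^ 2 * ‖u‖ ^ 2))).mono' (by fun_prop)
      (Eventually.of_forall fun ω => ?_)
    rw [Real.norm_of_nonneg (Real.exp_pos _).le]
    exact hdom ω a
  refine ⟨hexpint, fun a => ?_⟩
  set s := a ^ 2 * ‖u‖ ^ 2 with hs
  have hs0 : 0 ≤ s := by positivity
  have hgoal : ((48 * ‖u‖₊ ^ 2 : NNReal) : ℝ) * a ^ 2 / 2 = 24 * s := by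
    push_cast
    rw [hs]; ring
  rw [hgoal, mgf]
  have hint1 : Integrable (fun ω => 1 + a * inner ℝ (e ω) u) μ :=
    (integrable_const _).add (hTint.const_mul a)
  rcases le_total s (1 / 8) with h | h
  · calc ∫ ω, Real.exp (a * inner ℝ (e ω) u) ∂μ
        ≤ ∫ ω, (1 + a * inner ℝ (e ω) u + 8 * s * Real.exp (‖e ω‖ ^ 2 / 4)) ∂μ := by
          refine integral_mono (hexpint a) (hint1.add (hint.const_mul _)) fun ω => ?_
          refine (exp_le_one_add_add_sq_mul_exp_sq _).trans ?_
          have h1 := hCS ω a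
          have h2 : Real.exp ((a * inner ℝ (e ω) u) ^ 2) ≤ Real.exp (‖e ω‖ ^ 2 / 8) := by
            apply Real.exp_le_exp.2
            nlinarith [sq_nonneg ‖e ω‖]
          have h3 : ‖e ω‖ ^ 2 ≤ 8 * Real.exp (‖e ω‖ ^ 2 / 8) := by
            linarith [Real.add_one_le_exp (‖e ω‖ ^ 2 / 8)]
          have h4 : Real.exp (‖e ω‖ ^ 2 / 4) =
              Real.exp (‖e ω‖ ^ 2 / 8) * Real.exp (‖e ω‖ ^ 2 / 8) := by
            rw [← Real.exp_add]; ring_nf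
          have h5 : (a * inner ℝ (e ω) u) ^ 2 * Real.exp ((a * inner ℝ (e ω) u) ^ 2) ≤
              (s * (8 * Real.exp (‖e ω‖ ^ 2 / 8))) * Real.exp (‖e ω‖ ^ 2 / 8) := by
            gcongr
            exact h1.trans (mul_le_mul_of_nonneg_left h3 hs0)
          rw [h4]
          linarith
      _ = 1 + 8 * s * ∫ ω, Real.exp (‖e ω‖ ^ 2 / 4) ∂μ := by
          rw [integral_add hint1 (hint.const_mul _),
            integral_add (integrable_const _) (hTint.const_mul a), integral_const_mul,
            integral_const_mul, hmean]
          simp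
      _ ≤ 24 * s + 1 := by nlinarith
      _ ≤ _ := Real.add_one_le_exp _
  · calc ∫ ω, Real.exp (a * inner ℝ (e ω) u) ∂μ
        ≤ ∫ ω, Real.exp s * Real.exp (‖e ω‖ ^ 2 / 4) ∂μ :=
          integral_mono (hexpint a) (hint.const_mul _) fun ω => hdom ω a
      _ ≤ Real.exp s * 3 := by rw [integral_const_mul]; gcongr
      _ ≤ Real.exp s * Real.exp (16 * s) := by
          gcongr
          linarith [Real.add_one_le_exp (16 * s)]
      _ ≤ _ := by
          rw [← Real.exp_add]
          exact Real.exp_le_exp.2 (by linarith)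

/-! ### The risk bound for sub-Gaussian noise -/

theorem map_design_noise {X Ω E : Type*} [MeasurableSpace X] [MeasurableSpace Ω]
    [MeasurableSpace E] {μ : Measure Ω} [IsProbabilityMeasure μ] {γ : Measure X} {n : ℕ}
    {x : Fin n → Ω → X} (hx : ∀ i, Measurable (x i)) (hlaw : ∀ i, μ.map (x i) = γ)
    (hindep : iIndepFun x μ) {η : Ω → E} (hη : Measurable η)
    (h : IndepFun (fun ω i => x i ω) η μ) :
    μ.map (fun ω => (fun i => x i ω, η ω)) =
      (Measure.pi fun _ : Fin n => γ).prod (μ.map η) := by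
  have hxm : Measurable fun ω i => x i ω := measurable_pi_lambda _ hx
  rw [(indepFun_iff_map_prod_eq_prod_map_map hxm.aemeasurable hη.aemeasurable).1 h,
    (iIndepFun_iff_map_fun_eq_pi_map fun i => (hx i).aemeasurable).1 hindep]
  simp_rw [hlaw]

/-- A sub-Gaussian moment bound in terms of the lower integral. -/
theorem lintegral_exp_le_of_hasSubgaussianMGF {Ω : Type*} [MeasurableSpace Ω] {μ : Measure Ω}
    {T : Ω → ℝ} {c : NNReal} (h : HasSubgaussianMGF T c μ) (a : ℝ) :
    ∫⁻ ω, ENNReal.ofReal (Real.exp (a * T ω)) ∂μ ≤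
      ENNReal.ofReal (Real.exp (c * a ^ 2 / 2)) := by
  rw [← ofReal_integral_eq_lintegral_ofReal (h.integrable_exp_mul a)
    (Eventually.of_forall fun ω => (Real.exp_pos _).le)]
  exact ENNReal.ofReal_le_ofReal (h.mgf_le a)

theorem tendsto_apply_of_tendsto_empNorm {X Y : Type*} [NormedAddCommGroup Y] {n : ℕ}
    {x : Fin n → X} {u : ℕ → X → Y} {G : X → Y}
    (h : Tendsto (fun k => empNorm x (u k - G)) atTop (𝓝 0)) (i : Fin n) :
    Tendsto (fun k => u k (x i)) atTop (𝓝 (G (x i))) := by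
  rw [tendsto_iff_norm_sub_tendsto_zero]
  refine squeeze_zero (fun k => norm_nonneg _)
    (fun k => norm_le_sqrt_mul_empNorm x (u k - G) i) ?_
  simpa using h.const_mul √(n : ℝ)

/-- The auxiliary variable is the noise vector itself; the inner product is continuous for every
realization. The parameter 48 of each coordinate gives K = 24. -/
theorem lintegral_risk_le_of_subGaussianNoise {X Y Ω : Type*}
    [TopologicalSpace X] [HereditarilyLindelofSpace X] [MeasurableSpace X]
    [NormedAddCommGroup Y] [InnerProductSpace ℝ Y] [CompleteSpace Y] [SecondCountableTopology Y]
    [MeasurableSpace Y] [BorelSpace Y] [MeasurableSpace Ω] {μ : Measure Ω}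
    [IsProbabilityMeasure μ]
    {γ : Measure X} [IsProbabilityMeasure γ] {n : ℕ} (hn : 1 ≤ n) {σ : ℝ} (hσ : 0 < σ)
    {G₀ Gs : X → Y} (hG₀ : Measurable G₀) {𝒢 : Set (X → Y)} {Ψ : ℝ → ℝ}
    (hclass : ClassAssumption n γ G₀ 𝒢 Gs Ψ) {F : ℝ} (hF : 0 < F)
    (hbd : ∀ G ∈ 𝒢, ∀ z ∈ γ.support, ‖G z - G₀ z‖ ≤ F)
    {x : Fin n → Ω → X} {ε : Fin n → Y → Ω → ℝ} {Ghat : Ω → X → Y}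
    (hx : ∀ i, Measurable (x i)) (hlaw : ∀ i, μ.map (x i) = γ) (hindep : iIndepFun x μ)
    (hnoise : SubGaussianNoiseModel x ε μ) (hERM : IsERM γ G₀ 𝒢 σ x ε μ Ghat)
    {δ δ' : ℝ} (hδ : 0 < δ) (hδ' : 0 < δ')
    (hcrit : riskConst 24 * σ * Ψ δ ≤ √(n : ℝ) * δ ^ 2)
    (hent : ENNReal.ofReal (riskConst 24 * F ^ 2) * entropy (supDist γ.support) 𝒢 δ' ≤
      ENNReal.ofReal (n * δ' ^ 2)) :
    ∫⁻ ω, eLpNorm (Ghat ω - G₀) 2 γ ^ 2 ∂μ ≤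
      ENNReal.ofReal (riskConst 24 * (δ ^ 2 + δ' ^ 2 + (σ ^ 2 + F ^ 2) / n)) +
        8 * eLpNorm (Gs - G₀) 2 γ ^ 2 := by
  obtain ⟨e, he, heind, hex, heε⟩ := hnoise.exists_vector
  have hem : Measurable fun ω i => e i ω := measurable_pi_lambda _ fun i => (he i).measurable
  have hxm : Measurable fun ω i => x i ω := measurable_pi_lambda _ hx
  have hν : IsProbabilityMeasure (μ.map fun ω i => e i ω) :=
    Measure.isProbabilityMeasure_map hem.aemeasurable
  have hw : ∀ i : Fin n, Measurable fun p : Y × (Fin n → Y) => (inner ℝ (p.2 i) p.1 : ℝ) :=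
    fun i => by fun_prop
  refine lintegral_risk_le_of_noise_representation hn hσ hG₀ hclass hF hbd hERM
    (hxm.prodMk hem) (map_design_noise hx hlaw hindep hem hex)
    (w := fun i y z => inner ℝ (z i) y) hw (by norm_num) ?_ ?_ ?_ hδ hδ' hcrit hent
  · intro u v a
    rw [lintegral_map (by fun_prop) hem]
    have h1 := HasSubgaussianMGF.sum_of_iIndepFun (s := Finset.univ)
      (X := fun i ω => (inner ℝ (e i ω) (u i - v i) : ℝ))
      (heind.comp (fun i y => (inner ℝ y (u i - v i) : ℝ)) fun i => by fun_prop)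
      fun i _ => hasSubgaussianMGF_inner (he i) (u i - v i)
    refine le_trans (le_of_eq ?_) ((lintegral_exp_le_of_hasSubgaussianMGF h1 a).trans
      (le_of_eq ?_))
    · simp only [inner_sub_right]
    · congr 2
      push_cast
      rw [← Finset.mul_sum]
      ring
  · refine Eventually.of_forall fun p G _ u _ hlim i => ?_
    exact tendsto_const_nhds.inner (tendsto_apply_of_tendsto_empNorm hlim i)
  · exact Eventually.of_forall fun ω G _ i => heε i _ ω

/-! ### Random series with independent sub-Gaussian terms -/

/-- The partial sums of the random series `∑ a j * Z j`. -/
def partialSum {Ω : Type*} (Z : ℕ → Ω → ℝ) (a : ℕ → ℝ) (N : ℕ) (ω : Ω) : ℝ :=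
  ∑ j ∈ Finset.range N, a j * Z j ω

/-- `Z` is a sequence of independent centred sub-Gaussian variables with parameter `1`. -/
structure IsSubGaussianSequence {Ω : Type*} [MeasurableSpace Ω] (Z : ℕ → Ω → ℝ) (μ : Measure Ω) :
    Prop where
  measurable : ∀ j, Measurable (Z j)
  indep : iIndepFun Z μ
  subgaussian : ∀ j, HasSubgaussianMGF (Z j) 1 μ
  mean : ∀ j, ∫ ω, Z j ω ∂μ = 0

namespace IsSubGaussianSequence

variable {Ω : Type*} [MeasurableSpace Ω] {μ : Measure Ω} {Z : ℕ → Ω → ℝ}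

theorem hasSubgaussianMGF_partialSum (h : IsSubGaussianSequence Z μ) (a : ℕ → ℝ) (N : ℕ) :
    HasSubgaussianMGF (partialSum Z a N)
      (∑ j ∈ Finset.range N, Real.toNNReal (a j ^ 2)) μ :=
  HasSubgaussianMGF.sum_of_iIndepFun
    (h.indep.comp (fun j z => a j * z) fun j => measurable_const_mul (a j))
    fun j _ => by
      have h1 := (h.subgaussian j).const_mul (a j)
      convert h1 using 1
      · rfl
      · exact (Real.toNNReal_of_nonneg (sq_nonneg (a j))).trans (mul_one (M := NNReal) _).symm

theorem mgf_partialSum_le (h : IsSubGaussianSequence Z μ) {a : ℕ → ℝ} {N : ℕ} {v : ℝ}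
    (hv : ∑ j ∈ Finset.range N, a j ^ 2 ≤ v) (t : ℝ) :
    ∫ ω, Real.exp (t * partialSum Z a N ω) ∂μ ≤ Real.exp (v * t ^ 2 / 2) := by
  refine ((h.hasSubgaussianMGF_partialSum a N).mgf_le t).trans (Real.exp_le_exp.2 ?_)
  have h1 : ((∑ j ∈ Finset.range N, Real.toNNReal (a j ^ 2) : NNReal) : ℝ) =
      ∑ j ∈ Finset.range N, a j ^ 2 := by
    rw [NNReal.coe_sum]
    exact Finset.sum_congr rfl fun j _ => Real.coe_toNNReal _ (sq_nonneg _)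
  rw [h1]
  gcongr

theorem one_le_integral_exp (h : IsSubGaussianSequence Z μ) (j : ℕ) (t : ℝ) :
    1 ≤ ∫ ω, Real.exp (t * Z j ω) ∂μ := by
  have := h.indep.isProbabilityMeasure
  have hi := (h.subgaussian j).integrable
  calc (1 : ℝ) = ∫ ω, (1 + t * Z j ω) ∂μ := by
        rw [integral_add (integrable_const _) (hi.const_mul t), integral_const_mul, h.mean j]
        simp
    _ ≤ _ := by
        refine integral_mono ((integrable_const _).add (hi.const_mul t))
          ((h.subgaussian j).integrable_exp_mul t) fun ω => ?_
        simp only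
        linarith [Real.add_one_le_exp (t * Z j ω)]

/-- Each new factor is independent of the past and has mean at least 1, by centring and e^x ≥ 1 + x.
The shift to N + 1 terms matches the natural filtration, which at time N already contains Z N. -/
theorem submartingale_exp (h : IsSubGaussianSequence Z μ) (a : ℕ → ℝ) (t : ℝ) :
    Submartingale (fun N ω => Real.exp (t * partialSum Z a (N + 1) ω))
      (Filtration.natural Z fun j => (h.measurable j).stronglyMeasurable) μ := by
  have := h.indep.isProbabilityMeasure
  set 𝓕 := Filtration.natural Z fun j => (h.measurable j).stronglyMeasurable with h𝓕
  have hadZ : ∀ i j, j ≤ i → Measurable[𝓕 i] (Z j) := fun i j hij =>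
    ((Filtration.stronglyAdapted_natural fun j => (h.measurable j).stronglyMeasurable)
      j |>.measurable).mono (𝓕.mono hij) le_rfl
  have had : ∀ N, Measurable[𝓕 N] fun ω => Real.exp (t * partialSum Z a (N + 1) ω) := by
    intro N
    refine Real.measurable_exp.comp (Measurable.const_mul ?_ t)
    unfold partialSum
    exact Finset.measurable_fun_sum _ fun j hj =>
      (hadZ N j (Nat.lt_succ_iff.1 (Finset.mem_range.1 hj))).const_mul _
  have hint : ∀ N, Integrable (fun ω => Real.exp (t * partialSum Z a (N + 1) ω)) μ := fun N =>
    (h.hasSubgaussianMGF_partialSum a (N + 1)).integrable_exp_mul t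
  refine submartingale_nat (fun N => (had N).stronglyMeasurable) hint fun N => ?_
  set ξ : Ω → ℝ := fun ω => Real.exp (t * a (N + 1) * Z (N + 1) ω) with hξ
  have hξint : Integrable ξ μ := (h.subgaussian (N + 1)).integrable_exp_mul _
  have hprod : (fun ω => Real.exp (t * partialSum Z a (N + 1 + 1) ω)) =
      (fun ω => Real.exp (t * partialSum Z a (N + 1) ω)) * ξ := by
    funext ω
    simp only [Pi.mul_apply, hξ, partialSum]
    rw [Finset.sum_range_succ _ (N + 1), ← Real.exp_add]
    ring_nf
  have hcond : μ[ξ | 𝓕 N] =ᵐ[μ] fun _ => ∫ ω, ξ ω ∂μ := by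
    refine condExp_indep_eq (m₁ := MeasurableSpace.comap (Z (N + 1)) inferInstance)
      (h.measurable _).comap_le (𝓕.le N) ?_
      (h.indep.indep_comap_natural_of_lt (fun j => (h.measurable j).stronglyMeasurable)
        (Nat.lt_succ_self N))
    refine Measurable.stronglyMeasurable ?_
    exact Real.measurable_exp.comp ((comap_measurable (Z (N + 1))).const_mul _)
  have hpull : μ[fun ω => Real.exp (t * partialSum Z a (N + 1 + 1) ω) | 𝓕 N] =ᵐ[μ]
      (fun ω => Real.exp (t * partialSum Z a (N + 1) ω)) * μ[ξ | 𝓕 N] := by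
    have hi := hint (N + 1)
    rw [hprod] at hi ⊢
    exact condExp_mul_of_stronglyMeasurable_left (had N).stronglyMeasurable hi hξint
  filter_upwards [hcond, hpull] with ω h1 h2
  rw [h2, Pi.mul_apply, h1]
  exact le_mul_of_one_le_right (Real.exp_pos _).le (h.one_le_integral_exp (N + 1) _)

/-- Doob's maximal inequality for exp(t · partial sum), with t = u/v minimizing -tu + vt²/2. The
empty sum is 0 < u and never contributes. -/
theorem measure_exists_le_partialSum_le (h : IsSubGaussianSequence Z μ) {a : ℕ → ℝ} {v u : ℝ}
    (hv0 : 0 < v) (hv : ∀ N, ∑ j ∈ Finset.range N, a j ^ 2 ≤ v) (hu : 0 < u) :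
    μ {ω | ∃ N, u ≤ partialSum Z a N ω} ≤ ENNReal.ofReal (Real.exp (-(u ^ 2 / (2 * v)))) := by
  have := h.indep.isProbabilityMeasure
  have hsub := h.submartingale_exp a (u / v)
  set t := u / v with ht
  have ht0 : 0 < t := by positivity
  have hN : ∀ N, μ {ω | ∃ k ≤ N, u ≤ partialSum Z a (k + 1) ω} ≤
      ENNReal.ofReal (Real.exp (-(u ^ 2 / (2 * v)))) := by
    intro N
    have hmax := maximal_ineq hsub (fun _ _ => (Real.exp_pos _).le)
      (ε := Real.toNNReal (Real.exp (t * u))) N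
    simp only [Real.coe_toNNReal _ (Real.exp_pos _).le] at hmax
    have hsubset : {ω | ∃ k ≤ N, u ≤ partialSum Z a (k + 1) ω} ⊆
        {ω | Real.exp (t * u) ≤ (Finset.range (N + 1)).sup' Finset.nonempty_range_add_one
          fun k => Real.exp (t * partialSum Z a (k + 1) ω)} := by
      rintro ω ⟨k, hk, hku⟩
      refine le_trans ?_ (Finset.le_sup' (fun k => Real.exp (t * partialSum Z a (k + 1) ω))
        (Finset.mem_range.2 (Nat.lt_succ_of_le hk)))
      exact Real.exp_le_exp.2 (mul_le_mul_of_nonneg_left hku ht0.le)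
    have hrhs : ENNReal.ofReal (∫ ω in {ω | Real.exp (t * u) ≤
        (Finset.range (N + 1)).sup' Finset.nonempty_range_add_one
          fun k => Real.exp (t * partialSum Z a (k + 1) ω)},
            Real.exp (t * partialSum Z a (N + 1) ω) ∂μ) ≤
        ENNReal.ofReal (Real.exp (v * t ^ 2 / 2)) := by
      refine ENNReal.ofReal_le_ofReal ((setIntegral_le_integral (hsub.integrable N)
        (Eventually.of_forall fun _ => (Real.exp_pos _).le)).trans (h.mgf_partialSum_le (hv _) t))
    have h1 : ENNReal.ofReal (Real.exp (t * u)) *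
        μ {ω | ∃ k ≤ N, u ≤ partialSum Z a (k + 1) ω} ≤
          ENNReal.ofReal (Real.exp (v * t ^ 2 / 2)) := by
      refine le_trans ?_ (hmax.trans hrhs)
      exact mul_le_mul_right (measure_mono hsubset) _
    calc μ {ω | ∃ k ≤ N, u ≤ partialSum Z a (k + 1) ω}
        = ENNReal.ofReal (Real.exp (-(t * u))) * (ENNReal.ofReal (Real.exp (t * u)) *
            μ {ω | ∃ k ≤ N, u ≤ partialSum Z a (k + 1) ω}) := by
          rw [← mul_assoc, ← ENNReal.ofReal_mul (Real.exp_pos _).le, ← Real.exp_add]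
          simp
      _ ≤ ENNReal.ofReal (Real.exp (-(t * u))) * ENNReal.ofReal (Real.exp (v * t ^ 2 / 2)) := by
          gcongr
      _ = _ := by
          rw [← ENNReal.ofReal_mul (Real.exp_pos _).le, ← Real.exp_add, ht]
          congr 2
          field_simp
          ring
  have hunion : {ω | ∃ N, u ≤ partialSum Z a N ω} ⊆
      ⋃ N, {ω | ∃ k ≤ N, u ≤ partialSum Z a (k + 1) ω} := by
    rintro ω ⟨N, hN⟩
    rcases N with _ | N
    · simp only [partialSum, Finset.range_zero, Finset.sum_empty] at hN
      exact absurd hN (not_le.2 hu)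
    · exact Set.mem_iUnion.2 ⟨N, N, le_rfl, hN⟩
  refine (measure_mono hunion).trans ?_
  have hmono : Monotone fun N => {ω | ∃ k ≤ N, u ≤ partialSum Z a (k + 1) ω} := by
    rintro M N hMN ω ⟨k, hk, hku⟩
    exact ⟨k, hk.trans hMN, hku⟩
  rw [hmono.measure_iUnion]
  exact iSup_le hN

/-- A maximal inequality for the partial sums. -/
theorem measure_exists_le_abs_partialSum_le (h : IsSubGaussianSequence Z μ) {a : ℕ → ℝ}
    {v u : ℝ} (hv0 : 0 < v) (hv : ∀ N, ∑ j ∈ Finset.range N, a j ^ 2 ≤ v) (hu : 0 < u) :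
    μ {ω | ∃ N, u ≤ |partialSum Z a N ω|} ≤
      ENNReal.ofReal (2 * Real.exp (-(u ^ 2 / (2 * v)))) := by
  have h1 := h.measure_exists_le_partialSum_le hv0 hv hu
  have h2 := h.measure_exists_le_partialSum_le (a := fun j => -a j) hv0
    (fun N => by simpa using hv N) hu
  have hsub : {ω | ∃ N, u ≤ |partialSum Z a N ω|} ⊆ {ω | ∃ N, u ≤ partialSum Z a N ω} ∪
      {ω | ∃ N, u ≤ partialSum Z (fun j => -a j) N ω} := by
    rintro ω ⟨N, hN⟩
    rcases le_abs.1 hN with h | h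
    · exact Or.inl ⟨N, h⟩
    · refine Or.inr ⟨N, ?_⟩
      simpa [partialSum, neg_mul, Finset.sum_neg_distrib] using h
  calc _ ≤ _ := measure_mono hsub
    _ ≤ _ := measure_union_le _ _
    _ ≤ _ := add_le_add h1 h2
    _ = _ := by rw [← ENNReal.ofReal_add (by positivity) (by positivity)]; congr 1; ring

/-- Series with square summable coefficients converge almost surely. -/
theorem ae_cauchySeq_partialSum (h : IsSubGaussianSequence Z μ) {a : ℕ → ℝ}
    (ha : Summable fun j => a j ^ 2) :
    ∀ᵐ ω ∂μ, CauchySeq fun N => partialSum Z a N ω := by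
  set tail : ℕ → ℕ → ℝ := fun m j => if j < m then 0 else a j with htail
  -- The variance of the tail after m; the vanishing summand 1/(m+1) keeps it positive, as the
  -- maximal inequality requires.
  set v : ℕ → ℝ := fun m => (∑' j, a j ^ 2 - ∑ j ∈ Finset.range m, a j ^ 2) + 1 / ((m : ℝ) + 1)
    with hv
  have hdiff : ∀ m N ω, m ≤ N →
      partialSum Z (tail m) N ω = partialSum Z a N ω - partialSum Z a m ω := by
    intro m N ω hmN
    have h0 : ∑ j ∈ Finset.range m, tail m j * Z j ω = 0 :=
      Finset.sum_eq_zero fun j hj => by simp [htail, Finset.mem_range.1 hj]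
    have h1 : ∑ j ∈ Finset.Ico m N, tail m j * Z j ω = ∑ j ∈ Finset.Ico m N, a j * Z j ω :=
      Finset.sum_congr rfl fun j hj => by
        simp [htail, not_lt.2 (Finset.mem_Ico.1 hj).1]
    unfold partialSum
    rw [← Finset.sum_range_add_sum_Ico _ hmN, h0, zero_add, h1,
      ← Finset.sum_Ico_eq_sub _ hmN]
  have hpart : ∀ m, ∑ j ∈ Finset.range m, a j ^ 2 ≤ ∑' j, a j ^ 2 := fun m =>
    ha.sum_le_tsum _ fun j _ => sq_nonneg _
  have hv0 : ∀ m, 0 < v m := fun m => by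
    have := hpart m
    have h1 : (0 : ℝ) < 1 / ((m : ℝ) + 1) := by positivity
    simp only [hv]
    linarith
  have hvtail : ∀ m N, ∑ j ∈ Finset.range N, tail m j ^ 2 ≤ v m := by
    intro m N
    have h1 : ∑ j ∈ Finset.range N, tail m j ^ 2 ≤
        ∑ j ∈ Finset.range (max m N), tail m j ^ 2 :=
      Finset.sum_le_sum_of_subset_of_nonneg
        (Finset.range_mono (le_max_right _ _)) fun _ _ _ => sq_nonneg _
    have h0 : ∑ j ∈ Finset.range m, tail m j ^ 2 = 0 :=
      Finset.sum_eq_zero fun j hj => by simp [htail, Finset.mem_range.1 hj]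
    have h2 : ∑ j ∈ Finset.Ico m (max m N), tail m j ^ 2 =
        ∑ j ∈ Finset.Ico m (max m N), a j ^ 2 :=
      Finset.sum_congr rfl fun j hj => by
        simp [htail, not_lt.2 (Finset.mem_Ico.1 hj).1]
    rw [← Finset.sum_range_add_sum_Ico _ (le_max_left m N), h0, zero_add, h2,
      Finset.sum_Ico_eq_sub _ (le_max_left m N)] at h1
    have h3 := hpart (max m N)
    have h4 : (0 : ℝ) < 1 / ((m : ℝ) + 1) := by positivity
    simp only [hv]
    linarith
  have hvlim : Tendsto v atTop (𝓝 0) := by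
    have h1 := (tendsto_const_nhds (x := ∑' j, a j ^ 2)).sub ha.hasSum.tendsto_sum_nat
    simpa [hv] using h1.add tendsto_one_div_add_atTop_nhds_zero_nat
  have hae : ∀ k : ℕ, ∀ᵐ ω ∂μ, ∃ m, ∀ N, |partialSum Z (tail m) N ω| < 1 / ((k : ℝ) + 1) := by
    intro k
    set u : ℝ := 1 / ((k : ℝ) + 1) with hu
    have hu0 : 0 < u := by positivity
    -- The event that no m works lies in the exceptional event of every single m, so letting m → ∞
    -- shows that it is null.
    have hbound : ∀ m, μ {ω | ¬ ∃ m, ∀ N, |partialSum Z (tail m) N ω| < u} ≤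
        ENNReal.ofReal (2 * Real.exp (-(u ^ 2 / (2 * v m)))) := by
      intro m
      refine (measure_mono ?_).trans
        (h.measure_exists_le_abs_partialSum_le (hv0 m) (hvtail m) hu0)
      intro ω hω
      have hω' : ¬ ∃ m, ∀ N, |partialSum Z (tail m) N ω| < u := hω
      push Not at hω'
      exact hω' m
    have hlim : Tendsto (fun m => ENNReal.ofReal (2 * Real.exp (-(u ^ 2 / (2 * v m))))) atTop
        (𝓝 0) := by
      rw [← ENNReal.ofReal_zero]
      refine ENNReal.tendsto_ofReal ?_
      have h1 : Tendsto (fun m => 2 * v m) atTop (𝓝[>] 0) := by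
        refine tendsto_nhdsWithin_iff.2 ⟨by simpa using hvlim.const_mul 2,
          Eventually.of_forall fun m => ?_⟩
        have := hv0 m
        exact Set.mem_Ioi.2 (by positivity)
      have h2 : Tendsto (fun m => u ^ 2 / (2 * v m)) atTop atTop := by
        simp only [div_eq_mul_inv]
        exact (h1.inv_tendsto_nhdsGT_zero).const_mul_atTop (by positivity)
      have h3 := (Real.tendsto_exp_neg_atTop_nhds_zero.comp h2).const_mul 2
      simpa using h3
    rw [ae_iff]
    exact le_antisymm (ge_of_tendsto' hlim hbound) zero_le
  filter_upwards [ae_all_iff.2 hae] with ω hω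
  rw [Metric.cauchySeq_iff']
  intro b hb
  obtain ⟨k, hk⟩ := exists_nat_one_div_lt hb
  obtain ⟨m, hm⟩ := hω k
  refine ⟨m, fun N hN => ?_⟩
  rw [Real.dist_eq, ← hdiff m N ω hN]
  exact (hm N).trans hk

end IsSubGaussianSequence

/-! ### Uniform convergence of random series -/

/-- Telescoping along a sequence of approximations. -/
theorem abs_le_of_links {V : ℕ → ℝ} {l c : ℝ} {u : ℕ → ℝ} (hu : Summable u) (hu0 : ∀ j, 0 ≤ u j)
    (hlim : Tendsto V atTop (𝓝 l)) {m : ℕ} (hlink : ∀ j, m ≤ j → |V (j + 1) - V j| ≤ u j)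
    (hc : ∑' j, u j - ∑ j ∈ Finset.range m, u j ≤ c) : |l - V m| ≤ c := by
  refine le_of_tendsto ((hlim.sub_const (V m)).abs) ?_
  filter_upwards [eventually_ge_atTop m] with k hk
  have h1 : V k - V m = ∑ j ∈ Finset.Ico m k, (V (j + 1) - V j) := (Finset.sum_Ico_sub V hk).symm
  calc |V k - V m| ≤ ∑ j ∈ Finset.Ico m k, |V (j + 1) - V j| := by
        rw [h1]; exact Finset.abs_sum_le_sum_abs _ _
    _ ≤ ∑ j ∈ Finset.Ico m k, u j :=
        Finset.sum_le_sum fun j hj => hlink j (Finset.mem_Ico.1 hj).1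
    _ = ∑ j ∈ Finset.range k, u j - ∑ j ∈ Finset.range m, u j := Finset.sum_Ico_eq_sub _ hk
    _ ≤ c := by linarith [hu.sum_le_tsum (Finset.range k) fun j _ => hu0 j]

section Series

variable {Ω Y : Type*} [MeasurableSpace Ω] {μ : Measure Ω} [NormedAddCommGroup Y]
  [InnerProductSpace ℝ Y]

/-- The partial sums of the series `∑ ⟪y, ψ j⟫ z j`. -/
noncomputable def seriesSum (ψ : ℕ → Y) (N : ℕ) (y : Y) (z : ℕ → ℝ) : ℝ :=
  ∑ j ∈ Finset.range N, inner ℝ y (ψ j) * z j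

theorem seriesSum_sub (ψ : ℕ → Y) (N : ℕ) (y y' : Y) (z : ℕ → ℝ) :
    seriesSum ψ N (y - y') z = seriesSum ψ N y z - seriesSum ψ N y' z := by
  simp only [seriesSum, inner_sub_left, sub_mul, Finset.sum_sub_distrib]

theorem continuous_seriesSum (ψ : ℕ → Y) (N : ℕ) (z : ℕ → ℝ) :
    Continuous fun y => seriesSum ψ N y z := by
  unfold seriesSum
  fun_prop

/-- `ψ` satisfies Bessel's inequality. -/
def IsBessel (ψ : ℕ → Y) : Prop :=
  ∀ y N, ∑ j ∈ Finset.range N, (inner ℝ y (ψ j) : ℝ) ^ 2 ≤ ‖y‖ ^ 2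

theorem IsBessel.summable {ψ : ℕ → Y} (h : IsBessel ψ) (y : Y) :
    Summable fun j => (inner ℝ y (ψ j) : ℝ) ^ 2 :=
  summable_of_sum_range_le (fun _ => sq_nonneg _) (h y)

namespace IsSubGaussianSequence

variable {Z : ℕ → Ω → ℝ}

theorem ae_cauchySeq_seriesSum (h : IsSubGaussianSequence Z μ) {ψ : ℕ → Y} (hψ : IsBessel ψ)
    (y : Y) : ∀ᵐ ω ∂μ, CauchySeq fun N => seriesSum ψ N y (fun j => Z j ω) :=
  h.ae_cauchySeq_partialSum (hψ.summable y)

/-- The links of a chaining net are eventually small, simultaneously for all partial sums. -/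
theorem ae_eventually_links (h : IsSubGaussianSequence Z μ) {ψ : ℕ → Y} (hψ : IsBessel ψ)
    (L : ℕ → Finset (Y × Y)) {s q : ℕ → ℝ} (hs : ∀ j, 0 < s j)
    (hL : ∀ j, ∀ p ∈ L j, ‖p.1 - p.2‖ ≤ s j) (hq : ∀ j : ℕ, (j : ℝ) + 1 ≤ q j)
    (hcard : ∀ j, ((L j).card : ℝ) ≤ Real.exp (q j ^ 2)) :
    ∀ᵐ ω ∂μ, ∀ᶠ j in atTop, ∀ p ∈ L j, ∀ N,
      |seriesSum ψ N p.1 (fun j => Z j ω) - seriesSum ψ N p.2 (fun j => Z j ω)| ≤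
        2 * s j * q j := by
  set B : ℕ → Set Ω := fun j =>
    {ω | ∃ p ∈ L j, ∃ N, 2 * s j * q j ≤
      |seriesSum ψ N (p.1 - p.2) (fun j => Z j ω)|} with hB
  have hq0 : ∀ j : ℕ, 0 < q j := fun j => lt_of_lt_of_le (by positivity) (hq j)
  -- At threshold 2 s q each link fails with probability at most 2e^(-2q²). Against e^(q²) links
  -- this leaves 2e^(-q²) ≤ 2e^(-j), and Borel–Cantelli applies.
  have hBj : ∀ j, μ (B j) ≤ ENNReal.ofReal (2 * Real.exp (-1) ^ j) := by
    intro j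
    have hsub : B j ⊆ ⋃ p ∈ L j, {ω | ∃ N, 2 * s j * q j ≤
        |partialSum Z (fun j => inner ℝ (p.1 - p.2) (ψ j)) N ω|} := by
      rintro ω ⟨p, hp, N, hN⟩
      exact Set.mem_biUnion hp ⟨N, hN⟩
    calc μ (B j) ≤ ∑ p ∈ L j, μ {ω | ∃ N, 2 * s j * q j ≤
        |partialSum Z (fun j => inner ℝ (p.1 - p.2) (ψ j)) N ω|} :=
          (measure_mono hsub).trans (measure_biUnion_finset_le _ _)
      _ ≤ ∑ p ∈ L j, ENNReal.ofReal (2 * Real.exp (-(2 * q j ^ 2))) := by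
          refine Finset.sum_le_sum fun p hp => ?_
          have h1 := hs j
          have h2 := hq0 j
          refine (h.measure_exists_le_abs_partialSum_le (v := s j ^ 2) (by positivity)
            (fun N => (hψ _ N).trans (pow_le_pow_left₀ (norm_nonneg _) (hL j p hp) 2))
            (by positivity)).trans (le_of_eq ?_)
          congr 4
          field_simp
      _ = ENNReal.ofReal ((L j).card * (2 * Real.exp (-(2 * q j ^ 2)))) := by
          rw [Finset.sum_const, nsmul_eq_mul, ENNReal.ofReal_mul (Nat.cast_nonneg _),
            ENNReal.ofReal_natCast]
      _ ≤ ENNReal.ofReal (2 * Real.exp (-1) ^ j) := by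
          refine ENNReal.ofReal_le_ofReal ?_
          calc ((L j).card : ℝ) * (2 * Real.exp (-(2 * q j ^ 2)))
              ≤ Real.exp (q j ^ 2) * (2 * Real.exp (-(2 * q j ^ 2))) := by
                gcongr
                exact hcard j
            _ = 2 * Real.exp (-(q j ^ 2)) := by
                rw [mul_left_comm, ← Real.exp_add]
                ring_nf
            _ ≤ 2 * Real.exp (-1) ^ j := by
                rw [← Real.exp_nat_mul]
                gcongr
                nlinarith [hq j, hq0 j, (Nat.cast_nonneg j : (0 : ℝ) ≤ j)]
  have hsum : ∑' j, μ (B j) ≠ ⊤ := by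
    have hsm : Summable fun j : ℕ => 2 * Real.exp (-1) ^ j :=
      (summable_geometric_of_lt_one (Real.exp_pos _).le (by simp)).mul_left 2
    exact ne_top_of_le_ne_top hsm.tsum_ofReal_ne_top (ENNReal.tsum_le_tsum hBj)
  filter_upwards [ae_eventually_notMem hsum] with ω hω
  filter_upwards [hω] with j hj p hp N
  by_contra hcon
  refine hj ⟨p, hp, N, ?_⟩
  rw [seriesSum_sub]
  exact (not_le.1 hcon).le

/-- The series converges uniformly over a class with a finite entropy integral. -/
theorem ae_uniformCauchy_seriesSum (h : IsSubGaussianSequence Z μ) {ψ : ℕ → Y} (hψ : IsBessel ψ)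
    {T : Type*} {d : T → T → ℝ} (hsymm : ∀ s t, d s t = d t s)
    (htri : ∀ s t u, d s u ≤ d s t + d t u) {A : Set T} (hA : A.Nonempty)
    {r S : ℝ} (hr : 0 < r) (hS : 0 ≤ S)
    (hent : ∫⁻ ρ in Set.Ioc 0 r, entropy (fun s t => ENNReal.ofReal (d s t)) A ρ ^ (1 / 2 : ℝ) ≤
      ENNReal.ofReal S) {f : T → Y} {κ : ℝ} (hκ : 0 < κ) (hf : ∀ s t, ‖f s - f t‖ ≤ κ * d s t) :
    ∀ᵐ ω ∂μ, ∀ b : ℝ, 0 < b → ∃ N₀, ∀ N, N₀ ≤ N → ∀ M, N₀ ≤ M → ∀ t ∈ A,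
      |seriesSum ψ N (f t) (fun j => Z j ω) - seriesSum ψ M (f t) (fun j => Z j ω)| ≤ b := by
  classical
  obtain ⟨C, H, hCA, hC, hH0, hcard, hsum⟩ := exists_nets d hA hr hS hent
  -- The trailing 0 stands for L = 0 in `sum_chaining_scales_le`, which gives the summability of the
  -- link bounds.
  set q : ℕ → ℝ := fun j => √(H (j + 1) + H j) + j + 2 + 0 with hq
  set s : ℕ → ℝ := fun j => κ * (2 * (r / 2 ^ j)) with hs
  have hs0 : ∀ j, 0 < s j := fun j => by positivity
  have hq0 : ∀ j : ℕ, (j : ℝ) + 1 ≤ q j := fun j => by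
    have := Real.sqrt_nonneg (H (j + 1) + H j)
    simp only [hq]
    linarith
  have hq1 : ∀ j, H (j + 1) + H j ≤ q j ^ 2 := fun j => by
    have h1 := Real.sqrt_nonneg (H (j + 1) + H j)
    calc H (j + 1) + H j = √(H (j + 1) + H j) ^ 2 :=
          (Real.sq_sqrt (add_nonneg (hH0 _) (hH0 _))).symm
      _ ≤ q j ^ 2 := by
          gcongr
          simp only [hq]
          linarith [(Nat.cast_nonneg j : (0 : ℝ) ≤ j)]
  set u : ℕ → ℝ := fun j => 2 * s j * q j with hu
  have hu0 : ∀ j, 0 ≤ u j := fun j => by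
    have h1 := hs0 j
    have h2 : 0 ≤ q j := le_trans (by positivity) (hq0 j)
    positivity
  have husum : Summable u := by
    have h1 : Summable fun j => 2 * (r / 2 ^ j) * q j :=
      summable_of_sum_range_le (fun j => mul_nonneg (by positivity)
        (le_trans (by positivity) (hq0 j)))
        (sum_chaining_scales_le hr le_rfl (fun _ => le_rfl) hsum)
    refine (h1.mul_left (2 * κ)).congr fun j => ?_
    simp only [hu, hs]
    ring
  set L : ℕ → Finset (Y × Y) := fun j =>
    (((C (j + 1)) ×ˢ (C j)).filter fun p => d p.1 p.2 ≤ 2 * (r / 2 ^ j)).image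
      fun p => (f p.1, f p.2) with hL
  have hlinks := h.ae_eventually_links hψ L hs0
    (fun j p hp => by
      obtain ⟨p', hp', rfl⟩ := Finset.mem_image.1 hp
      exact (hf _ _).trans (mul_le_mul_of_nonneg_left (Finset.mem_filter.1 hp').2 hκ.le))
    hq0
    (fun j => by
      calc ((L j).card : ℝ) ≤ (((C (j + 1)) ×ˢ (C j)).card : ℝ) := by
            exact_mod_cast Finset.card_image_le.trans (Finset.card_filter_le _ _)
        _ = ((C (j + 1)).card : ℝ) * (C j).card := by rw [Finset.card_product]; push_cast; rfl
        _ ≤ Real.exp (H (j + 1)) * Real.exp (H j) := by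
            gcongr
            · exact hcard (j + 1)
            · exact hcard j
        _ = Real.exp (H (j + 1) + H j) := (Real.exp_add _ _).symm
        _ ≤ _ := Real.exp_le_exp.2 (hq1 j))
  have hcauchy : ∀ᵐ ω ∂μ, ∀ m, ∀ c ∈ C m, CauchySeq fun N =>
      seriesSum ψ N (f c) (fun j => Z j ω) := by
    rw [ae_all_iff]
    intro m
    exact (eventually_all_finset (C m)).2 fun c _ => h.ae_cauchySeq_seriesSum hψ (f c)
  filter_upwards [hlinks, hcauchy] with ω hω hωc b hb
  obtain ⟨m₀, hm₀⟩ := eventually_atTop.1 hω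
  -- An ε/3 argument: from a high level m on, the links move every partial sum by at most b/3,
  -- whatever its length, and on the finite net at level m the series converges pointwise.
  have htail : ∀ᶠ m in atTop, ∑' j, u j - ∑ j ∈ Finset.range m, u j < b / 3 := by
    have h1 := (tendsto_const_nhds (x := ∑' j, u j)).sub husum.hasSum.tendsto_sum_nat
    rw [sub_self] at h1
    exact h1.eventually_lt_const (by positivity)
  obtain ⟨m, hmtail, hm⟩ := (htail.and (eventually_ge_atTop m₀)).exists
  have hN₀ : ∀ c : T, ∃ N₀, c ∈ C m → ∀ N, N₀ ≤ N → ∀ M, N₀ ≤ M →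
      |seriesSum ψ N (f c) (fun j => Z j ω) - seriesSum ψ M (f c) (fun j => Z j ω)| ≤ b / 3 := by
    intro c
    by_cases hc : c ∈ C m
    · obtain ⟨N₀, hN₀⟩ := Metric.cauchySeq_iff.1 (hωc m c hc) (b / 3) (by positivity)
      exact ⟨N₀, fun _ N hN M hM => (hN₀ N hN M hM).le⟩
    · exact ⟨0, fun hc' => absurd hc' hc⟩
  choose N₀ hN₀ using hN₀
  refine ⟨(C m).sup N₀, fun N hN M hM t ht => ?_⟩
  choose π hπC hπ using fun j => hC j t ht
  have hlink : ∀ K j, m ≤ j → |seriesSum ψ K (f (π (j + 1))) (fun j => Z j ω) -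
      seriesSum ψ K (f (π j)) (fun j => Z j ω)| ≤ u j := by
    intro K j hj
    refine hm₀ j (hm.trans hj) (f (π (j + 1)), f (π j)) (Finset.mem_image.2
      ⟨(π (j + 1), π j), ?_, rfl⟩) K
    rw [Finset.mem_filter, Finset.mem_product]
    refine ⟨⟨hπC _, hπC _⟩, ?_⟩
    have h3 := hπ (j + 1)
    have h4 : r / 2 ^ (j + 1) ≤ r / 2 ^ j := by gcongr <;> norm_num
    calc d (π (j + 1)) (π j) ≤ d (π (j + 1)) t + d t (π j) := htri _ _ _
      _ ≤ r / 2 ^ j + r / 2 ^ j := add_le_add (by rw [hsymm]; linarith) (hπ j)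
      _ = _ := by ring
  have hlimf : Tendsto (fun j => f (π j)) atTop (𝓝 (f t)) := by
    rw [tendsto_iff_norm_sub_tendsto_zero]
    have h2 : Tendsto (fun j : ℕ => κ * (r / (2 : ℝ) ^ j)) atTop (𝓝 0) := by
      simpa using (tendsto_const_nhds.div_atTop
        (tendsto_pow_atTop_atTop_of_one_lt (by norm_num))).const_mul κ
    refine squeeze_zero (fun _ => norm_nonneg _) (fun j => ?_) h2
    rw [norm_sub_rev]
    exact (hf _ _).trans (mul_le_mul_of_nonneg_left (hπ j) hκ.le)
  have hdev : ∀ K, |seriesSum ψ K (f t) (fun j => Z j ω) -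
      seriesSum ψ K (f (π m)) (fun j => Z j ω)| ≤ b / 3 := fun K =>
    abs_le_of_links (V := fun j => seriesSum ψ K (f (π j)) (fun j => Z j ω)) husum hu0
      (((continuous_seriesSum ψ K fun j => Z j ω).tendsto _).comp hlimf) (hlink K) hmtail.le
  have h1 := hdev N
  have h2 := hdev M
  have h3 := hN₀ (π m) (hπC m) N ((Finset.le_sup (hπC m)).trans hN) M
    ((Finset.le_sup (hπC m)).trans hM)
  rw [abs_le] at h1 h2 h3 ⊢
  constructor <;> linarith [h1.1, h1.2, h2.1, h2.2, h3.1, h3.2]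

end IsSubGaussianSequence

end Series

/-! ### Gaussian white noise -/

section WhiteNoise

variable {Ω Y : Type*} [MeasurableSpace Ω] {μ : Measure Ω}

theorem hasSubgaussianMGF_of_hasGaussianLaw {T : Ω → ℝ} (h : HasGaussianLaw T μ)
    (hmean : ∫ ω, T ω ∂μ = 0) {c : NNReal} (hc : Var[T; μ] ≤ c) : HasSubgaussianMGF T c μ := by
  have hmap := h.map_eq_gaussianReal
  have hm : AEMeasurable T μ := h.aemeasurable
  refine ⟨fun t => ?_, fun t => ?_⟩
  · have h1 : Integrable (fun z => Real.exp (t * z)) (μ.map T) := by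
      rw [hmap]
      exact integrable_exp_mul_gaussianReal t
    exact (integrable_map_measure (by fun_prop) hm).1 h1
  · rw [mgf_gaussianReal hmap, hmean, zero_mul, zero_add,
      Real.coe_toNNReal _ (variance_nonneg _ _)]
    gcongr

variable [NormedAddCommGroup Y] [InnerProductSpace ℝ Y] {W : Y → Ω → ℝ}

namespace IsWhiteNoise

theorem memLp_two (hW : IsWhiteNoise W μ) (y : Y) : MemLp (W y) 2 μ :=
  (hW.gaussian.hasGaussianLaw_eval y).memLp_two

theorem variance_eq (hW : IsWhiteNoise W μ) (y : Y) : Var[W y; μ] = ‖y‖ ^ 2 := by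
  rw [← covariance_self (hW.measurable y).aemeasurable, hW.covariance, real_inner_self_eq_norm_sq]

theorem hasSubgaussianMGF_sub (hW : IsWhiteNoise W μ) (u v : Y) :
    HasSubgaussianMGF (fun ω => W u ω - W v ω) (‖u - v‖₊ ^ 2) μ := by
  have := hW.gaussian.isProbabilityMeasure
  refine hasSubgaussianMGF_of_hasGaussianLaw hW.gaussian.hasGaussianLaw_fun_sub ?_ ?_
  · rw [integral_sub ((hW.memLp_two u).integrable one_le_two)
      ((hW.memLp_two v).integrable one_le_two), hW.mean, hW.mean, sub_zero]
  · rw [variance_fun_sub (hW.memLp_two u) (hW.memLp_two v), hW.variance_eq, hW.variance_eq,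
      hW.covariance]
    push_cast
    exact (norm_sub_sq_real u v).ge

/-- The coordinates of a white noise in an orthonormal basis, extended by zero to a sequence. -/
theorem exists_expansion (hW : IsWhiteNoise W μ) :
    ∃ ψ : ℕ → Y, IsBessel ψ ∧ IsSubGaussianSequence (fun j => W (ψ j)) μ ∧
      ∀ᵐ ω ∂μ, ∀ (y : Y) (l : ℝ),
        Tendsto (fun N => seriesSum ψ N y fun j => W (ψ j) ω) atTop (𝓝 l) → W y ω = l := by
  classical
  have := hW.gaussian.isProbabilityMeasure
  obtain ⟨J, φ, hφ⟩ := hW.series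
  set ψ : ℕ → Y := fun j => if h : j ∈ J then φ ⟨j, h⟩ else 0 with hψ
  have hmem : ∀ j (h : j ∈ J), ψ j = φ ⟨j, h⟩ := fun j h => by simp only [hψ, dif_pos h]
  have hnot : ∀ j, j ∉ J → ψ j = 0 := fun j h => by simp only [hψ, dif_neg h]
  have horth : ∀ i j, i ≠ j → (inner ℝ (ψ i) (ψ j) : ℝ) = 0 := by
    intro i j hij
    by_cases hi : i ∈ J
    · by_cases hj : j ∈ J
      · rw [hmem i hi, hmem j hj]
        exact φ.orthonormal.2 fun h => hij (congrArg Subtype.val h)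
      · rw [hnot j hj, inner_zero_right]
    · rw [hnot i hi, inner_zero_left]
  have hnorm : ∀ j, ‖ψ j‖ ≤ 1 := by
    intro j
    by_cases hj : j ∈ J
    · rw [hmem j hj, φ.orthonormal.1]
    · rw [hnot j hj, norm_zero]
      exact zero_le_one
  refine ⟨ψ, fun y N => ?_, ⟨fun j => hW.measurable _, ?_, fun j => ?_, fun j => hW.mean _⟩, ?_⟩
  · have h1 := φ.orthonormal.sum_inner_products_le y (s := (Finset.range N).subtype (· ∈ J))
    refine le_trans (le_of_eq ?_) h1
    rw [← Finset.sum_filter_of_ne (p := (· ∈ J)), ← Finset.sum_subtype_eq_sum_filter]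
    · refine Finset.sum_congr rfl fun j _ => ?_
      rw [hmem j.1 j.2, Real.norm_eq_abs, sq_abs, real_inner_comm]
    · intro j _ h
      by_contra hj
      rw [hnot j hj, inner_zero_right] at h
      norm_num at h
  -- Jointly Gaussian coordinates that are uncorrelated are independent; the padding vectors 0 have
  -- zero covariance with all others.
  · have h1 := IsGaussianProcess.iIndepFun_of_covariance_eq_zero (P := μ) (S := fun _ : ℕ => Unit)
      (X := fun j _ => W (ψ j)) (hW.gaussian.comp_right fun p : (_ : ℕ) × Unit => ψ p.1)
      (fun j _ => (hW.measurable _).aemeasurable)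
      (fun i j hij _ _ => by rw [hW.covariance, horth i j hij])
    exact h1.comp (fun _ f => f ()) fun _ => measurable_pi_apply _
  · refine hasSubgaussianMGF_of_hasGaussianLaw (hW.gaussian.hasGaussianLaw_eval _)
      (hW.mean _) ?_
    rw [hW.variance_eq, NNReal.coe_one]
    exact pow_le_one₀ (norm_nonneg _) (hnorm j)
  · filter_upwards [hφ] with ω hω y l hlim
    refine hω y l (hlim.congr fun N => Finset.sum_congr rfl fun j _ => ?_)
    by_cases hj : j ∈ J
    · simp only [hmem j hj, dif_pos hj]
    · rw [hnot j hj, dif_neg hj, inner_zero_right, zero_mul]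

end IsWhiteNoise

end WhiteNoise

/-! ### The risk bound for white noise -/

section SeriesLimit

variable {Y : Type*} [NormedAddCommGroup Y] [InnerProductSpace ℝ Y]

/-- The sum of the series `∑ ⟪y, ψ j⟫ z j`, if it converges. -/
noncomputable def seriesLim (ψ : ℕ → Y) (y : Y) (z : ℕ → ℝ) : ℝ :=
  limsup (fun N => seriesSum ψ N y z) atTop

theorem measurable_seriesSum [SecondCountableTopology Y] [MeasurableSpace Y] [BorelSpace Y]
    (ψ : ℕ → Y) (N : ℕ) : Measurable fun p : Y × (ℕ → ℝ) => seriesSum ψ N p.1 p.2 := by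
  unfold seriesSum
  fun_prop

/-- Being a limsup, this version of the noise is jointly measurable in index and coordinates, even
where the series diverges. -/
theorem measurable_seriesLim [SecondCountableTopology Y] [MeasurableSpace Y] [BorelSpace Y]
    (ψ : ℕ → Y) : Measurable fun p : Y × (ℕ → ℝ) => seriesLim ψ p.1 p.2 :=
  Measurable.limsup fun N => measurable_seriesSum ψ N

theorem tendsto_seriesSum_seriesLim {ψ : ℕ → Y} {y : Y} {z : ℕ → ℝ}
    (h : CauchySeq fun N => seriesSum ψ N y z) :
    Tendsto (fun N => seriesSum ψ N y z) atTop (𝓝 (seriesLim ψ y z)) := by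
  obtain ⟨l, hl⟩ := cauchySeq_tendsto_of_complete h
  rwa [seriesLim, hl.limsup_eq]

theorem continuousOn_seriesLim {ψ : ℕ → Y} {z : ℕ → ℝ} {B : Set Y}
    (h : UniformCauchySeqOn (fun N y => seriesSum ψ N y z) atTop B) :
    ContinuousOn (fun y => seriesLim ψ y z) B :=
  (h.tendstoUniformlyOn_of_tendsto fun _ hy =>
    tendsto_seriesSum_seriesLim (h.cauchySeq hy)).continuousOn
      (Frequently.of_forall fun N => (continuous_seriesSum ψ N z).continuousOn)

/-- Partial sums are continuous in y, so each Cauchy estimate is a closed condition and passes to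
the closure. The countable form of the hypothesis is what makes the event measurable. -/
theorem uniformCauchySeqOn_seriesSum_of_dense {ψ : ℕ → Y} {z : ℕ → ℝ} {B : Set Y} {g : ℕ → Y}
    (hg : B ⊆ closure (Set.range g))
    (h : ∀ m : ℕ, ∃ N₀, ∀ N, N₀ ≤ N → ∀ M, N₀ ≤ M → ∀ k,
      |seriesSum ψ N (g k) z - seriesSum ψ M (g k) z| ≤ 1 / ((m : ℝ) + 1)) :
    UniformCauchySeqOn (fun N y => seriesSum ψ N y z) atTop B := by
  rw [Metric.uniformCauchySeqOn_iff]
  intro b hb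
  obtain ⟨m, hm⟩ := exists_nat_one_div_lt hb
  obtain ⟨N₀, hN₀⟩ := h m
  refine ⟨N₀, fun N hN M hM y hy => ?_⟩
  have hclosed : IsClosed {y | |seriesSum ψ N y z - seriesSum ψ M y z| ≤ 1 / ((m : ℝ) + 1)} :=
    isClosed_le (((continuous_seriesSum ψ N z).sub (continuous_seriesSum ψ M z)).abs)
      continuous_const
  have h1 := closure_minimal (Set.range_subset_iff.2 (hN₀ N hN M hM)) hclosed (hg hy)
  exact lt_of_le_of_lt h1 hm

end SeriesLimit

/-- The noise series converges uniformly over the class at the design points. -/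
theorem ae_uniformCauchySeqOn_seriesSum {X Y E : Type*} [TopologicalSpace X]
    [HereditarilyLindelofSpace X] [MeasurableSpace X] [NormedAddCommGroup Y]
    [InnerProductSpace ℝ Y] [SecondCountableTopology Y] [MeasurableSpace Y] [BorelSpace Y]
    [MeasurableSpace E] {ν : Measure E} [IsProbabilityMeasure ν] {γ : Measure X}
    [IsProbabilityMeasure γ] {n : ℕ} {G₀ Gs : X → Y}
    {𝒢 : Set (X → Y)} {Ψ : ℝ → ℝ} (hclass : ClassAssumption n γ G₀ 𝒢 Gs Ψ) {F : ℝ} (hF : 0 < F)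
    (hbd : ∀ G ∈ 𝒢, ∀ z ∈ γ.support, ‖G z - G₀ z‖ ≤ F) {Z : Fin n → ℕ → E → ℝ}
    {ψ : Fin n → ℕ → Y} (hψ : ∀ i, IsBessel (ψ i)) (hZ : ∀ i, IsSubGaussianSequence (Z i) ν) :
    ∀ᵐ p ∂((Measure.pi fun _ : Fin n => γ).prod ν), ∀ i,
      UniformCauchySeqOn (fun N y => seriesSum (ψ i) N y (fun j => Z i j p.2)) atTop
        ((fun G : X → Y => G (p.1 i)) '' 𝒢) := by
  have hsupp : ∀ᵐ x ∂(Measure.pi fun _ : Fin n => γ), ∀ i, x i ∈ γ.support :=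
    ae_all_iff.2 fun i => (Measure.quasiMeasurePreserving_eval (fun _ : Fin n => γ) i).ae
      Measure.support_mem_ae
  obtain ⟨g, hg𝒢, hg⟩ := exists_dense_seq_of_isCompact ⟨Gs, hclass.mem⟩ hclass.compact
  -- Only countable quantifiers occur, so Q is measurable and may be checked for one fixed design at
  -- a time.
  set Q : (Fin n → X) × E → Prop := fun p => ∀ i, ∀ m : ℕ, ∃ N₀, ∀ N, N₀ ≤ N → ∀ M, N₀ ≤ M →
    ∀ k, |seriesSum (ψ i) N (g k (p.1 i)) (fun j => Z i j p.2) -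
      seriesSum (ψ i) M (g k (p.1 i)) (fun j => Z i j p.2)| ≤ 1 / ((m : ℝ) + 1) with hQ
  have hQm : MeasurableSet {p | Q p} := by
    have hs : ∀ i N k, Measurable fun p : (Fin n → X) × E =>
        seriesSum (ψ i) N (g k (p.1 i)) (fun j => Z i j p.2) := by
      intro i N k
      have h1 := hclass.measurable _ (hg𝒢 k)
      have h2 := (hZ i).measurable
      exact (measurable_seriesSum (ψ i) N).comp
        (f := fun p : (Fin n → X) × E => (g k (p.1 i), fun j => Z i j p.2)) (by fun_prop)
    refine measurableSet_setOfPred.2 ?_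
    refine Measurable.forall fun i => Measurable.forall fun m => Measurable.exists fun N₀ =>
      Measurable.forall fun N => Measurable.imp measurable_const <| Measurable.forall fun M =>
        Measurable.imp measurable_const <| Measurable.forall fun k => measurableSet_setOfPred.1 ?_
    exact measurableSet_le ((hs i N k).sub (hs i M k)).abs measurable_const
  have hQae : ∀ᵐ p ∂((Measure.pi fun _ : Fin n => γ).prod ν), Q p := by
    rw [Measure.ae_prod_iff_ae_ae hQm]
    filter_upwards [hsupp, hclass.entropyIntegral_le] with x hx hent
    refine ae_all_iff.2 fun i => ?_
    have hn : (0 : ℝ) < n := by exact_mod_cast i.pos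
    -- At radius 2F the localized class is the whole class, which therefore has a finite entropy
    -- integral. Evaluation at x i is √n-Lipschitz for ‖·‖_n.
    have hloc : localized x 𝒢 Gs (2 * F) = 𝒢 := by
      refine Set.Subset.antisymm (fun G hG => hG.1) fun G hG => ⟨hG, ?_⟩
      refine empNorm_le_of_forall x (by positivity) fun i => ?_
      have h1 := hbd G hG _ (hx i)
      have h2 := hbd Gs hclass.mem _ (hx i)
      rw [norm_sub_rev] at h2
      have h3 := norm_sub_le_norm_sub_add_norm_sub (G (x i)) (G₀ (x i)) (Gs (x i))
      rw [Pi.sub_apply]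
      linarith
    have hent' := hent (2 * F) (by positivity)
    rw [entropyIntegral, hloc] at hent'
    have h1 := (hZ i).ae_uniformCauchy_seriesSum (hψ i)
      (d := fun s t : X → Y => empNorm x (s - t)) (empNorm_sub_comm x)
      (empNorm_sub_le x) ⟨Gs, hclass.mem⟩ (by positivity) (hclass.nonneg _ (by positivity))
      hent' (f := fun G => G (x i)) (Real.sqrt_pos.2 hn)
      (fun s t => norm_le_sqrt_mul_empNorm x (s - t) i)
    filter_upwards [h1] with z hz m
    obtain ⟨N₀, hN₀⟩ := hz (1 / ((m : ℝ) + 1)) (by positivity)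
    exact ⟨N₀, fun N hN M hM k => hN₀ N hN M hM _ (hg𝒢 k)⟩
  have hsupp' := Measure.quasiMeasurePreserving_fst (μ := Measure.pi fun _ : Fin n => γ)
    (ν := ν) |>.ae hsupp
  filter_upwards [hQae, hsupp'] with p hp hps i
  refine uniformCauchySeqOn_seriesSum_of_dense (g := fun k => g k (p.1 i)) ?_ (hp i)
  rintro _ ⟨G, hG, rfl⟩
  rw [Metric.mem_closure_range_iff]
  intro b hb
  obtain ⟨k, hk⟩ := hg G hG b hb
  exact ⟨k, by rw [dist_eq_norm]; exact hk _ (hps i)⟩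

theorem IsSubGaussianSequence.of_comp {Ω E : Type*} [MeasurableSpace Ω] [MeasurableSpace E]
    {μ : Measure Ω} {Z : ℕ → E → ℝ} {η : Ω → E} (hη : Measurable η) (hZ : ∀ j, Measurable (Z j))
    (h : IsSubGaussianSequence (fun j ω => Z j (η ω)) μ) :
    IsSubGaussianSequence Z (μ.map η) := by
  have := h.indep.isProbabilityMeasure
  have := Measure.isProbabilityMeasure_map (μ := μ) hη.aemeasurable
  refine ⟨hZ, ?_, fun j => ⟨fun t => ?_, fun t => ?_⟩, fun j => ?_⟩
  · rw [iIndepFun_iff_map_fun_eq_infinitePi_map hZ, Measure.map_map (by fun_prop) hη]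
    have h1 := (iIndepFun_iff_map_fun_eq_infinitePi_map h.measurable).1 h.indep
    simp only [Measure.map_map (hZ _) hη]
    exact h1
  · exact (integrable_map_measure (by fun_prop) hη.aemeasurable).2
      ((h.subgaussian j).integrable_exp_mul t)
  · rw [mgf_map hη.aemeasurable (by fun_prop)]
    exact (h.subgaussian j).mgf_le t
  · rw [integral_map hη.aemeasurable (by fun_prop)]
    exact h.mean j

/-- The auxiliary variable collects the noise coordinates in a basis for each i, and w is the limit
of the corresponding series. -/
theorem lintegral_risk_le_of_whiteNoise {X Y Ω : Type*}
    [TopologicalSpace X] [HereditarilyLindelofSpace X] [MeasurableSpace X]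
    [NormedAddCommGroup Y] [InnerProductSpace ℝ Y] [SecondCountableTopology Y]
    [MeasurableSpace Y] [BorelSpace Y] [MeasurableSpace Ω] {μ : Measure Ω}
    [IsProbabilityMeasure μ]
    {γ : Measure X} [IsProbabilityMeasure γ] {n : ℕ} (hn : 1 ≤ n) {σ : ℝ} (hσ : 0 < σ)
    {G₀ Gs : X → Y} (hG₀ : Measurable G₀) {𝒢 : Set (X → Y)} {Ψ : ℝ → ℝ}
    (hclass : ClassAssumption n γ G₀ 𝒢 Gs Ψ) {F : ℝ} (hF : 0 < F)
    (hbd : ∀ G ∈ 𝒢, ∀ z ∈ γ.support, ‖G z - G₀ z‖ ≤ F)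
    {x : Fin n → Ω → X} {ε : Fin n → Y → Ω → ℝ} {Ghat : Ω → X → Y}
    (hx : ∀ i, Measurable (x i)) (hlaw : ∀ i, μ.map (x i) = γ) (hindep : iIndepFun x μ)
    (hnoise : WhiteNoiseModel x ε μ) (hERM : IsERM γ G₀ 𝒢 σ x ε μ Ghat)
    {δ δ' : ℝ} (hδ : 0 < δ) (hδ' : 0 < δ')
    (hcrit : riskConst 24 * σ * Ψ δ ≤ √(n : ℝ) * δ ^ 2)
    (hent : ENNReal.ofReal (riskConst 24 * F ^ 2) * entropy (supDist γ.support) 𝒢 δ' ≤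
      ENNReal.ofReal (n * δ' ^ 2)) :
    ∫⁻ ω, eLpNorm (Ghat ω - G₀) 2 γ ^ 2 ∂μ ≤
      ENNReal.ofReal (riskConst 24 * (δ ^ 2 + δ' ^ 2 + (σ ^ 2 + F ^ 2) / n)) +
        8 * eLpNorm (Gs - G₀) 2 γ ^ 2 := by
  choose ψ hψ hZ hser using fun i => (hnoise.whiteNoise i).exists_expansion
  set η : Ω → Fin n → ℕ → ℝ := fun ω i j => ε i (ψ i j) ω with hη
  have hηm : Measurable η := measurable_pi_lambda _ fun i => measurable_pi_lambda _ fun j =>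
    (hnoise.whiteNoise i).measurable _
  have hxm : Measurable fun ω i => x i ω := measurable_pi_lambda _ hx
  have hν : IsProbabilityMeasure (μ.map η) := Measure.isProbabilityMeasure_map hηm.aemeasurable
  have hind : IndepFun (fun ω i => x i ω) η μ :=
    hnoise.indep_design.comp (φ := id) (ψ := fun (f : Fin n → Y → ℝ) i j => f i (ψ i j))
      measurable_id (by fun_prop)
  have hmap := map_design_noise hx hlaw hindep hηm hind
  have hw : ∀ i, Measurable fun p : Y × (Fin n → ℕ → ℝ) => seriesLim (ψ i) p.1 (p.2 i) :=
    fun i => (measurable_seriesLim (ψ i)).comp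
      (f := fun p : Y × (Fin n → ℕ → ℝ) => (p.1, p.2 i)) (by fun_prop)
  have hZ' : ∀ i, IsSubGaussianSequence (fun j (z : Fin n → ℕ → ℝ) => z i j) (μ.map η) :=
    fun i => IsSubGaussianSequence.of_comp hηm (fun j => by fun_prop) (hZ i)
  have hcauchy := ae_uniformCauchySeqOn_seriesSum (ν := μ.map η) hclass hF hbd hψ hZ'
  -- The null set here depends on y, which suffices for moments at fixed indices; at indices
  -- depending on the data, uniform convergence over the class is used instead.
  have heval : ∀ i y, ∀ᵐ ω ∂μ, seriesLim (ψ i) y (η ω i) = ε i y ω := by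
    intro i y
    filter_upwards [(hZ i).ae_cauchySeq_seriesSum (hψ i) y, hser i] with ω h1 h2
    exact (h2 y _ (tendsto_seriesSum_seriesLim h1)).symm
  refine lintegral_risk_le_of_noise_representation hn hσ hG₀ hclass hF hbd hERM
    (hxm.prodMk hηm) hmap (w := fun i y z => seriesLim (ψ i) y (z i)) hw (by norm_num) ?_ ?_ ?_
    hδ hδ' hcrit hent
  · intro u v a
    have hwm : ∀ i y, Measurable fun z : Fin n → ℕ → ℝ => seriesLim (ψ i) y (z i) :=
      fun i y => (hw i).comp
        (f := fun z : Fin n → ℕ → ℝ => (y, z)) (measurable_const.prodMk measurable_id)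
    rw [lintegral_map (by
      refine (Real.measurable_exp.comp (Measurable.const_mul ?_ a)).ennreal_ofReal
      exact Finset.measurable_fun_sum _ fun i _ => (hwm i _).sub (hwm i _)) hηm]
    have h1 := HasSubgaussianMGF.sum_of_iIndepFun (s := Finset.univ)
      (X := fun i ω => ε i (u i) ω - ε i (v i) ω)
      (hnoise.indep.comp (fun i f => f (u i) - f (v i)) fun i => by fun_prop)
      fun i _ => (hnoise.whiteNoise i).hasSubgaussianMGF_sub (u i) (v i)
    refine le_trans (le_of_eq ?_) ((lintegral_exp_le_of_hasSubgaussianMGF h1 a).trans ?_)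
    · refine lintegral_congr_ae ?_
      filter_upwards [ae_all_iff.2 fun i => heval i (u i), ae_all_iff.2 fun i => heval i (v i)]
        with ω hu hv
      simp only [hu, hv]
    · refine ENNReal.ofReal_le_ofReal (Real.exp_le_exp.2 ?_)
      push_cast
      have h2 : 0 ≤ ∑ i, ‖u i - v i‖ ^ 2 := by positivity
      -- The Gaussian constant is 1/2; it is enlarged to 24 so that both noise types share one
      -- constant.
      nlinarith [mul_nonneg h2 (sq_nonneg a)]
  · filter_upwards [hcauchy] with p hp G hG u hu hlim i
    refine (continuousOn_seriesLim (hp i) _ ⟨G, hG, rfl⟩).tendsto.comp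
      (tendsto_nhdsWithin_iff.2 ⟨tendsto_apply_of_tendsto_empNorm hlim i,
        Eventually.of_forall fun k => ⟨u k, hu k, rfl⟩⟩)
  · have h1 := hcauchy
    rw [← hmap] at h1
    filter_upwards [ae_of_ae_map (hxm.prodMk hηm).aemeasurable h1, ae_all_iff.2 hser]
      with ω hω hs G hG i
    exact hs i _ _ (tendsto_seriesSum_seriesLim ((hω i).cauchySeq ⟨G, hG, rfl⟩))

end HilbertRegression

/-! ### The main theorem: both noise types and all reference maps. -/

open HilbertRegression in
theorem mainTheorem6 :
    ∃ C : ℝ, 0 < C ∧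
      ∀ (X Y Ω : Type*)
        [NormedAddCommGroup X] [InnerProductSpace ℝ X] [CompleteSpace X]
        [SecondCountableTopology X] [MeasurableSpace X] [BorelSpace X]
        [NormedAddCommGroup Y] [InnerProductSpace ℝ Y] [CompleteSpace Y]
        [SecondCountableTopology Y] [MeasurableSpace Y] [BorelSpace Y]
        [MeasurableSpace Ω] (μ : Measure Ω) [IsProbabilityMeasure μ]
        (γ : Measure X) [IsProbabilityMeasure γ]
        (n : ℕ) (_ : 1 ≤ n) (σ : ℝ) (_ : 0 < σ)
        (G₀ : X → Y) (_ : Measurable G₀) (𝒢 : Set (X → Y)) (Ψ : ℝ → ℝ) (Finf : ℝ)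
        (x : Fin n → Ω → X) (ε : Fin n → Y → Ω → ℝ) (Ghat : Ω → X → Y) (δ δ' : ℝ),
        (∀ Gs ∈ 𝒢, ClassAssumption n γ G₀ 𝒢 Gs Ψ) →
        (∀ G ∈ 𝒢, ∀ z ∈ γ.support, ‖G z - G₀ z‖ ≤ Finf) →
        RegressionModel γ x ε μ →
        IsERM γ G₀ 𝒢 σ x ε μ Ghat →
        0 < δ → 0 < δ' →
        C * σ * Ψ δ ≤ √(n : ℝ) * δ ^ 2 →
        ENNReal.ofReal (C * Finf ^ 2) * entropy (supDist γ.support) 𝒢 δ' ≤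
          ENNReal.ofReal (n * δ' ^ 2) →
        ∫⁻ ω, eLpNorm (Ghat ω - G₀) 2 γ ^ 2 ∂μ ≤
          ENNReal.ofReal (C * (δ ^ 2 + δ' ^ 2 + (σ ^ 2 + Finf ^ 2) / n)) +
            8 * ⨅ Gs ∈ 𝒢, eLpNorm (Gs - G₀) 2 γ ^ 2 := by
  refine ⟨riskConst 24, lt_of_lt_of_le (by norm_num) (le_riskConst (K := 24) (by norm_num)), ?_⟩
  intro X Y Ω _ _ _ _ _ _ _ _ _ _ _ _ _ μ _ γ _ n hn σ hσ G₀ hG₀ 𝒢 Ψ Finf x ε Ghat δ δ' hclass hbd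
    hmodel hERM hδ hδ' hcrit hent
  obtain ⟨ω₀⟩ : Nonempty Ω := nonempty_of_isProbabilityMeasure μ
  have hne : γ.support.Nonempty := by
    have h : ∀ᵐ z ∂γ, z ∈ γ.support := Measure.support_mem_ae
    exact h.exists
  have hF0 : 0 ≤ Finf := by
    obtain ⟨z, hz⟩ := hne
    exact (norm_nonneg _).trans (hbd (Ghat ω₀) (hERM.mem ω₀) z hz)
  -- The comparison of norms rescales by the squared bound; if the bound is 0, every map of the
  -- class equals G₀ almost everywhere and the risk vanishes.
  rcases hF0.eq_or_lt with hF | hF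
  · have hzero : ∀ ω, eLpNorm (Ghat ω - G₀) 2 γ = 0 := by
      intro ω
      have h1 : Ghat ω - G₀ =ᵐ[γ] 0 := by
        filter_upwards [Measure.support_mem_ae (μ := γ)] with z hz
        exact norm_le_zero_iff.1 ((hbd (Ghat ω) (hERM.mem ω) z hz).trans_eq hF.symm)
      rw [eLpNorm_congr_ae h1, eLpNorm_zero]
    simp [hzero]
  -- The estimator does not depend on the reference map, so a bound for each one passes to the
  -- infimum.
  · simp only [ENNReal.mul_iInf_of_ne (show (8 : ℝ≥0∞) ≠ 0 by norm_num)
      (show (8 : ℝ≥0∞) ≠ ⊤ by norm_num), ENNReal.add_iInf]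
    refine le_iInf₂ fun Gs hGs => ?_
    rcases hmodel.noise with hnoise | hnoise
    · exact lintegral_risk_le_of_whiteNoise hn hσ hG₀ (hclass Gs hGs) hF hbd hmodel.measurable
        hmodel.law hmodel.indep hnoise hERM hδ hδ' hcrit hent
    · exact lintegral_risk_le_of_subGaussianNoise hn hσ hG₀ (hclass Gs hGs) hF hbd
        hmodel.measurable hmodel.law hmodel.indep hnoise hERM hδ hδ' hcrit hent
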